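/- Let $\mathcal V$ be a complete and cocomplete symmetric monoidal closed category with unit $I$. For a set $S$, let $\mathcal V\mathrm{Quiv}_S$ be the category of families $Q=(Q(a,b))_{a,b\in S}$ of objects of $\mathcal V$, with the monoidal structure $(Q\otimes_S P)(a,b)=\coprod_{c\in S}Q(a,c)\otimes P(c,b)$ and with unit $I_S$, where $I_S(a,a)=I$ and $I_S(a,b)$ is initial for $a\ne b$. Let $\mathbf{fint}$ be the category of intervals $[n]=\{0<\dots<n\}$ ($n\ge 0$) and order morphisms preserving both endpoints, monoidal under $[m]+[n]=[m+n]$. A *templicial object* $(X,S)$ is a set $S$ with a colax monoidal functor $X:\mathbf{fint}^{op}\to\mathcal V\mathrm{Quiv}_S$, with comultiplications $\mu_{k,l}:X_{k+l}\to X_k\otimes_S X_l$, whose counit $X_0\to I_S$ is an isomorphism. A morphism $(X,S)\to(Y,S')$ is a map $f:S\to S'$ with a monoidal natural transformation $f_!X\to Y$, where $f_!$ is left adjoint to the restriction $f^*$ of quivers. This gives the category $\mathrm{ts}\mathcal V$. Let $\mathbf{nec}$ be the category of necklaces $\Delta^{n_1}\vee\dots\vee\Delta^{n_k}$ ($k\ge0$,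 $n_i>0$): a morphism $T\to U$ is an endpoint preserving order morphism on vertices such that every joint of $U$ is the image of a joint of $T$; it is monoidal under $\vee$. Let $\mathcal V\mathrm{Cat}_{\mathbf{nec}}$ be the category of necklace categories, that is, of small categories enriched in $\mathcal V^{\mathbf{nec}^{op}}$ with the Day convolution, and enriched functors. A necklace category $\mathcal C$ with object set $S$ has quivers $\mathcal C_T$, maps $\mathcal C(f):\mathcal C_U\to\mathcal C_T$ for $f:T\to U$, and maps $m:\mathcal C_T\otimes_S\mathcal C_U\to\mathcal C_{T\vee U}$ and $u:I_S\to\mathcal C_{\Delta^0}$ induced by composition and identities. The functor $(-)^{nec}:\mathrm{ts}\mathcal V\to\mathcal V\mathrm{Cat}_{\mathbf{nec}}$ sends $(X,S)$ to the necklace category with object set $S$ and hom-objects $T\mapsto X_T(a,b)$, where $X_T=X_{n_1}\otimes_S\dots\otimes_S X_{n_k}$ for $T=\Delta^{n_1}\vee\dots\vee\Delta^{n_k}$; a map of necklaces acts through the comultiplications, the isomorphism $X_0\cong I_S$ and the functoriality of $X$, and the composition is induced by $X_T\otimes_S X_U\cong X_{T\vee U}$. For a necklace category $\mathcal C$ with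 object set $S$, let $\mathcal C^{temp}$ be the templicial object with vertex set $S$ and with maps $p_n:\mathcal C^{temp}_n\to\mathcal C_{\Delta^n}$ given inductively as follows: $\mathcal C^{temp}_0=I_S$ and $p_0=u$; for $n>0$, $(\mathcal C^{temp}_n,p_n,(\mu_{k,l})_{k,l>0,\,k+l=n})$ is the limit in $\mathcal V\mathrm{Quiv}_S$ of $$\mathcal C_{\Delta^n}\to\prod_{k+l=n}\mathcal C_{\Delta^k\vee\Delta^l}\leftarrow\prod_{k+l=n}\mathcal C^{temp}_k\otimes_S\mathcal C^{temp}_l\rightrightarrows\prod_{r+s+t=n}\mathcal C^{temp}_r\otimes_S\mathcal C^{temp}_s\otimes_S\mathcal C^{temp}_t$$ (all indices positive), with maps given by $\mathcal C(\nu_{k,l})$, where $\nu_{k,l}:\Delta^k\vee\Delta^l\to\Delta^n$ is the identity on vertices, by $m\circ(p_k\otimes p_l)$, and by $\mathrm{id}\otimes\mu_{s,t}$ and $\mu_{r,s}\otimes\mathrm{id}$; the maps $\mu_{0,n}$, $\mu_{n,0}$ are the unit isomorphisms; and, for $f:[m]\to[n]$, the map $\mathcal C^{temp}(f)$ is the one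 that is compatible with the $\mu_{k,l}$ and satisfies $p_m\,\mathcal C^{temp}(f)=\mathcal C(f)\,p_n$. **Theorem.** The functor $(-)^{nec}:\mathrm{ts}\mathcal V\to\mathcal V\mathrm{Cat}_{\mathbf{nec}}$ is fully faithful. For every necklace category $\mathcal C$ the templicial object $\mathcal C^{temp}$ exists, and (for any choice of the limits involved) the assignment $\mathcal C\mapsto\mathcal C^{temp}$ is the object part of a functor $(-)^{temp}:\mathcal V\mathrm{Cat}_{\mathbf{nec}}\to\mathrm{ts}\mathcal V$ that is right adjoint to $(-)^{nec}$. Hence $\mathrm{ts}\mathcal V$ is a coreflective subcategory of $\mathcal V\mathrm{Cat}_{\mathbf{nec}}$. -/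

import Mathlib

open CategoryTheory MonoidalCategory Limits Opposite

universe v u v' u'

set_option linter.all false

noncomputable section

/-- The category of finite intervals: objects `[n] = {0 < ... < n}`, morphisms the order morphisms
preserving both endpoints. -/
structure FInt where
  len : ℕ

namespace FInt

/-- An order morphism `[m] → [n]` with `0 ↦ 0` and `m ↦ n`. -/
@[ext]
structure Hom (m n : FInt) where
  toFun : Fin (m.len + 1) → Fin (n.len + 1)
  monotone : Monotone toFun
  map_zero : toFun 0 = 0
  map_last : toFun (Fin.last _) = Fin.last _

instance : Category FInt where
  Hom := Hom
  id m := ⟨fun i => i, fun _ _ h => h, rfl, rfl⟩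
  comp f g := ⟨fun i => g.toFun (f.toFun i), fun _ _ h => g.monotone (f.monotone h),
    by simp [f.map_zero, g.map_zero], by simp [f.map_last, g.map_last]⟩

/-- The underlying map, extended to all natural numbers by the constant value `n` beyond `m`. -/
def fn {m n : FInt} (f : m ⟶ n) (i : ℕ) : ℕ :=
  (Hom.toFun f ⟨min i m.len, by omega⟩ : Fin (n.len + 1))

variable {m n : FInt}

lemma fn_zero (f : m ⟶ n) : fn f 0 = 0 := by
  have := congrArg Fin.val f.map_zero
  simpa [fn] using this

lemma fn_last (f : m ⟶ n) {i : ℕ} (h : m.len ≤ i) : fn f i = n.len := by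
  have := congrArg Fin.val f.map_last
  rw [← Fin.val_last n.len, ← this, fn]
  congr
  simpa using h

lemma fn_mono (f : m ⟶ n) : Monotone (fn f) := by
  intro i j h
  exact f.monotone (Fin.mk_le_mk.2 (min_le_min_right _ h))

lemma fn_le (f : m ⟶ n) (i : ℕ) : fn f i ≤ n.len :=
  Nat.lt_succ_iff.1 (Fin.is_lt _)

lemma hom_ext {f g : m ⟶ n} (h : ∀ i ≤ m.len, fn f i = fn g i) : f = g := by
  apply Hom.ext
  ext i
  have := h i (by omega)
  simp only [fn] at this
  convert this <;> omega

lemma fn_id (i : ℕ) : fn (𝟙 m) i = min i m.len := rfl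

lemma fn_comp {k : FInt} (f : m ⟶ n) (g : n ⟶ k) (i : ℕ) : fn (f ≫ g) i = fn g (fn f i) := by
  have h : min (fn f i) n.len = fn f i := min_eq_left (fn_le f i)
  change _ = ((Hom.toFun g ⟨min (fn f i) n.len, _⟩ : Fin (k.len + 1)) : ℕ)
  simp only [h]
  rfl

/-- The morphism of `FInt` with a given underlying map on natural numbers. -/
def homMk (φ : ℕ → ℕ) (h0 : φ 0 = 0) (hl : φ m.len = n.len)
    (mono : ∀ i j, i ≤ j → j ≤ m.len → φ i ≤ φ j) : m ⟶ n where
  toFun i := ⟨φ i, by have := mono i m.len (by omega) le_rfl; omega⟩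
  monotone i j h := Fin.mk_le_mk.2 (mono i j h (by omega))
  map_zero := Fin.ext h0
  map_last := Fin.ext hl

lemma fn_homMk (φ : ℕ → ℕ) (h0 hl mono) {i : ℕ} (h : i ≤ m.len) :
    fn (homMk (m := m) (n := n) φ h0 hl mono) i = φ i := by
  simp [fn, homMk, min_eq_left h]

/-- `[m] + [n] = [m + n]`, and `f + g` is `f` on `[0, m]` and `m' + g (- - m)` beyond `m`. -/
def addHom {m m' n n' : FInt} (f : m ⟶ m') (g : n ⟶ n') :
    (⟨m.len + n.len⟩ : FInt) ⟶ ⟨m'.len + n'.len⟩ :=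
  homMk (fun i => if i ≤ m.len then fn f i else m'.len + fn g (i - m.len))
    (by simp [fn_zero])
    (by
      change (if m.len + n.len ≤ m.len then fn f (m.len + n.len)
        else m'.len + fn g (m.len + n.len - m.len)) = m'.len + n'.len
      split_ifs with h
      · have h1 := fn_last f (i := m.len + n.len) (by omega)
        have h2 := fn_last g (i := 0) (by omega)
        rw [fn_zero] at h2
        omega
      · rw [fn_last g (by omega)])
    (by
      intro i j hij _
      have h1 := fn_mono f hij
      have h2 := fn_mono g (Nat.sub_le_sub_right hij m.len)
      have h3 := fn_le f i
      change (if i ≤ m.len then fn f i else m'.len + fn g (i - m.len)) ≤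
        (if j ≤ m.len then fn f j else m'.len + fn g (j - m.len))
      split_ifs
      · exact h1
      · exact h3.trans (Nat.le_add_right _ _)
      · omega
      · exact Nat.add_le_add_left h2 _)

lemma fn_addHom {m m' n n' : FInt} (f : m ⟶ m') (g : n ⟶ n') (i : ℕ) :
    fn (addHom f g) i = fn f i + fn g (i - m.len) := by
  by_cases hi : i ≤ m.len + n.len
  · rw [addHom, fn_homMk _ _ _ _ hi]
    split_ifs with h
    · rw [show i - m.len = 0 by omega, fn_zero, add_zero]
    · rw [fn_last f (by omega)]
  · rw [fn_last _ (by dsimp; omega), fn_last f (by omega), fn_last g (by omega)]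

/-- The identity map `[m] → [n]` for `m = n`. -/
def cast (h : m.len = n.len) : m ⟶ n := homMk id rfl h (fun _ _ h _ => h)

lemma fn_cast (h : m.len = n.len) (i : ℕ) : fn (cast h) i = min i m.len := by
  by_cases hi : i ≤ m.len
  · rw [cast, fn_homMk _ _ _ _ hi, min_eq_left hi]; rfl
  · rw [fn_last _ (by omega), min_eq_right (by omega), h]

/-- `cast` as an isomorphism. -/
def castIso (h : m.len = n.len) : m ≅ n where
  hom := cast h
  inv := cast h.symm
  hom_inv_id := hom_ext fun i hi => by simp only [fn_comp, fn_cast, fn_id]; omega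
  inv_hom_id := hom_ext fun i hi => by simp only [fn_comp, fn_cast, fn_id]; omega

lemma addHom_comp {m m' m'' n n' n'' : FInt} (f : m ⟶ m') (g : n ⟶ n') (f' : m' ⟶ m'')
    (g' : n' ⟶ n'') : addHom f g ≫ addHom f' g' = addHom (f ≫ f') (g ≫ g') :=
  hom_ext fun i hi => by
    simp only [fn_comp, fn_addHom]
    by_cases h : i ≤ m.len
    · have := fn_le f i
      rw [show i - m.len = 0 by omega, fn_zero, add_zero, fn_zero,
        show fn f i - m'.len = 0 by omega, fn_zero]
    · rw [fn_last f (by omega), fn_last f' (by omega), fn_last f' (by omega), Nat.add_sub_cancel_left]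

instance : MonoidalCategoryStruct FInt where
  tensorObj m n := ⟨m.len + n.len⟩
  tensorHom f g := addHom f g
  whiskerLeft m _ _ f := addHom (𝟙 m) f
  whiskerRight f n := addHom f (𝟙 n)
  tensorUnit := ⟨0⟩
  associator _ _ _ := castIso (add_assoc _ _ _)
  leftUnitor _ := castIso (zero_add _)
  rightUnitor _ := castIso (add_zero _)

lemma len_tensor (m n : FInt) : (m ⊗ n).len = m.len + n.len := rfl

lemma len_unit : (𝟙_ FInt).len = 0 := rfl

lemma fn_tensorHom {m m' n n' : FInt} (f : m ⟶ m') (g : n ⟶ n') (i : ℕ) :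
    fn (f ⊗ₘ g) i = fn f i + fn g (i - m.len) := fn_addHom f g i

lemma fn_assoc (m n k : FInt) (i : ℕ) :
    fn (α_ m n k).hom i = min i (m.len + n.len + k.len) :=
  fn_cast (add_assoc _ _ _) _

lemma fn_left (m : FInt) (i : ℕ) : fn (λ_ m).hom i = min i (0 + m.len) :=
  fn_cast (zero_add _) _

lemma fn_right (m : FInt) (i : ℕ) : fn (ρ_ m).hom i = min i (m.len + 0) :=
  fn_cast (add_zero _) _

lemma fn_min (f : m ⟶ n) (i : ℕ) : fn f (min i m.len) = fn f i := by
  simp [fn]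

instance : MonoidalCategory FInt :=
  MonoidalCategory.ofTensorHom
    (id_tensorHom_id := fun _ _ => hom_ext fun i hi => by
      simp only [len_tensor, fn_tensorHom, fn_id]
      omega)
    (tensorHom_comp_tensorHom := fun f g f' g' => (addHom_comp f g f' g'))
    (associator_naturality := fun {X₁ X₂ X₃ Y₁ Y₂ Y₃} f g h => hom_ext fun i hi => by
      simp only [fn_comp, fn_tensorHom, fn_assoc, len_tensor] at hi ⊢
      have h1 := fn_le f i
      have h2 := fn_le g (i - X₁.len)
      have h3 := fn_le h (i - (X₁.len + X₂.len))
      rw [min_eq_left hi, min_eq_left (by omega), Nat.sub_sub, add_assoc])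
    (leftUnitor_naturality := fun {X Y} f => hom_ext fun i hi => by
      simp only [fn_comp, fn_tensorHom, fn_left, fn_id, len_tensor, len_unit] at hi ⊢
      have h1 := fn_le f i
      rw [min_eq_left hi, Nat.sub_zero]
      omega)
    (rightUnitor_naturality := fun {X Y} f => hom_ext fun i hi => by
      simp only [fn_comp, fn_tensorHom, fn_right, fn_id, len_tensor, len_unit] at hi ⊢
      have h1 := fn_le f i
      rw [min_eq_left hi]
      omega)
    (pentagon := fun _ _ _ _ => hom_ext fun i hi => by
      simp only [fn_comp, fn_tensorHom, fn_assoc, fn_id, len_tensor] at hi ⊢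
      omega)
    (triangle := fun _ _ => hom_ext fun i hi => by
      simp only [fn_comp, fn_tensorHom, fn_assoc, fn_left, fn_right, fn_id, len_tensor, len_unit]
        at hi ⊢
      omega)

end FInt

/-- A necklace `Δ^{n₁} ∨ ... ∨ Δ^{nₖ}` (`k ≥ 0`, all `nᵢ > 0`), given by the sizes of its beads. -/
@[ext]
structure Nec where
  beads : List ℕ
  pos : ∀ n ∈ beads, 0 < n

namespace Nec

/-- The vertices of the necklace `T` are `0, ..., T.len`. -/
def len (T : Nec) : ℕ := T.beads.sum

/-- The interval of vertices of a necklace. -/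
abbrev vertices (T : Nec) : FInt := ⟨T.len⟩

/-- The joints of `Δ^{n₁} ∨ ... ∨ Δ^{nₖ}` are the vertices `0, n₁, n₁ + n₂, ..., n₁ + ... + nₖ`. -/
def IsJoint (T : Nec) (j : ℕ) : Prop := ∃ L, L <+: T.beads ∧ L.sum = j

/-- A map of necklaces `T → U` is an endpoint preserving order morphism `f` on vertices such that
every joint of `U` is the image under `f` of a joint of `T`. -/
@[ext]
structure Hom (T U : Nec) where
  toHom : T.vertices ⟶ U.vertices
  joint : ∀ j, U.IsJoint j → ∃ i, T.IsJoint i ∧ FInt.fn toHom i = j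

lemma IsJoint.le {T : Nec} {j : ℕ} (h : T.IsJoint j) : j ≤ T.len := by
  obtain ⟨L, ⟨M, hM⟩, rfl⟩ := h
  simp [len, ← hM]

instance : Category Nec where
  Hom := Hom
  id T := ⟨𝟙 _, fun j hj => ⟨j, hj, by rw [FInt.fn_id, min_eq_left hj.le]⟩⟩
  comp f g := ⟨f.toHom ≫ g.toHom, fun j hj => by
    obtain ⟨i, hi, rfl⟩ := g.joint j hj
    obtain ⟨k, hk, rfl⟩ := f.joint i hi
    exact ⟨k, hk, FInt.fn_comp _ _ _⟩⟩

/-- The map on vertices of a map of necklaces. -/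
def fn {T U : Nec} (f : T ⟶ U) : ℕ → ℕ := FInt.fn (Hom.toHom f)

lemma hom_ext {T U : Nec} {f g : T ⟶ U} (h : ∀ i ≤ T.len, fn f i = fn g i) : f = g :=
  Hom.ext (FInt.hom_ext h)

lemma fn_id (T : Nec) (i : ℕ) : fn (𝟙 T) i = min i T.len := rfl

lemma fn_comp {T U V : Nec} (f : T ⟶ U) (g : U ⟶ V) (i : ℕ) : fn (f ≫ g) i = fn g (fn f i) :=
  FInt.fn_comp _ _ _

lemma fn_zero {T U : Nec} (f : T ⟶ U) : fn f 0 = 0 := FInt.fn_zero _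

lemma fn_last {T U : Nec} (f : T ⟶ U) {i : ℕ} (h : T.len ≤ i) : fn f i = U.len := FInt.fn_last _ h

lemma fn_mono {T U : Nec} (f : T ⟶ U) : Monotone (fn f) := FInt.fn_mono _

lemma fn_le {T U : Nec} (f : T ⟶ U) (i : ℕ) : fn f i ≤ U.len := FInt.fn_le _ _

/-- The wedge of two necklaces. -/
def wedge (T U : Nec) : Nec where
  beads := T.beads ++ U.beads
  pos n hn := (List.mem_append.1 hn).elim (T.pos n) (U.pos n)

lemma len_wedge (T U : Nec) : (wedge T U).len = T.len + U.len := by simp [wedge, len]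

lemma isJoint_wedge {T U : Nec} {j : ℕ} :
    (wedge T U).IsJoint j ↔ T.IsJoint j ∨ ∃ i, U.IsJoint i ∧ j = T.len + i := by
  constructor
  · rintro ⟨L, ⟨M, hM⟩, rfl⟩
    rcases List.append_eq_append_iff.1 hM with ⟨A, h1, h2⟩ | ⟨A, h1, h2⟩
    · exact Or.inl ⟨L, ⟨A, h1.symm⟩, rfl⟩
    · exact Or.inr ⟨A.sum, ⟨A, ⟨M, h2.symm⟩, rfl⟩, by simp [len, h1]⟩
  · rintro (⟨L, hL, rfl⟩ | ⟨i, ⟨L, hL, rfl⟩, rfl⟩)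
    · exact ⟨L, hL.trans (List.prefix_append _ _), rfl⟩
    · exact ⟨T.beads ++ L, (List.prefix_append_right_inj _).2 hL, by simp [len]⟩

/-- The map on vertices of the wedge of two maps. -/
def wedgeFn {T T' U U' : Nec} (f : T ⟶ T') (g : U ⟶ U') :
    (wedge T U).vertices ⟶ (wedge T' U').vertices :=
  (FInt.cast (len_wedge T U) : (wedge T U).vertices ⟶ T.vertices ⊗ U.vertices) ≫
    (Hom.toHom f ⊗ₘ Hom.toHom g) ≫
      (FInt.cast (len_wedge T' U').symm : T'.vertices ⊗ U'.vertices ⟶ (wedge T' U').vertices)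

lemma fn_wedgeFn {T T' U U' : Nec} (f : T ⟶ T') (g : U ⟶ U') (i : ℕ) :
    FInt.fn (wedgeFn f g) i = fn f i + fn g (i - T.len) := by
  have h1 := fn_le f i
  have h2 := fn_le g (i - T.len)
  by_cases hi : i ≤ T.len + U.len
  · rw [wedgeFn, FInt.fn_comp, FInt.fn_comp, FInt.fn_cast, FInt.fn_cast, FInt.fn_tensorHom]
    simp only [len_wedge, min_eq_left hi]
    exact min_eq_left (Nat.add_le_add h1 h2)
  · rw [FInt.fn_last _ (by simp only [len_wedge]; omega), fn_last f (by omega),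
      fn_last g (by omega)]
    exact len_wedge _ _

/-- The wedge of two maps of necklaces; on vertices it is the sum of intervals. -/
def wedgeHom {T T' U U' : Nec} (f : T ⟶ T') (g : U ⟶ U') : wedge T U ⟶ wedge T' U' where
  toHom := wedgeFn f g
  joint j hj := by
    simp only [fn_wedgeFn]
    rcases isJoint_wedge.1 hj with hj | ⟨k, hk, rfl⟩
    · obtain ⟨i, hi, rfl⟩ := f.joint j hj
      refine ⟨i, isJoint_wedge.2 (Or.inl hi), ?_⟩
      rw [Nat.sub_eq_zero_of_le hi.le, fn_zero, add_zero, fn]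
    · obtain ⟨i, hi, rfl⟩ := g.joint k hk
      refine ⟨T.len + i, isJoint_wedge.2 (Or.inr ⟨i, hi, rfl⟩), ?_⟩
      rw [fn_last f (by omega), Nat.add_sub_cancel_left, fn]

lemma fn_wedgeHom {T T' U U' : Nec} (f : T ⟶ T') (g : U ⟶ U') (i : ℕ) :
    fn (wedgeHom f g) i = fn f i + fn g (i - T.len) := fn_wedgeFn f g i

lemma fn_eqToHom {T U : Nec} (h : T = U) (i : ℕ) : fn (eqToHom h) i = min i T.len := by
  subst h; rfl

/-- The wedge is strictly associative and unital, up to the equality of necklaces. -/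
instance : MonoidalCategoryStruct Nec where
  tensorObj := wedge
  tensorHom f g := wedgeHom f g
  whiskerLeft T _ _ f := wedgeHom (𝟙 T) f
  whiskerRight f U := wedgeHom f (𝟙 U)
  tensorUnit := ⟨[], by simp⟩
  associator _ _ _ := eqToIso (Nec.ext (List.append_assoc _ _ _))
  leftUnitor _ := eqToIso (Nec.ext (List.nil_append _))
  rightUnitor _ := eqToIso (Nec.ext (List.append_nil _))

lemma len_tensor (T U : Nec) : (T ⊗ U).len = T.len + U.len := len_wedge T U

lemma len_unit : (𝟙_ Nec).len = 0 := rfl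

lemma fn_tensorHom {T T' U U' : Nec} (f : T ⟶ T') (g : U ⟶ U') (i : ℕ) :
    fn (f ⊗ₘ g) i = fn f i + fn g (i - T.len) := fn_wedgeFn f g i

lemma fn_assoc (T U V : Nec) (i : ℕ) :
    fn (α_ T U V).hom i = min i (T.len + U.len + V.len) := by
  rw [← len_tensor, ← len_tensor]
  exact fn_eqToHom (Nec.ext (List.append_assoc _ _ _)) _

lemma fn_left (T : Nec) (i : ℕ) : fn (λ_ T).hom i = min i T.len := by
  have := fn_eqToHom (Nec.ext (List.nil_append _) : 𝟙_ Nec ⊗ T = T) i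
  rw [len_tensor, len_unit, zero_add] at this
  exact this

lemma fn_right (T : Nec) (i : ℕ) : fn (ρ_ T).hom i = min i T.len := by
  have := fn_eqToHom (Nec.ext (List.append_nil _) : T ⊗ 𝟙_ Nec = T) i
  rw [len_tensor, len_unit, add_zero] at this
  exact this

instance : MonoidalCategory Nec :=
  MonoidalCategory.ofTensorHom
    (id_tensorHom_id := fun _ _ => hom_ext fun i hi => by
      simp only [len_tensor, fn_tensorHom, fn_id]
      omega)
    (tensorHom_comp_tensorHom := fun {X₁ Y₁ Z₁ X₂ Y₂ Z₂} f g f' g' => hom_ext fun i hi => by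
      simp only [fn_comp, fn_tensorHom]
      by_cases h : i ≤ X₁.len
      · have := fn_le f i
        rw [Nat.sub_eq_zero_of_le h, fn_zero, add_zero, fn_zero,
          Nat.sub_eq_zero_of_le this, fn_zero]
      · rw [fn_last f (by omega), fn_last f' (by omega), fn_last f' (by omega),
          Nat.add_sub_cancel_left])
    (associator_naturality := fun {X₁ X₂ X₃ Y₁ Y₂ Y₃} f g h => hom_ext fun i hi => by
      simp only [fn_comp, fn_tensorHom, fn_assoc, len_tensor] at hi ⊢
      have h1 := fn_le f i
      have h2 := fn_le g (i - X₁.len)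
      have h3 := fn_le h (i - (X₁.len + X₂.len))
      rw [min_eq_left hi, min_eq_left (by omega), Nat.sub_sub, add_assoc])
    (leftUnitor_naturality := fun {X Y} f => hom_ext fun i hi => by
      simp only [fn_comp, fn_tensorHom, fn_left, fn_id, len_tensor, len_unit] at hi ⊢
      have h1 := fn_le f i
      rw [min_eq_left (by omega : i ≤ X.len), Nat.sub_zero]
      omega)
    (rightUnitor_naturality := fun {X Y} f => hom_ext fun i hi => by
      simp only [fn_comp, fn_tensorHom, fn_right, fn_id, len_tensor, len_unit] at hi ⊢
      have h1 := fn_le f i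
      rw [min_eq_left (by omega : i ≤ X.len)]
      omega)
    (pentagon := fun _ _ _ _ => hom_ext fun i hi => by
      simp only [fn_comp, fn_tensorHom, fn_assoc, fn_id, len_tensor] at hi ⊢
      omega)
    (triangle := fun _ _ => hom_ext fun i hi => by
      simp only [fn_comp, fn_tensorHom, fn_assoc, fn_left, fn_right, fn_id, len_tensor, len_unit]
        at hi ⊢
      omega)

end Nec

section Coproducts

variable {V : Type u} [Category.{v} V] [MonoidalCategory V] [SymmetricCategory V]
  [MonoidalClosed V] {ι : Type v} {f : ι → V} [HasCoproduct f] {R Z : V}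

/-- The tensor product preserves coproducts in its first variable: maps out of `(∐ f) ⊗ R`. -/
def sigmaDescRight (g : ∀ i, f i ⊗ R ⟶ Z) : (∐ f) ⊗ R ⟶ Z :=
  Cofan.IsColimit.desc (isColimitOfHasCoproductOfPreservesColimit (tensorRight R) f) g

lemma ι_sigmaDescRight (g : ∀ i, f i ⊗ R ⟶ Z) (i : ι) :
    Sigma.ι f i ▷ R ≫ sigmaDescRight g = g i :=
  Cofan.IsColimit.fac (isColimitOfHasCoproductOfPreservesColimit (tensorRight R) f) g i

lemma sigma_ext_right {g h : (∐ f) ⊗ R ⟶ Z} (e : ∀ i, Sigma.ι f i ▷ R ≫ g = Sigma.ι f i ▷ R ≫ h) :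
    g = h :=
  Cofan.IsColimit.hom_ext (isColimitOfHasCoproductOfPreservesColimit (tensorRight R) f) g h e

/-- The tensor product preserves coproducts in its second variable: maps out of `R ⊗ (∐ f)`. -/
def sigmaDescLeft (g : ∀ i, R ⊗ f i ⟶ Z) : R ⊗ (∐ f) ⟶ Z :=
  Cofan.IsColimit.desc (isColimitOfHasCoproductOfPreservesColimit (tensorLeft R) f) g

lemma ι_sigmaDescLeft (g : ∀ i, R ⊗ f i ⟶ Z) (i : ι) :
    R ◁ Sigma.ι f i ≫ sigmaDescLeft g = g i :=
  Cofan.IsColimit.fac (isColimitOfHasCoproductOfPreservesColimit (tensorLeft R) f) g i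

lemma sigma_ext_left {g h : R ⊗ (∐ f) ⟶ Z} (e : ∀ i, R ◁ Sigma.ι f i ≫ g = R ◁ Sigma.ι f i ≫ h) :
    g = h :=
  Cofan.IsColimit.hom_ext (isColimitOfHasCoproductOfPreservesColimit (tensorLeft R) f) g h e

end Coproducts

/-- A `V`-enriched quiver with set of vertices `S`. -/
structure VQuiv (V : Type u) (S : Type v) where
  obj : S → S → V

namespace VQuiv

variable {V : Type u} [Category.{v} V] {S : Type v}

/-- A morphism of quivers over a fixed set of vertices. -/
@[ext]
structure Hom (Q P : VQuiv V S) where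
  app (a b : S) : Q.obj a b ⟶ P.obj a b

instance : Category (VQuiv V S) where
  Hom := Hom
  id Q := ⟨fun _ _ => 𝟙 _⟩
  comp f g := ⟨fun a b => f.app a b ≫ g.app a b⟩

/-- The components of a morphism of quivers. -/
abbrev app {Q P : VQuiv V S} (f : Q ⟶ P) (a b : S) : Q.obj a b ⟶ P.obj a b := Hom.app f a b

lemma hom_ext {Q P : VQuiv V S} {f g : Q ⟶ P} (h : ∀ a b, app f a b = app g a b) : f = g :=
  Hom.ext (funext fun a => funext fun b => h a b)

@[simp]
lemma app_id (Q : VQuiv V S) (a b : S) : app (𝟙 Q) a b = 𝟙 _ := rfl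

@[simp]
lemma app_comp {Q P R : VQuiv V S} (f : Q ⟶ P) (g : P ⟶ R) (a b : S) :
    app (f ≫ g) a b = app f a b ≫ app g a b := rfl

/-- A family of isomorphisms is an isomorphism of quivers. -/
def isoMk {Q P : VQuiv V S} (e : ∀ a b, Q.obj a b ≅ P.obj a b) : Q ≅ P where
  hom := ⟨fun a b => (e a b).hom⟩
  inv := ⟨fun a b => (e a b).inv⟩
  hom_inv_id := hom_ext fun a b => (e a b).hom_inv_id
  inv_hom_id := hom_ext fun a b => (e a b).inv_hom_id

variable [MonoidalCategory V] [SymmetricCategory V] [MonoidalClosed V] [HasColimits V]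

/-- `(Q ⊗ P)(a, b) = ∐ c, Q(a, c) ⊗ P(c, b)`. -/
def tensor (Q P : VQuiv V S) : VQuiv V S where
  obj a b := ∐ fun c => Q.obj a c ⊗ P.obj c b

variable (V S) in
/-- `I_S(a, b)` is the coproduct of copies of the unit indexed by the proofs of `a = b`, that is,
the unit if `a = b` and the initial object otherwise. -/
def unit : VQuiv V S where
  obj a b := ∐ fun _ : ULift.{v} (PLift (a = b)) => 𝟙_ V

/-- The coprojections of the tensor product. -/
def tι (Q P : VQuiv V S) (a c b : S) : Q.obj a c ⊗ P.obj c b ⟶ (tensor Q P).obj a b :=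
  Sigma.ι (fun c => Q.obj a c ⊗ P.obj c b) c

/-- The coprojections of the unit quiver; `uι rfl` is the isomorphism `I ≅ I_S(a, a)`. -/
def uι {a b : S} (e : a = b) : 𝟙_ V ⟶ (unit V S).obj a b :=
  Sigma.ι (fun _ : ULift.{v} (PLift (a = b)) => 𝟙_ V) ⟨⟨e⟩⟩

section ext

variable {Q P R T : VQuiv V S} {a b c d : S} {Y Z : V}

lemma tensor_ext {f g : (tensor Q P).obj a b ⟶ Z} (h : ∀ c, tι Q P a c b ≫ f = tι Q P a c b ≫ g) :
    f = g := Sigma.hom_ext _ _ h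

lemma tensor_ext_right {f g : (tensor Q P).obj a b ⊗ Y ⟶ Z}
    (h : ∀ c, tι Q P a c b ▷ Y ≫ f = tι Q P a c b ▷ Y ≫ g) : f = g := sigma_ext_right h

lemma tensor_ext_left {f g : Y ⊗ (tensor Q P).obj a b ⟶ Z}
    (h : ∀ c, Y ◁ tι Q P a c b ≫ f = Y ◁ tι Q P a c b ≫ g) : f = g := sigma_ext_left h

lemma unit_ext {f g : (unit V S).obj a b ⟶ Z} (h : ∀ e : a = b, uι e ≫ f = uι e ≫ g) : f = g :=
  Sigma.hom_ext _ _ fun ⟨⟨e⟩⟩ => h e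

lemma unit_ext_right {f g : (unit V S).obj a b ⊗ Y ⟶ Z}
    (h : ∀ e : a = b, uι e ▷ Y ≫ f = uι e ▷ Y ≫ g) : f = g :=
  sigma_ext_right fun ⟨⟨e⟩⟩ => h e

lemma unit_ext_left {f g : Y ⊗ (unit V S).obj a b ⟶ Z}
    (h : ∀ e : a = b, Y ◁ uι e ≫ f = Y ◁ uι e ≫ g) : f = g :=
  sigma_ext_left fun ⟨⟨e⟩⟩ => h e

/-- Maps out of the tensor product. -/
def tdesc (g : ∀ c, Q.obj a c ⊗ P.obj c b ⟶ Z) : (tensor Q P).obj a b ⟶ Z := Sigma.desc g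

@[simp]
lemma tι_tdesc (g : ∀ c, Q.obj a c ⊗ P.obj c b ⟶ Z) (c : S) :
    tι Q P a c b ≫ tdesc g = g c := Sigma.ι_desc _ _

@[simp]
lemma tι_tdesc_assoc (g : ∀ c, Q.obj a c ⊗ P.obj c b ⟶ Z) (c : S) {Z' : V} (h : Z ⟶ Z') :
    tι Q P a c b ≫ tdesc g ≫ h = g c ≫ h := by
  rw [← Category.assoc, tι_tdesc]

/-- Maps out of the unit. -/
def udesc (g : ∀ e : a = b, 𝟙_ V ⟶ Z) : (unit V S).obj a b ⟶ Z := Sigma.desc fun e => g e.down.down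

@[simp]
lemma uι_udesc (g : ∀ e : a = b, 𝟙_ V ⟶ Z) (e : a = b) : uι e ≫ udesc g = g e := Sigma.ι_desc _ _

@[simp]
lemma uι_udesc_assoc (g : ∀ e : a = b, 𝟙_ V ⟶ Z) (e : a = b) {Z' : V} (h : Z ⟶ Z') :
    uι e ≫ udesc g ≫ h = g e ≫ h := by
  rw [← Category.assoc, uι_udesc]

/-- Maps out of `(Q ⊗ P)(a, b) ⊗ Y`. -/
def tdescR (g : ∀ c, (Q.obj a c ⊗ P.obj c b) ⊗ Y ⟶ Z) : (tensor Q P).obj a b ⊗ Y ⟶ Z :=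
  sigmaDescRight g

@[simp]
lemma tι_tdescR (g : ∀ c, (Q.obj a c ⊗ P.obj c b) ⊗ Y ⟶ Z) (c : S) :
    tι Q P a c b ▷ Y ≫ tdescR g = g c := ι_sigmaDescRight _ _

@[simp]
lemma tι_tdescR_assoc (g : ∀ c, (Q.obj a c ⊗ P.obj c b) ⊗ Y ⟶ Z) (c : S) {Z' : V} (h : Z ⟶ Z') :
    tι Q P a c b ▷ Y ≫ tdescR g ≫ h = g c ≫ h := by
  rw [← Category.assoc, tι_tdescR]

/-- Maps out of `Y ⊗ (Q ⊗ P)(a, b)`. -/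
def tdescL (g : ∀ c, Y ⊗ (Q.obj a c ⊗ P.obj c b) ⟶ Z) : Y ⊗ (tensor Q P).obj a b ⟶ Z :=
  sigmaDescLeft g

@[simp]
lemma tι_tdescL (g : ∀ c, Y ⊗ (Q.obj a c ⊗ P.obj c b) ⟶ Z) (c : S) :
    Y ◁ tι Q P a c b ≫ tdescL g = g c := ι_sigmaDescLeft _ _

@[simp]
lemma tι_tdescL_assoc (g : ∀ c, Y ⊗ (Q.obj a c ⊗ P.obj c b) ⟶ Z) (c : S) {Z' : V} (h : Z ⟶ Z') :
    Y ◁ tι Q P a c b ≫ tdescL g ≫ h = g c ≫ h := by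
  rw [← Category.assoc, tι_tdescL]

/-- Maps out of `I_S(a, b) ⊗ Y`. -/
def udescR (g : ∀ e : a = b, 𝟙_ V ⊗ Y ⟶ Z) : (unit V S).obj a b ⊗ Y ⟶ Z :=
  sigmaDescRight fun e => g e.down.down

@[simp]
lemma uι_udescR (g : ∀ e : a = b, 𝟙_ V ⊗ Y ⟶ Z) (e : a = b) :
    uι e ▷ Y ≫ udescR g = g e := ι_sigmaDescRight (fun e => g e.down.down) _

@[simp]
lemma uι_udescR_assoc (g : ∀ e : a = b, 𝟙_ V ⊗ Y ⟶ Z) (e : a = b) {Z' : V} (h : Z ⟶ Z') :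
    uι e ▷ Y ≫ udescR g ≫ h = g e ≫ h := by
  rw [← Category.assoc, uι_udescR]

/-- Maps out of `Y ⊗ I_S(a, b)`. -/
def udescL (g : ∀ e : a = b, Y ⊗ 𝟙_ V ⟶ Z) : Y ⊗ (unit V S).obj a b ⟶ Z :=
  sigmaDescLeft fun e => g e.down.down

@[simp]
lemma uι_udescL (g : ∀ e : a = b, Y ⊗ 𝟙_ V ⟶ Z) (e : a = b) :
    Y ◁ uι e ≫ udescL g = g e := ι_sigmaDescLeft (fun e => g e.down.down) _

@[simp]
lemma uι_udescL_assoc (g : ∀ e : a = b, Y ⊗ 𝟙_ V ⟶ Z) (e : a = b) {Z' : V} (h : Z ⟶ Z') :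
    Y ◁ uι e ≫ udescL g ≫ h = g e ≫ h := by
  rw [← Category.assoc, uι_udescL]

end ext

/-- The tensor product of two morphisms of quivers. -/
def tensorMap {Q Q' P P' : VQuiv V S} (f : Q ⟶ Q') (g : P ⟶ P') : tensor Q P ⟶ tensor Q' P' where
  app a b := tdesc fun c => (app f a c ⊗ₘ app g c b) ≫ tι Q' P' a c b

/-- The associator of quivers. -/
def assoc (Q P R : VQuiv V S) : tensor (tensor Q P) R ≅ tensor Q (tensor P R) :=
  isoMk fun a b =>
    { hom := tdesc fun d => tdescR fun c =>
        (α_ _ _ _).hom ≫ Q.obj a c ◁ tι P R c d b ≫ tι Q (tensor P R) a c b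
      inv := tdesc fun c => tdescL fun d =>
        (α_ _ _ _).inv ≫ tι Q P a c d ▷ R.obj d b ≫ tι (tensor Q P) R a d b
      hom_inv_id := tensor_ext fun d => tensor_ext_right fun c => by simp
      inv_hom_id := tensor_ext fun c => tensor_ext_left fun d => by simp }

/-- The left unitor of quivers. -/
def leftUnit (Q : VQuiv V S) : tensor (unit V S) Q ≅ Q :=
  isoMk fun a b =>
    { hom := tdesc fun c => udescR fun e => (λ_ _).hom ≫ eqToHom (by rw [e])
      inv := (λ_ _).inv ≫ uι rfl ▷ _ ≫ tι (unit V S) Q a a b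
      hom_inv_id := tensor_ext fun c => unit_ext_right fun e => by subst e; simp
      inv_hom_id := by simp }

/-- The right unitor of quivers. -/
def rightUnit (Q : VQuiv V S) : tensor Q (unit V S) ≅ Q :=
  isoMk fun a b =>
    { hom := tdesc fun c => udescL fun e => (ρ_ _).hom ≫ eqToHom (by rw [e])
      inv := (ρ_ _).inv ≫ _ ◁ uι rfl ≫ tι Q (unit V S) a b b
      hom_inv_id := tensor_ext fun c => unit_ext_left fun e => by subst e; simp
      inv_hom_id := by simp }

instance : MonoidalCategoryStruct (VQuiv V S) where
  tensorObj := tensor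
  tensorHom := tensorMap
  whiskerLeft Q _ _ f := tensorMap (𝟙 Q) f
  whiskerRight f Q := tensorMap f (𝟙 Q)
  tensorUnit := unit V S
  associator := assoc
  leftUnitor := leftUnit
  rightUnitor := rightUnit

section lemmas

variable {Q Q' P P' R : VQuiv V S} (a b c d : S) {Z : V}

/-- The coprojections of the tensor product. -/
def inj (Q P : VQuiv V S) (a c b : S) : Q.obj a c ⊗ P.obj c b ⟶ (Q ⊗ P).obj a b := tι Q P a c b

/-- The coprojections of the unit. -/
def uinj {a b : S} (e : a = b) : 𝟙_ V ⟶ (𝟙_ (VQuiv V S)).obj a b := uι e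

@[simp]
lemma inj_tensorHom (f : Q ⟶ Q') (g : P ⟶ P') :
    inj Q P a c b ≫ app (f ⊗ₘ g) a b = (app f a c ⊗ₘ app g c b) ≫ inj Q' P' a c b :=
  tι_tdesc _ _

@[simp]
lemma inj_tensorHom_assoc (f : Q ⟶ Q') (g : P ⟶ P') (h : (Q' ⊗ P').obj a b ⟶ Z) :
    inj Q P a c b ≫ app (f ⊗ₘ g) a b ≫ h = (app f a c ⊗ₘ app g c b) ≫ inj Q' P' a c b ≫ h := by
  rw [← Category.assoc, inj_tensorHom, Category.assoc]

lemma inj_whiskerRight_tensorHom (f : Q ⟶ Q') (g : P ⟶ P') {Y Y' : V} (k : Y ⟶ Y') :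
    inj Q P a c b ▷ Y ≫ (app (f ⊗ₘ g) a b ⊗ₘ k) =
      ((app f a c ⊗ₘ app g c b) ⊗ₘ k) ≫ inj Q' P' a c b ▷ Y' := by
  rw [← tensorHom_id, tensorHom_comp_tensorHom, inj_tensorHom, ← tensorHom_id,
    tensorHom_comp_tensorHom, Category.id_comp, Category.comp_id]

lemma inj_whiskerLeft_tensorHom (f : Q ⟶ Q') (g : P ⟶ P') {Y Y' : V} (k : Y ⟶ Y') :
    Y ◁ inj Q P a c b ≫ (k ⊗ₘ app (f ⊗ₘ g) a b) =
      (k ⊗ₘ (app f a c ⊗ₘ app g c b)) ≫ Y' ◁ inj Q' P' a c b := by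
  rw [← id_tensorHom, tensorHom_comp_tensorHom, inj_tensorHom, ← id_tensorHom,
    tensorHom_comp_tensorHom, Category.id_comp, Category.comp_id]

@[simp]
lemma inj_associator_hom :
    inj Q P a c d ▷ R.obj d b ≫ inj (Q ⊗ P) R a d b ≫ app (α_ Q P R).hom a b =
      (α_ _ _ _).hom ≫ Q.obj a c ◁ inj P R c d b ≫ inj Q (P ⊗ R) a c b := by
  have h1 : inj (Q ⊗ P) R a d b ≫ app (α_ Q P R).hom a b = _ := tι_tdesc _ _
  rw [h1]
  exact tι_tdescR _ _

@[simp]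
lemma inj_leftUnitor_hom :
    uinj rfl ▷ Q.obj a b ≫ inj (𝟙_ _) Q a a b ≫ app (λ_ Q).hom a b = (λ_ _).hom := by
  have h1 : inj (𝟙_ _) Q a a b ≫ app (λ_ Q).hom a b = _ := tι_tdesc _ _
  rw [h1]
  exact (uι_udescR _ _).trans (by simp)

@[simp]
lemma inj_rightUnitor_hom :
    Q.obj a b ◁ uinj rfl ≫ inj Q (𝟙_ _) a b b ≫ app (ρ_ Q).hom a b = (ρ_ _).hom := by
  have h1 : inj Q (𝟙_ _) a b b ≫ app (ρ_ Q).hom a b = _ := tι_tdesc _ _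
  rw [h1]
  exact (uι_udescL _ _).trans (by simp)

end lemmas

section ext

variable {Q P R T : VQuiv V S} {a b c d : S} {Y Z : V}

lemma inj_ext {f g : (Q ⊗ P).obj a b ⟶ Z} (h : ∀ c, inj Q P a c b ≫ f = inj Q P a c b ≫ g) :
    f = g := tensor_ext h

lemma inj_ext_right {f g : (Q ⊗ P).obj a b ⊗ Y ⟶ Z}
    (h : ∀ c, inj Q P a c b ▷ Y ≫ f = inj Q P a c b ▷ Y ≫ g) : f = g := tensor_ext_right h

lemma inj_ext_left {f g : Y ⊗ (Q ⊗ P).obj a b ⟶ Z}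
    (h : ∀ c, Y ◁ inj Q P a c b ≫ f = Y ◁ inj Q P a c b ≫ g) : f = g := tensor_ext_left h

lemma inj_ext_right_right {Y' : V} {f g : ((Q ⊗ P).obj a b ⊗ Y) ⊗ Y' ⟶ Z}
    (h : ∀ c, inj Q P a c b ▷ Y ▷ Y' ≫ f = inj Q P a c b ▷ Y ▷ Y' ≫ g) : f = g := by
  rw [← cancel_epi (α_ _ _ _).inv]
  refine inj_ext_right fun c => ?_
  rw [associator_inv_naturality_left_assoc, associator_inv_naturality_left_assoc, h]

lemma uinj_ext {f g : (𝟙_ (VQuiv V S)).obj a b ⟶ Z}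
    (h : ∀ e : a = b, uinj e ≫ f = uinj e ≫ g) : f = g := unit_ext h

lemma uinj_ext_right {f g : (𝟙_ (VQuiv V S)).obj a b ⊗ Y ⟶ Z}
    (h : ∀ e : a = b, uinj e ▷ Y ≫ f = uinj e ▷ Y ≫ g) : f = g := unit_ext_right h

lemma uinj_ext_left {f g : Y ⊗ (𝟙_ (VQuiv V S)).obj a b ⟶ Z}
    (h : ∀ e : a = b, Y ◁ uinj e ≫ f = Y ◁ uinj e ≫ g) : f = g := unit_ext_left h

lemma inj_ext_unit {Y' : V} {f g : (Y' ⊗ (𝟙_ (VQuiv V S)).obj a b) ⊗ Y ⟶ Z}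
    (h : ∀ e : a = b, (Y' ◁ uinj e) ▷ Y ≫ f = (Y' ◁ uinj e) ▷ Y ≫ g) : f = g := by
  have h' : (β_ _ _).hom ▷ Y ≫ f = (β_ _ _).hom ▷ Y ≫ g := by
    rw [← cancel_epi (α_ _ _ _).inv]
    refine uinj_ext_right fun e => ?_
    rw [associator_inv_naturality_left_assoc, associator_inv_naturality_left_assoc]
    have := BraidedCategory.braiding_naturality_left (uinj (V := V) e) Y'
    have := congrArg (fun t => t ▷ Y) this
    simp only [comp_whiskerRight] at this
    rw [reassoc_of% this, reassoc_of% this, h e]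
  exact (cancel_epi _).1 h'

end ext

instance : MonoidalCategory (VQuiv V S) :=
  MonoidalCategory.ofTensorHom
    (id_tensorHom_id := fun _ _ => hom_ext fun a b => inj_ext fun c => by simp)
    (tensorHom_comp_tensorHom := fun f g f' g' => hom_ext fun a b => inj_ext fun c => by simp)
    (associator_naturality := fun f g h => hom_ext fun a b =>
      inj_ext fun d => inj_ext_right fun c => by
        simp only [app_comp, inj_tensorHom_assoc]
        rw [← Category.assoc, inj_whiskerRight_tensorHom, Category.assoc, inj_associator_hom,
          reassoc_of% (inj_associator_hom (Q := _) (P := _) (R := _) a b c d), inj_tensorHom,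
          ← Category.assoc (_ ◁ _), inj_whiskerLeft_tensorHom]
        simp)
    (leftUnitor_naturality := fun {X Y} f => hom_ext fun a b =>
      inj_ext fun d => uinj_ext_right fun e => by
        subst e
        simp only [app_comp, inj_tensorHom_assoc, app_id, id_tensorHom]
        rw [← whisker_exchange_assoc, inj_leftUnitor_hom, reassoc_of% (inj_leftUnitor_hom (Q := X) a b)]
        simp)
    (rightUnitor_naturality := fun {X Y} f => hom_ext fun a b =>
      inj_ext fun d => uinj_ext_left fun e => by
        subst e
        simp only [app_comp, inj_tensorHom_assoc, app_id, tensorHom_id]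
        rw [whisker_exchange_assoc, inj_rightUnitor_hom, reassoc_of% (inj_rightUnitor_hom (Q := X) a d)]
        simp)
    (pentagon := fun W X Y Z => hom_ext fun a b =>
      inj_ext fun e => inj_ext_right fun d => inj_ext_right_right fun c => by
        simp only [app_comp, inj_tensorHom_assoc, app_id, id_tensorHom, tensorHom_id, inj_tensorHom]
        have h1 := congrArg (fun t => t ▷ Z.obj e b)
          (inj_associator_hom (Q := W) (P := X) (R := Y) a e c d)
        have h2 := inj_associator_hom (Q := W) (P := X ⊗ Y) (R := Z) a b c e
        have h3 := congrArg (fun t => W.obj a c ◁ t)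
          (inj_associator_hom (Q := X) (P := Y) (R := Z) c b d e)
        have h4 := inj_associator_hom (Q := W ⊗ X) (P := Y) (R := Z) a b d e
        have h5 := inj_associator_hom (Q := W) (P := X) (R := Y ⊗ Z) a b c d
        simp only [comp_whiskerRight, Category.assoc, MonoidalCategory.whiskerLeft_comp] at h1 h3
        rw [reassoc_of% h1, reassoc_of% h2, inj_tensorHom, app_id, id_tensorHom, reassoc_of% h4,
          associator_naturality_left_assoc, ← whisker_exchange_assoc, h5,
          associator_naturality_middle_assoc, reassoc_of% h3]
        simp)
    (triangle := fun X Y => hom_ext fun a b =>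
      inj_ext fun d => inj_ext_right fun c => inj_ext_unit fun e => by
        subst e
        simp only [app_comp, inj_tensorHom, app_id, id_tensorHom, tensorHom_id]
        have h1 := inj_associator_hom (Q := X) (P := 𝟙_ _) (R := Y) a b c c
        have h2 := congrArg (fun t => X.obj a c ◁ t) (inj_leftUnitor_hom (Q := Y) c b)
        have h3 := congrArg (fun t => t ▷ Y.obj c b) (inj_rightUnitor_hom (Q := X) a c)
        simp only [comp_whiskerRight, Category.assoc, MonoidalCategory.whiskerLeft_comp] at h2 h3
        rw [reassoc_of% h1, inj_tensorHom, app_id, id_tensorHom, associator_naturality_middle_assoc,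
          reassoc_of% h2, reassoc_of% h3, triangle_assoc])

end VQuiv

namespace VQuiv

variable {V : Type u} [Category.{v} V] {S T R : Type v}

variable (V) in
/-- The restriction `f^*` of quivers along a map `f` of sets of vertices. -/
def pullback (f : S → T) : VQuiv V T ⥤ VQuiv V S where
  obj Q := ⟨fun a b => Q.obj (f a) (f b)⟩
  map g := ⟨fun a b => app g (f a) (f b)⟩

@[simp]
lemma app_pullback_map (f : S → T) {Q P : VQuiv V T} (g : Q ⟶ P) (a b : S) :
    app ((pullback V f).map g) a b = app g (f a) (f b) := rfl

variable [MonoidalCategory V] [SymmetricCategory V] [MonoidalClosed V] [HasColimits V]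

/-- The canonical map `f^*Q ⊗ f^*P → f^*(Q ⊗ P)`. -/
def pullMul (f : S → T) (Q P : VQuiv V T) :
    (pullback V f).obj Q ⊗ (pullback V f).obj P ⟶ (pullback V f).obj (Q ⊗ P) where
  app a b := tdesc fun c => inj Q P (f a) (f c) (f b)

variable (V) in
/-- The canonical map `I_S → f^* I_T`. -/
def pullUnit (f : S → T) : 𝟙_ (VQuiv V S) ⟶ (pullback V f).obj (𝟙_ (VQuiv V T)) where
  app a b := udesc fun e => uinj (congrArg f e)

@[simp]
lemma inj_pullMul (f : S → T) (Q P : VQuiv V T) (a c b : S) :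
    inj ((pullback V f).obj Q) ((pullback V f).obj P) a c b ≫ app (pullMul f Q P) a b =
      inj Q P (f a) (f c) (f b) := tι_tdesc _ _

@[simp]
lemma inj_pullMul_assoc (f : S → T) (Q P : VQuiv V T) (a c b : S) {Z : V}
    (h : ((pullback V f).obj (Q ⊗ P)).obj a b ⟶ Z) :
    inj ((pullback V f).obj Q) ((pullback V f).obj P) a c b ≫ app (pullMul f Q P) a b ≫ h =
      inj Q P (f a) (f c) (f b) ≫ h := by
  rw [← Category.assoc, inj_pullMul]
  rfl

@[simp]
lemma uinj_pullUnit (f : S → T) {a b : S} (e : a = b) :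
    uinj e ≫ app (pullUnit V f) a b = uinj (congrArg f e) :=
  uι_udesc (fun e : a = b => uinj (V := V) (congrArg f e)) e

lemma comp_whiskerRight_eq {A B C E : V} {x : A ⟶ B} {y : B ⟶ C} {z : A ⟶ C} (h : x ≫ y = z) (D : V)
    (k : C ⊗ D ⟶ E) : x ▷ D ≫ y ▷ D ≫ k = z ▷ D ≫ k := by
  rw [← h, comp_whiskerRight, Category.assoc]

lemma comp_whiskerLeft_eq {A B C E : V} {x : A ⟶ B} {y : B ⟶ C} {z : A ⟶ C} (h : x ≫ y = z) (D : V)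
    (k : D ⊗ C ⟶ E) : D ◁ x ≫ D ◁ y ≫ k = D ◁ z ≫ k := by
  rw [← h, MonoidalCategory.whiskerLeft_comp, Category.assoc]

lemma inj_whiskerLeft (Q : VQuiv V S) {P P' : VQuiv V S} (g : P ⟶ P') (a c b : S) {Z : V}
    (h : (Q ⊗ P').obj a b ⟶ Z) :
    inj Q P a c b ≫ app (Q ◁ g) a b ≫ h = Q.obj a c ◁ app g c b ≫ inj Q P' a c b ≫ h := by
  rw [← id_tensorHom, inj_tensorHom_assoc, app_id, id_tensorHom]

lemma inj_whiskerRight {Q Q' : VQuiv V S} (g : Q ⟶ Q') (P : VQuiv V S) (a c b : S) {Z : V}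
    (h : (Q' ⊗ P).obj a b ⟶ Z) :
    inj Q P a c b ≫ app (g ▷ P) a b ≫ h = app g a c ▷ P.obj c b ≫ inj Q' P a c b ≫ h := by
  rw [← tensorHom_id, inj_tensorHom_assoc, app_id, tensorHom_id]

lemma inj_whiskerLeft' (Q : VQuiv V S) {P P' : VQuiv V S} (g : P ⟶ P') (a c b : S) :
    inj Q P a c b ≫ app (Q ◁ g) a b = Q.obj a c ◁ app g c b ≫ inj Q P' a c b := by
  rw [← id_tensorHom, inj_tensorHom, app_id, id_tensorHom]

lemma inj_whiskerRight' {Q Q' : VQuiv V S} (g : Q ⟶ Q') (P : VQuiv V S) (a c b : S) :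
    inj Q P a c b ≫ app (g ▷ P) a b = app g a c ▷ P.obj c b ≫ inj Q' P a c b := by
  rw [← tensorHom_id, inj_tensorHom, app_id, tensorHom_id]

instance (f : S → T) : (pullback V f).LaxMonoidal where
  ε := pullUnit V f
  μ := pullMul f
  μ_natural_left {Q Q'} g P := hom_ext fun a b => inj_ext fun c => by
    simp only [app_comp, inj_whiskerRight, inj_pullMul, inj_pullMul_assoc, app_pullback_map]
    refine (inj_whiskerRight' g P (f a) (f c) (f b)).symm.trans ?_
    exact (inj_pullMul_assoc f Q P a c b (app (g ▷ P) (f a) (f b))).symm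
  μ_natural_right {Q Q'} P g := hom_ext fun a b => inj_ext fun c => by
    simp only [app_comp, inj_whiskerLeft, inj_pullMul, inj_pullMul_assoc, app_pullback_map]
    refine (inj_whiskerLeft' P g (f a) (f c) (f b)).symm.trans ?_
    exact (inj_pullMul_assoc f P Q a c b (app (P ◁ g) (f a) (f b))).symm
  associativity Q P R := hom_ext fun a b => inj_ext fun d => inj_ext_right fun c => by
    simp only [app_comp, inj_whiskerRight]
    rw [reassoc_of% (inj_associator_hom (Q := (pullback V f).obj Q) (P := (pullback V f).obj P)
      (R := (pullback V f).obj R) a b c d), inj_whiskerLeft, inj_pullMul]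
    refine (comp_whiskerRight_eq (inj_pullMul f Q P a c d) _ _).trans ?_
    refine Eq.trans ?_ (congrArg (fun t => (α_ _ _ _).hom ≫ t)
      (comp_whiskerLeft_eq (inj_pullMul f P R c d b) _ _)).symm
    refine Eq.trans ?_ (inj_associator_hom (Q := Q) (P := P) (R := R) (f a) (f b) (f c) (f d))
    exact congrArg (fun t => _ ≫ t) (inj_pullMul_assoc f (Q ⊗ P) R a d b _)
  left_unitality Q := hom_ext fun a b => inj_ext fun c => uinj_ext_right fun e => by
    subst e
    simp only [app_comp, inj_whiskerRight]
    refine (inj_leftUnitor_hom a b).trans (Eq.trans ?_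
      (comp_whiskerRight_eq (uinj_pullUnit (V := V) f (rfl : a = a)) _ _).symm)
    refine (inj_leftUnitor_hom (f a) (f b)).symm.trans ?_
    exact congrArg (fun t => _ ≫ t) (inj_pullMul_assoc f _ Q a a b _).symm
  right_unitality Q := hom_ext fun a b => inj_ext fun c => uinj_ext_left fun e => by
    subst e
    simp only [app_comp, inj_whiskerLeft]
    refine (inj_rightUnitor_hom a c).trans (Eq.trans ?_
      (comp_whiskerLeft_eq (uinj_pullUnit (V := V) f (rfl : c = c)) _ _).symm)
    refine (inj_rightUnitor_hom (f a) (f c)).symm.trans ?_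
    exact congrArg (fun t => _ ≫ t) (inj_pullMul_assoc f Q _ a c c _).symm

end VQuiv

namespace VQuiv

variable {V : Type u} [Category.{v} V] {S T R : Type v}
  [MonoidalCategory V] [SymmetricCategory V] [MonoidalClosed V] [HasColimits V]

lemma pullMul_comp (f : S → T) (g : T → R) (Q P : VQuiv V R) :
    pullMul (fun a => g (f a)) Q P = pullMul f ((pullback V g).obj Q) ((pullback V g).obj P) ≫
      (pullback V f).map (pullMul g Q P) :=
  hom_ext fun a b => inj_ext fun c => by
    refine (inj_pullMul (fun a => g (f a)) Q P a c b).trans ?_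
    refine Eq.trans ?_ (inj_pullMul_assoc f ((pullback V g).obj Q) ((pullback V g).obj P) a c b
      (app (pullMul g Q P) (f a) (f b))).symm
    exact (inj_pullMul g Q P (f a) (f c) (f b)).symm

lemma pullUnit_comp (f : S → T) (g : T → R) :
    pullUnit V (fun a => g (f a)) = pullUnit V f ≫ (pullback V f).map (pullUnit V g) :=
  hom_ext fun a b => uinj_ext fun e => by
    subst e
    have h := uinj_pullUnit (V := V) f (rfl : a = a)
    refine (uinj_pullUnit (V := V) (fun a => g (f a)) (rfl : a = a)).trans ?_
    refine Eq.trans ?_ ((reassoc_of% h) (app (pullUnit V g) (f a) (f a))).symm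
    exact (uinj_pullUnit (V := V) g (rfl : f a = f a)).symm

lemma pullMul_id (Q P : VQuiv V S) : pullMul (fun a => a) Q P = 𝟙 (Q ⊗ P) :=
  hom_ext fun a b => inj_ext fun c => by
    refine (inj_pullMul (fun a => a) Q P a c b).trans ?_
    rw [app_id]
    exact (Category.comp_id _).symm

lemma pullUnit_id : pullUnit V (fun a : S => a) = 𝟙 (𝟙_ (VQuiv V S)) :=
  hom_ext fun a b => uinj_ext fun e => by
    refine (uinj_pullUnit (V := V) (fun a => a) e).trans ?_
    rw [app_id]
    exact (Category.comp_id _).symm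

end VQuiv

/-- A templicial object: a set `S` with a colax monoidal functor `X : fint^op → V Quiv_S` that is
strongly unital, that is, whose counit `X_0 → I_S` is an isomorphism. -/
structure Templicial (V : Type u) [Category.{v} V] [MonoidalCategory V] [SymmetricCategory V]
    [MonoidalClosed V] [HasColimits V] where
  S : Type v
  X : FIntᵒᵖ ⥤ VQuiv V S
  [oplax : X.OplaxMonoidal]
  [unital : IsIso (Functor.OplaxMonoidal.η X)]

attribute [instance] Templicial.oplax Templicial.unital

namespace Templicial

open VQuiv Functor.OplaxMonoidal Functor.LaxMonoidal

variable {V : Type u} [Category.{v} V] [MonoidalCategory V] [SymmetricCategory V]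
  [MonoidalClosed V] [HasColimits V]

/-- A morphism of templicial objects: a map `f : S → T` with a monoidal natural transformation
`f_! X → Y`, given by its mate `q : X → f^* Y`. -/
@[ext]
structure Hom (X Y : Templicial V) where
  f : X.S → Y.S
  q : X.X ⟶ Y.X ⋙ pullback V f
  comul (m n : FIntᵒᵖ) : δ X.X m n ≫ (q.app m ⊗ₘ q.app n) ≫ μ (pullback V f) _ _ =
    q.app (m ⊗ n) ≫ (pullback V f).map (δ Y.X m n)
  counit : η X.X ≫ ε (pullback V f) = q.app (𝟙_ _) ≫ (pullback V f).map (η Y.X)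

/-- The identity. -/
def Hom.id (X : Templicial V) : Hom X X where
  f a := a
  q := { app := fun n => 𝟙 (X.X.obj n)
         naturality := fun m n g => (Category.comp_id _).trans (Category.id_comp (X.X.map g)).symm }
  comul m n := by
    have h := pullMul_id (X.X.obj m) (X.X.obj n)
    have e : δ X.X m n ≫ (𝟙 (X.X.obj m) ⊗ₘ 𝟙 (X.X.obj n)) ≫ 𝟙 (X.X.obj m ⊗ X.X.obj n) =
        𝟙 _ ≫ δ X.X m n := by
      rw [id_tensorHom_id, Category.id_comp, Category.comp_id, Category.id_comp]
    exact (congrArg (fun t => _ ≫ _ ≫ t) h).trans e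
  counit := by
    have e : η X.X ≫ 𝟙 (𝟙_ (VQuiv V X.S)) = 𝟙 _ ≫ η X.X := by
      rw [Category.id_comp, Category.comp_id]
    exact (congrArg (fun t => _ ≫ t) pullUnit_id).trans e

lemma μ_pull {S T : Type v} (f : S → T) {Q P Q' P' : VQuiv V T} (g : Q ⟶ Q') (h : P ⟶ P') :
    ((pullback V f).map g ⊗ₘ (pullback V f).map h) ≫ μ (pullback V f) Q' P' =
      μ (pullback V f) Q P ≫ (pullback V f).map (g ⊗ₘ h) := by
  exact μ_natural _ _ _

lemma comp_comul {W : Type*} [Category W] [MonoidalCategory W] {A B B' B'' C C' C'' D D' E F Z : W}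
    {d : A ⟶ B ⊗ C} {q : B ⟶ B'} {q' : C ⟶ C'} {m : B' ⊗ C' ⟶ D} {p : A ⟶ E} {e : E ⟶ D}
    {r : B' ⟶ B''} {r' : C' ⟶ C''} {m' : B'' ⊗ C'' ⟶ D'} {n : D ⟶ D'} {k : D' ⟶ Z} {s : E ⟶ F}
    {z : F ⟶ Z} (h₁ : d ≫ (q ⊗ₘ q') ≫ m = p ≫ e) (h₂ : (r ⊗ₘ r') ≫ m' = m ≫ n)
    (h₃ : e ≫ n ≫ k = s ≫ z) : d ≫ ((q ≫ r) ⊗ₘ (q' ≫ r')) ≫ m' ≫ k = (p ≫ s) ≫ z := by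
  rw [← tensorHom_comp_tensorHom, Category.assoc, reassoc_of% h₂, reassoc_of% h₁, Category.assoc, h₃]

lemma comp_counit {W : Type*} [Category W] {A B C D E F : W} {a : A ⟶ B} {b : B ⟶ C} {c : A ⟶ D}
    {d : D ⟶ C} {e : C ⟶ E} {f : D ⟶ F} {g : F ⟶ E} (h₁ : a ≫ b = c ≫ d) (h₂ : d ≫ e = f ≫ g) :
    a ≫ b ≫ e = (c ≫ f) ≫ g := by
  rw [reassoc_of% h₁, Category.assoc, h₂]

/-- The composition. -/
def Hom.comp {X Y Z : Templicial V} (p : Hom X Y) (r : Hom Y Z) : Hom X Z where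
  f a := r.f (p.f a)
  q := { app := fun n => p.q.app n ≫ (pullback V p.f).map (r.q.app n)
         naturality := fun m n g => by
          have h1 := p.q.naturality g
          have h2 := congrArg (fun t => (pullback V p.f).map t) (r.q.naturality g)
          simp only [Functor.map_comp] at h2
          refine Eq.trans ((reassoc_of% h1) ((pullback V p.f).map (r.q.app n))) ?_
          exact (congrArg (fun t => p.q.app m ≫ t) h2).trans (Category.assoc _ _ _).symm }
  comul m n := by
    have h1 := p.comul m n
    have h2 := congrArg (fun t => (pullback V p.f).map t) (r.comul m n)
    simp only [Functor.map_comp] at h2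
    have h3 := pullMul_comp p.f r.f (Z.X.obj m) (Z.X.obj n)
    have h4 := μ_pull p.f (r.q.app m) (r.q.app n)
    refine (congrArg (fun t => _ ≫ _ ≫ t) h3).trans ?_
    exact comp_comul h1 h4 h2
  counit := by
    have h1 := p.counit
    have h2 := congrArg (fun t => (pullback V p.f).map t) r.counit
    simp only [Functor.map_comp] at h2
    have h3 := pullUnit_comp (V := V) p.f r.f
    refine (congrArg (fun t => _ ≫ t) h3).trans ?_
    exact comp_counit h1 h2

/-- The category `ts V` of templicial objects. -/
instance : Category (Templicial V) where
  Hom := Hom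
  id := Hom.id
  comp := Hom.comp
  id_comp p := by
    refine Hom.ext rfl (heq_of_eq (NatTrans.ext (funext fun n => ?_)))
    exact Category.id_comp (p.q.app n)
  comp_id p := by
    refine Hom.ext rfl (heq_of_eq (NatTrans.ext (funext fun n => ?_)))
    exact Category.comp_id (p.q.app n)
  assoc p r s := by
    refine Hom.ext rfl (heq_of_eq (NatTrans.ext (funext fun n => ?_)))
    exact Category.assoc (p.q.app n) ((pullback V p.f).map (r.q.app n)) _

end Templicial

namespace VQuiv

variable (V : Type u) [Category.{v} V] {S T : Type v}
  [MonoidalCategory V] [SymmetricCategory V] [MonoidalClosed V] [HasColimits V]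

variable {V} in
/-- The direct image `f_!` of quivers: `(f_! Q)(x, y) = ∐_{f a = x, f b = y} Q(a, b)`. -/
def pushObj (f : S → T) (Q : VQuiv V S) : VQuiv V T where
  obj x y := ∐ fun z : {z : S × S // f z.1 = x ∧ f z.2 = y} => Q.obj z.1.1 z.1.2

variable {V} in
/-- The coprojections of `f_! Q`. -/
def pushι (f : S → T) (Q : VQuiv V S) (a b : S) : Q.obj a b ⟶ (pushObj f Q).obj (f a) (f b) :=
  Sigma.ι (fun z : {z : S × S // f z.1 = f a ∧ f z.2 = f b} => Q.obj z.1.1 z.1.2) ⟨(a, b), rfl, rfl⟩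

variable {V} in
/-- Maps out of `f_! Q`. -/
def pushDesc (f : S → T) {Q : VQuiv V S} {P : VQuiv V T} (h : Q ⟶ (pullback V f).obj P) :
    pushObj f Q ⟶ P where
  app x y := Sigma.desc fun z : {z : S × S // f z.1 = x ∧ f z.2 = y} =>
    app h z.1.1 z.1.2 ≫ eqToHom (congrArg₂ P.obj z.2.1 z.2.2)

variable {V} in
lemma pushι_pushDesc (f : S → T) {Q : VQuiv V S} {P : VQuiv V T} (h : Q ⟶ (pullback V f).obj P)
    (a b : S) : pushι f Q a b ≫ app (pushDesc f h) (f a) (f b) = app h a b :=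
  (Sigma.ι_desc _ _).trans (Category.comp_id _)

variable {V} in
lemma push_ext (f : S → T) {Q : VQuiv V S} {P : VQuiv V T} {g h : pushObj f Q ⟶ P}
    (e : ∀ a b, pushι f Q a b ≫ app g (f a) (f b) = pushι f Q a b ≫ app h (f a) (f b)) : g = h :=
  hom_ext fun x y => Sigma.hom_ext _ _ fun ⟨⟨a, b⟩, h1, h2⟩ => by
    dsimp at h1 h2
    subst h1 h2
    exact e a b

/-- The functor `f_!`. -/
def pushforward (f : S → T) : VQuiv V S ⥤ VQuiv V T where
  obj := pushObj f
  map {Q P} g := pushDesc f ⟨fun a b => app g a b ≫ pushι f P a b⟩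
  map_id Q := push_ext f fun a b => by
    rw [pushι_pushDesc]
    exact (Category.id_comp _).trans (Category.comp_id _).symm
  map_comp {Q P R} g h := push_ext f fun a b => by
    rw [pushι_pushDesc, app_comp, ← Category.assoc, pushι_pushDesc]
    refine (Category.assoc _ _ _).trans ?_
    refine (congrArg (fun t => _ ≫ t) ?_).trans (Category.assoc _ _ _).symm
    exact (pushι_pushDesc f (⟨fun a b => app h a b ≫ pushι f R a b⟩ :
      P ⟶ (pullback V f).obj (pushObj f R)) a b).symm

/-- `f_!` is left adjoint to `f^*`. -/
def pushAdj (f : S → T) : pushforward V f ⊣ pullback V f :=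
  Adjunction.mkOfHomEquiv
    { homEquiv := fun Q P =>
        { toFun := fun g => ⟨fun a b => pushι f Q a b ≫ app g (f a) (f b)⟩
          invFun := fun h => pushDesc f h
          left_inv := fun g => push_ext f fun a b => pushι_pushDesc f _ a b
          right_inv := fun h => hom_ext fun a b => pushι_pushDesc f _ a b }
      homEquiv_naturality_left_symm := fun {Q Q' P} g h => push_ext f fun a b => by
        refine (pushι_pushDesc f _ a b).trans ?_
        refine Eq.trans ?_ (Category.assoc _ _ _)
        refine Eq.trans ?_ (congrArg (· ≫ app (pushDesc f h) (f a) (f b))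
          (pushι_pushDesc f (⟨fun a b => app g a b ≫ pushι f Q' a b⟩ :
            Q ⟶ (pullback V f).obj (pushObj f Q')) a b).symm)
        refine Eq.trans ?_ (Category.assoc _ _ _).symm
        exact congrArg (fun t => app g a b ≫ t) (pushι_pushDesc f h a b).symm
      homEquiv_naturality_right := fun g h => hom_ext fun a b => (Category.assoc _ _ _).symm }

/-- The induced colax monoidal structure on `f_!`. -/
instance (f : S → T) : (pushforward V f).OplaxMonoidal := (pushAdj V f).leftAdjointOplaxMonoidal

end VQuiv

namespace Templicial

open VQuiv Functor.OplaxMonoidal Functor.LaxMonoidal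

variable {V : Type u} [Category.{v} V] [MonoidalCategory V] [SymmetricCategory V]
  [MonoidalClosed V] [HasColimits V]

/-- A map `f : S → T` with a monoidal natural transformation `f_! X → Y`. -/
@[ext]
structure PushHom (X Y : Templicial V) where
  f : X.S → Y.S
  α : X.X ⋙ pushforward V f ⟶ Y.X
  comul (m n : FIntᵒᵖ) : δ (X.X ⋙ pushforward V f) m n ≫ (α.app m ⊗ₘ α.app n) =
    α.app (m ⊗ n) ≫ δ Y.X m n
  counit : η (X.X ⋙ pushforward V f) = α.app (𝟙_ _) ≫ η Y.X

/-- The naturality of mates. -/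
lemma push_nat {S T : Type v} (f : S → T) {X : FIntᵒᵖ ⥤ VQuiv V S} {Y : FIntᵒᵖ ⥤ VQuiv V T}
    {m n : FIntᵒᵖ} (g : m ⟶ n) (a : (pushforward V f).obj (X.obj m) ⟶ Y.obj m)
    (b : (pushforward V f).obj (X.obj n) ⟶ Y.obj n) :
    (pushforward V f).map (X.map g) ≫ b = a ≫ Y.map g ↔
      X.map g ≫ (pushAdj V f).homEquiv _ _ b =
        (pushAdj V f).homEquiv _ _ a ≫ (pullback V f).map (Y.map g) := by
  rw [← Adjunction.homEquiv_naturality_left, ← Adjunction.homEquiv_naturality_right,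
    Equiv.apply_eq_iff_eq]

lemma push_comul {S T : Type v} (f : S → T) {X : FIntᵒᵖ ⥤ VQuiv V S} {Y : FIntᵒᵖ ⥤ VQuiv V T}
    [X.OplaxMonoidal] [Y.OplaxMonoidal] (α : X ⋙ pushforward V f ⟶ Y) (m n : FIntᵒᵖ) :
    δ (X ⋙ pushforward V f) m n ≫ (α.app m ⊗ₘ α.app n) = α.app (m ⊗ n) ≫ δ Y m n ↔
      δ X m n ≫ ((pushAdj V f).homEquiv _ _ (α.app m) ⊗ₘ (pushAdj V f).homEquiv _ _ (α.app n)) ≫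
        μ (pullback V f) _ _ =
      (pushAdj V f).homEquiv _ _ (α.app (m ⊗ n)) ≫ (pullback V f).map (δ Y m n) := by
  rw [← Adjunction.homEquiv_naturality_right, ← ((pushAdj V f).homEquiv _ _).apply_eq_iff_eq]
  refine Eq.congr_left ?_
  rw [Functor.OplaxMonoidal.comp_δ, Category.assoc, Adjunction.homEquiv_naturality_left]
  congr 1
  change (pushAdj V f).homEquiv _ _ (((pushAdj V f).homEquiv _ _).symm _ ≫ _) = _
  rw [Adjunction.homEquiv_naturality_right, Equiv.apply_symm_apply, Category.assoc, ← μ_natural,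
    tensorHom_comp_tensorHom_assoc]
  rfl

lemma push_counit {S T : Type v} (f : S → T) {X : FIntᵒᵖ ⥤ VQuiv V S} {Y : FIntᵒᵖ ⥤ VQuiv V T}
    [X.OplaxMonoidal] [Y.OplaxMonoidal] (α : X ⋙ pushforward V f ⟶ Y) :
    η (X ⋙ pushforward V f) = α.app (𝟙_ _) ≫ η Y ↔
      η X ≫ ε (pullback V f) =
        (pushAdj V f).homEquiv _ _ (α.app (𝟙_ _)) ≫ (pullback V f).map (η Y) := by
  rw [← Adjunction.homEquiv_naturality_right, ← ((pushAdj V f).homEquiv _ _).apply_eq_iff_eq]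
  refine Eq.congr_left ?_
  rw [Functor.OplaxMonoidal.comp_η, Adjunction.homEquiv_naturality_left]
  congr 1
  exact Equiv.apply_symm_apply _ _

/-- The two descriptions of morphisms of templicial objects agree. -/
def homEquivPush (X Y : Templicial V) : PushHom X Y ≃ Hom X Y where
  toFun p :=
    { f := p.f
      q :=
        { app := fun n => (pushAdj V p.f).homEquiv _ _ (p.α.app n)
          naturality := fun m n g => (push_nat p.f g _ _).1 (p.α.naturality g) }
      comul := fun m n => (push_comul p.f p.α m n).1 (p.comul m n)
      counit := (push_counit p.f p.α).1 p.counit }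
  invFun p :=
    let α : X.X ⋙ pushforward V p.f ⟶ Y.X :=
      { app := fun n => ((pushAdj V p.f).homEquiv _ _).symm (p.q.app n)
        naturality := fun m n g => (push_nat p.f g _ _).2 (by
          rw [Equiv.apply_symm_apply, Equiv.apply_symm_apply]
          exact p.q.naturality g) }
    { f := p.f
      α := α
      comul := fun m n => (push_comul p.f α m n).2 (by
        simp only [α, Equiv.apply_symm_apply]
        exact p.comul m n)
      counit := (push_counit p.f α).2 (by
        simp only [α, Equiv.apply_symm_apply]
        exact p.counit) }
  left_inv p := PushHom.ext rfl (heq_of_eq (NatTrans.ext (funext fun n =>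
    ((pushAdj V p.f).homEquiv _ _).symm_apply_apply (p.α.app n))))
  right_inv p := Hom.ext rfl (heq_of_eq (NatTrans.ext (funext fun n =>
    ((pushAdj V p.f).homEquiv _ _).apply_symm_apply (p.q.app n))))

end Templicial

namespace Neck

/-- `Cut U s U'`: the list of beads `U` can be cut at the vertex `s`, which lies in its first bead,
leaving the beads `U'`. -/
inductive Cut : List ℕ → ℕ → List ℕ → Type
  | nil : Cut [] 0 []
  | full (u : ℕ) (U : List ℕ) : Cut (u :: U) u U
  | part (u s r : ℕ) (U : List ℕ) (h : u = s + r) (hr : 0 < r) : Cut (u :: U) s (r :: U)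

lemma Cut.unique {U : List ℕ} {s : ℕ} {U' U'' : List ℕ} (c : Cut U s U') (c' : Cut U s U'') :
    (⟨U', c⟩ : Σ A, Cut U s A) = ⟨U'', c'⟩ := by
  cases c with
  | nil => cases c'; rfl
  | full u U =>
    cases c' with
    | full => rfl
    | part _ _ r _ h hr => omega
  | part u s r U h hr =>
    cases c' with
    | full => omega
    | part _ _ r' _ h' hr' =>
      obtain rfl : r = r' := by omega
      rfl

lemma Cut.sum {U : List ℕ} {s : ℕ} {U' : List ℕ} (c : Cut U s U') : U.sum = s + U'.sum := by
  cases c <;> simp <;> omega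

lemma Cut.pos {U : List ℕ} {s : ℕ} {U' : List ℕ} (c : Cut U s U') (h : ∀ u ∈ U, 0 < u) :
    ∀ u ∈ U', 0 < u := by
  cases c <;> simp_all

lemma Cut.le {U : List ℕ} {s : ℕ} {U' : List ℕ} (c : Cut U s U') : s ≤ U.headD 0 := by
  cases c <;> simp_all

/-- Every vertex of the first bead gives a cut. -/
def cutOf : (U : List ℕ) → (s : ℕ) → s ≤ U.headD 0 → Σ A, Cut U s A
  | [], 0, _ => ⟨[], .nil⟩
  | [], s + 1, h => absurd h (by simp)
  | u :: U, s, h =>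
    if e : u = s then ⟨U, e ▸ Cut.full u U⟩
    else ⟨(u - s) :: U, .part u s (u - s) U (by simp at h; omega) (by simp at h; omega)⟩

/-- `φ` is the map on vertices of a map from the necklace with beads `T` to that with beads `U`. -/
structure Valid (T U : List ℕ) (φ : ℕ → ℕ) : Prop where
  zero : φ 0 = 0
  last : φ T.sum = U.sum
  mono : ∀ i j, i ≤ j → j ≤ T.sum → φ i ≤ φ j
  joint : ∀ L, L <+: U → ∃ M, M <+: T ∧ φ M.sum = L.sum
  pos : ∀ u ∈ U, 0 < u

lemma Valid.nil {U : List ℕ} {φ : ℕ → ℕ} (h : Valid [] U φ) : U = [] := by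
  have h1 := h.last
  have h2 := h.pos
  rw [List.sum_nil, h.zero] at h1
  cases U with
  | nil => rfl
  | cons u U => simp at h1 h2; omega

lemma Valid.head {t : ℕ} {T U : List ℕ} {φ : ℕ → ℕ} (h : Valid (t :: T) U φ) :
    φ t ≤ U.headD 0 := by
  cases U with
  | nil =>
    have h1 := h.mono t (t :: T).sum (by simp) le_rfl
    rw [h.last] at h1
    simpa using h1
  | cons u U =>
    obtain ⟨M, ⟨N, hN⟩, hM⟩ := h.joint [u] (by simp)
    have hu := h.pos u (by simp)
    cases M with
    | nil => simp [h.zero] at hM; omega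
    | cons m M =>
      simp only [List.cons_append, List.cons.injEq] at hN
      obtain ⟨rfl, rfl⟩ := hN
      have := h.mono m (m :: M).sum (by simp) (by simp)
      simp only [hM] at this
      simpa using this

lemma Valid.cut {s w : ℕ} {U U' V V' : List ℕ} {φ ψ : ℕ → ℕ} (h : Valid U V φ)
    (c : Cut U s U') (d : Cut V w V') (hψ : ∀ i ≤ U'.sum, φ (s + i) = w + ψ i) (hs : φ s = w) :
    Valid U' V' ψ where
  zero := by have := hψ 0 (by simp); simp at this; omega
  last := by
    have h1 := hψ U'.sum le_rfl
    have h2 := h.last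
    have h3 := c.sum
    have h4 := d.sum
    rw [h3] at h2
    omega
  mono i j hij hj := by
    have h3 := c.sum
    have h1 := h.mono (s + i) (s + j) (by omega) (by omega)
    rw [hψ i (by omega), hψ j hj] at h1
    omega
  joint L hL := by
    have key : L = [] ∨ ∃ L', L' <+: V ∧ L'.sum = w + L.sum := by
      cases d with
      | nil => exact Or.inl (List.prefix_nil.1 hL)
      | full u U => exact Or.inr ⟨w :: L, by simpa using hL, by simp⟩
      | part u s r U h hr =>
        cases L with
        | nil => exact Or.inl rfl
        | cons l L =>
          obtain ⟨rfl, hL⟩ := List.cons_prefix_cons.1 hL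
          exact Or.inr ⟨u :: L, by simpa using hL, by simp; omega⟩
    have hz : ψ 0 = 0 := by have := hψ 0 (by simp); simp at this; omega
    rcases key with rfl | ⟨L', hL', e⟩
    · exact ⟨[], by simp, by simp [hz]⟩
    · obtain ⟨M, hM', hM⟩ := h.joint L' hL'
      have key' : M = [] ∨ ∃ M', M' <+: U' ∧ M.sum = s + M'.sum := by
        cases c with
        | nil => exact Or.inl (List.prefix_nil.1 hM')
        | full u U =>
          cases M with
          | nil => exact Or.inl rfl
          | cons m M =>
            obtain ⟨rfl, hM''⟩ := List.cons_prefix_cons.1 hM'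
            exact Or.inr ⟨M, hM'', by simp⟩
        | part u s r U h hr =>
          cases M with
          | nil => exact Or.inl rfl
          | cons m M =>
            obtain ⟨rfl, hM'⟩ := List.cons_prefix_cons.1 hM'
            exact Or.inr ⟨r :: M, by simpa using hM', by simp; omega⟩
      rcases key' with rfl | ⟨M', hp, e'⟩
      · simp only [List.sum_nil, h.zero] at hM
        exact ⟨[], by simp, by simp only [List.sum_nil, hz]; omega⟩
      · refine ⟨M', hp, ?_⟩
        rw [e', hψ _ (by obtain ⟨N, rfl⟩ := hp; simp)] at hM
        omega
  pos := d.pos h.pos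

lemma Valid.tail {t s : ℕ} {T U U' : List ℕ} {φ ψ : ℕ → ℕ} (h : Valid (t :: T) U φ)
    (c : Cut U s U') (hψ : ∀ i ≤ T.sum, φ (t + i) = s + ψ i) (hs : φ t = s) :
    Valid T U' ψ := h.cut (.full t T) c hψ hs

lemma Valid.congr {T U : List ℕ} {φ ψ : ℕ → ℕ} (h : Valid T U φ)
    (e : ∀ i ≤ T.sum, φ i = ψ i) : Valid T U ψ where
  zero := by rw [← e 0 (by omega), h.zero]
  last := by rw [← e _ le_rfl, h.last]
  mono i j hij hj := by rw [← e i (by omega), ← e j hj]; exact h.mono i j hij hj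
  joint L hL := by
    obtain ⟨M, hM, h'⟩ := h.joint L hL
    refine ⟨M, hM, ?_⟩
    rw [← e _ ?_, h']
    obtain ⟨N, rfl⟩ := hM
    simp
  pos := h.pos

lemma Valid.comp {T U V : List ℕ} {φ ψ : ℕ → ℕ} (h : Valid T U φ) (k : Valid U V ψ) :
    Valid T V (fun i => ψ (φ i)) where
  zero := by simp only [h.zero, k.zero]
  last := by simp only [h.last, k.last]
  mono i j hij hj := by
    refine k.mono _ _ (h.mono i j hij hj) ?_
    rw [← h.last]
    exact h.mono _ _ hj le_rfl
  joint L hL := by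
    obtain ⟨M, hM, e⟩ := k.joint L hL
    obtain ⟨N, hN, e'⟩ := h.joint M hM
    exact ⟨N, hN, by rw [e', e]⟩
  pos := k.pos

/-- The restriction of `φ` to the first bead. -/
def Valid.seg {t : ℕ} {T U : List ℕ} {φ : ℕ → ℕ} (h : Valid (t :: T) U φ) :
    (⟨t⟩ : FInt) ⟶ ⟨φ t⟩ :=
  FInt.homMk φ h.zero rfl fun i j hij (hj : j ≤ t) => h.mono i j hij (by simp; omega)

lemma Valid.fn_seg {t : ℕ} {T U : List ℕ} {φ : ℕ → ℕ} (h : Valid (t :: T) U φ) {i : ℕ}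
    (hi : i ≤ t) : FInt.fn h.seg i = φ i := FInt.fn_homMk _ _ _ _ hi

lemma Valid.shift {t : ℕ} {T U : List ℕ} {φ : ℕ → ℕ} (h : Valid (t :: T) U φ) {i : ℕ}
    (hi : i ≤ T.sum) : φ (t + i) = φ t + (φ (t + i) - φ t) := by
  have := h.mono t (t + i) (by omega) (by simp; omega)
  omega

variable {W : Type u} [Category.{v} W] [MonoidalCategory W]

lemma coh_left {A : W} (B C : W) (f : 𝟙_ W ⟶ A) :
    ((λ_ B).inv ≫ f ▷ B) ▷ C ≫ (α_ A B C).hom = (λ_ (B ⊗ C)).inv ≫ f ▷ (B ⊗ C) := by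
  simp

lemma coh_right {A : W} (B C : W) (f : 𝟙_ W ⟶ A) :
    ((ρ_ B).inv ≫ B ◁ f) ▷ C ≫ (α_ B A C).hom = B ◁ ((λ_ C).inv ≫ f ▷ C) := by
  simp

lemma coh_assoc {A A' B C D E F : W} (f : A ⟶ B ⊗ C) (g : B ⟶ D ⊗ E) (h : A ⟶ D ⊗ A')
    (k : A' ⟶ E ⊗ C) (e : f ≫ g ▷ C ≫ (α_ D E C).hom = h ≫ D ◁ k) :
    (f ▷ F ≫ (α_ B C F).hom) ≫ g ▷ (C ⊗ F) ≫ (α_ D E (C ⊗ F)).hom =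
      (h ▷ F ≫ (α_ D A' F).hom) ≫ D ◁ (k ▷ F ≫ (α_ E C F).hom) := by
  have e' := congrArg (fun t => t ▷ F ≫ (α_ D (E ⊗ C) F).hom ≫ D ◁ (α_ E C F).hom) e
  simp only [comp_whiskerRight, Category.assoc] at e'
  simp only [MonoidalCategory.whiskerLeft_comp, Category.assoc]
  rw [← associator_naturality_middle_assoc, ← e']
  simp

lemma coh_nat {A B B' C C' D D' E E' F : W} {p : A ⟶ B ⊗ C} {m : B ⟶ B'} {n : C ⟶ C'}
    {k : B' ⟶ D' ⊗ E'} {k' : B ⟶ D ⊗ E} {q : A ⟶ D ⊗ F} {l : F ⟶ E ⊗ C} {f : D ⟶ D'} {g : E ⟶ E'}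
    (hs : p ≫ k' ▷ C ≫ (α_ D E C).hom = q ≫ D ◁ l) (hn : m ≫ k = k' ≫ (f ⊗ₘ g)) :
    (p ≫ (m ⊗ₘ n)) ≫ (k ▷ C' ≫ (α_ D' E' C').hom) = q ≫ (f ⊗ₘ (l ≫ (g ⊗ₘ n))) := by
  have h1 : q ≫ (f ⊗ₘ (l ≫ (g ⊗ₘ n))) = (q ≫ D ◁ l) ≫ (f ⊗ₘ (g ⊗ₘ n)) := by
    simp [← id_tensorHom]
  rw [h1, ← hs]
  simp only [Category.assoc]
  rw [← associator_naturality, ← tensorHom_id, ← tensorHom_id, tensorHom_comp_tensorHom_assoc,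
    tensorHom_comp_tensorHom_assoc, hn, Category.comp_id, Category.id_comp]

section

variable (X : FIntᵒᵖ ⥤ W)

/-- `X_n`. -/
abbrev ob (n : ℕ) : W := X.obj (op ⟨n⟩)

/-- The action of a map of intervals. -/
abbrev mp {m n : ℕ} (f : (⟨m⟩ : FInt) ⟶ ⟨n⟩) : ob X n ⟶ ob X m := X.map f.op

/-- `X_{n₁} ⊗ (X_{n₂} ⊗ ... ⊗ I)`. -/
@[reducible]
def XL : List ℕ → W
  | [] => 𝟙_ W
  | n :: L => ob X n ⊗ XL L

variable [X.OplaxMonoidal]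

/-- The comultiplication `μ_{a,b} : X_n → X_a ⊗ X_b` for `n = a + b`. -/
def comul (a b n : ℕ) (h : n = a + b) : ob X n ⟶ ob X a ⊗ ob X b :=
  mp X (FInt.cast h.symm : (⟨a + b⟩ : FInt) ⟶ ⟨n⟩) ≫ Functor.OplaxMonoidal.δ X (op ⟨a⟩) (op ⟨b⟩)

/-- The counit `X_0 → I`. -/
def coun : ob X 0 ⟶ 𝟙_ W := Functor.OplaxMonoidal.η X

lemma comul_nat {a b n a' b' n' : ℕ} (h : n = a + b) (h' : n' = a' + b')
    (f : (⟨n⟩ : FInt) ⟶ ⟨n'⟩) (f₁ : (⟨a⟩ : FInt) ⟶ ⟨a'⟩) (f₂ : (⟨b⟩ : FInt) ⟶ ⟨b'⟩)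
    (e : ∀ i ≤ n, FInt.fn f i = FInt.fn f₁ i + FInt.fn f₂ (i - a)) :
    mp X f ≫ comul X a b n h = comul X a' b' n' h' ≫ (mp X f₁ ⊗ₘ mp X f₂) := by
  have key : (FInt.cast h.symm : (⟨a⟩ : FInt) ⊗ ⟨b⟩ ⟶ ⟨n⟩) ≫ f =
      (f₁ ⊗ₘ f₂) ≫ (FInt.cast h'.symm : (⟨a'⟩ : FInt) ⊗ ⟨b'⟩ ⟶ ⟨n'⟩) := by
    refine FInt.hom_ext fun i hi => ?_
    have h1 := FInt.fn_le f₁ i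
    have h2 := FInt.fn_le f₂ (i - a)
    simp only [FInt.fn_comp, FInt.fn_cast, FInt.fn_tensorHom, FInt.len_tensor] at hi h1 h2 ⊢
    rw [min_eq_left hi, min_eq_left (by omega), e i (by omega)]
  have hn := Functor.OplaxMonoidal.δ_natural X f₁.op f₂.op
  have hk := congrArg (fun t => X.map t.op) key
  simp only [op_comp, Functor.map_comp] at hk
  unfold comul mp
  rw [Category.assoc]
  erw [hn, reassoc_of% hk]
  rfl

lemma comul_rfl (a b : ℕ) :
    comul X a b (a + b) rfl = Functor.OplaxMonoidal.δ X (op ⟨a⟩) (op ⟨b⟩) := by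
  have h : (FInt.cast rfl : (⟨a + b⟩ : FInt) ⟶ ⟨a + b⟩) = 𝟙 _ :=
    FInt.hom_ext fun i hi => by rw [FInt.fn_cast, FInt.fn_id]
  rw [comul, mp, h, op_id]
  erw [X.map_id]
  exact Category.id_comp _

lemma comul_assoc {a b c ab bc n : ℕ} (h₁ : n = ab + c) (h₂ : ab = a + b) (h₃ : n = a + bc)
    (h₄ : bc = b + c) :
    comul X ab c n h₁ ≫ comul X a b ab h₂ ▷ ob X c ≫ (α_ _ _ _).hom =
      comul X a bc n h₃ ≫ ob X a ◁ comul X b c bc h₄ := by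
  subst h₂ h₄ h₁
  rw [comul_rfl, comul_rfl, comul_rfl, comul, Category.assoc]
  exact Functor.OplaxMonoidal.oplax_associativity X (op (⟨a⟩ : FInt)) (op ⟨b⟩) (op ⟨c⟩)

lemma comul_left (n : ℕ) (h : n = 0 + n) :
    comul X 0 n n h ≫ coun X ▷ ob X n = (λ_ _).inv := by
  rw [Functor.OplaxMonoidal.oplax_left_unitality X (op (⟨n⟩ : FInt)), comul, Category.assoc]
  rfl

lemma comul_right (n : ℕ) (h : n = n + 0) :
    comul X n 0 n h ≫ ob X n ◁ coun X = (ρ_ _).inv := by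
  rw [Functor.OplaxMonoidal.oplax_right_unitality X (op (⟨n⟩ : FInt)), comul, Category.assoc]
  rfl

variable [IsIso (Functor.OplaxMonoidal.η X)]

instance : IsIso (coun X) := inferInstanceAs (IsIso (Functor.OplaxMonoidal.η X))

/-- The inverse of the counit, `I → X_0`. -/
def un : 𝟙_ W ⟶ ob X 0 := inv (coun X)

lemma comul_left' (n : ℕ) (h : n = 0 + n) :
    comul X 0 n n h = (λ_ _).inv ≫ un X ▷ ob X n := by
  rw [← comul_left X n h, Category.assoc, ← comp_whiskerRight, un, IsIso.hom_inv_id,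
    id_whiskerRight, Category.comp_id]

lemma comul_right' (n : ℕ) (h : n = n + 0) :
    comul X n 0 n h = (ρ_ _).inv ≫ ob X n ◁ un X := by
  rw [← comul_right X n h, Category.assoc, ← MonoidalCategory.whiskerLeft_comp, un,
    IsIso.hom_inv_id, MonoidalCategory.whiskerLeft_id, Category.comp_id]

/-- Cutting the first bead: `X_U → X_s ⊗ X_{U'}`, given by the comultiplication of `X` if `s` is not
a joint of `U`, by the identity if it is the first nonzero one, and by `I ≅ X_0` if `U = {0}`. -/
def split : {U : List ℕ} → {s : ℕ} → {U' : List ℕ} → Cut U s U' → (XL X U ⟶ ob X s ⊗ XL X U')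
  | _, _, _, .nil => (λ_ _).inv ≫ un X ▷ 𝟙_ W
  | _, _, _, .full u U => 𝟙 (ob X u ⊗ XL X U)
  | _, _, _, .part u s r U h _ => comul X s r u h ▷ XL X U ≫ (α_ _ _ _).hom

/-- The map `X_U → X_T` induced by a map of necklaces from `T` to `U` with map on vertices `φ`:
if `T` has beads `t :: T'`, it is the composition `X_U → X_{φ t} ⊗ X_{U'} → X_t ⊗ X_{T'}` of the cut
at `φ t` with the action of the restrictions of `φ` to the first bead and to the remaining beads. -/
def nmap : (T U : List ℕ) → (φ : ℕ → ℕ) → Valid T U φ → (XL X U ⟶ XL X T)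
  | [], U, φ, h => eqToHom (by rw [h.nil])
  | t :: T, U, φ, h =>
    split X (cutOf U (φ t) h.head).2 ≫
      (mp X h.seg ⊗ₘ nmap T (cutOf U (φ t) h.head).1 (fun i => φ (t + i) - φ t)
        (h.tail (cutOf U (φ t) h.head).2 (fun _ hi => h.shift hi) rfl))

lemma nmap_nil {φ : ℕ → ℕ} (h : Valid [] [] φ) : nmap X [] [] φ h = 𝟙 _ := rfl

lemma nmap_congr (T U : List ℕ) {φ ψ : ℕ → ℕ} (h : Valid T U φ) (h' : Valid T U ψ)
    (e : ∀ i ≤ T.sum, φ i = ψ i) : nmap X T U φ h = nmap X T U ψ h' := by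
  induction T generalizing U φ ψ with
  | nil => rfl
  | cons t T ih =>
    have aux : ∀ (s s' : ℕ) (hs : s = s') (a : s ≤ U.headD 0) (a' : s' ≤ U.headD 0)
        (f : (⟨t⟩ : FInt) ⟶ ⟨s⟩) (f' : (⟨t⟩ : FInt) ⟶ ⟨s'⟩)
        (_ : ∀ i ≤ t, FInt.fn f i = FInt.fn f' i) (φ' ψ' : ℕ → ℕ)
        (v : Valid T (cutOf U s a).1 φ') (v' : Valid T (cutOf U s' a').1 ψ')
        (_ : ∀ i ≤ T.sum, φ' i = ψ' i),
        split X (cutOf U s a).2 ≫ (mp X f ⊗ₘ nmap X T _ φ' v) =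
          split X (cutOf U s' a').2 ≫ (mp X f' ⊗ₘ nmap X T _ ψ' v') := by
      intro s s' hs a a' f f' hf φ' ψ' v v' he
      subst hs
      obtain rfl : f = f' := FInt.hom_ext hf
      rw [ih _ v v' he]
    refine aux _ _ (e t (by simp)) _ _ _ _ (fun i hi => ?_) _ _ _ _ (fun i hi => ?_)
    · rw [h.fn_seg hi, h'.fn_seg hi, e i (by simp; omega)]
    · rw [e (t + i) (by simp; omega), e t (by simp)]

lemma nmap_cons {t s : ℕ} {T U U' : List ℕ} {φ ψ : ℕ → ℕ} (h : Valid (t :: T) U φ)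
    (c : Cut U s U') (f : (⟨t⟩ : FInt) ⟶ ⟨s⟩) (hf : ∀ i ≤ t, FInt.fn f i = φ i)
    (hψ : ∀ i ≤ T.sum, φ (t + i) = s + ψ i) (h' : Valid T U' ψ) :
    nmap X (t :: T) U φ h = split X c ≫ (mp X f ⊗ₘ nmap X T U' ψ h') := by
  obtain rfl : φ t = s := by
    rw [← hf t le_rfl]
    exact FInt.fn_last f le_rfl
  have hc := (cutOf U (φ t) h.head).2.unique c
  rw [nmap]
  have aux : ∀ (d : Σ A, Cut U (φ t) A) (_ : d = ⟨U', c⟩) (v : Valid T d.1 _),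
      split X d.2 ≫ (mp X h.seg ⊗ₘ nmap X T d.1 (fun i => φ (t + i) - φ t) v) =
        split X c ≫ (mp X f ⊗ₘ nmap X T U' ψ h') := by
    rintro d rfl v
    obtain rfl : h.seg = f := FInt.hom_ext fun i hi => by rw [h.fn_seg hi, hf i hi]
    rw [nmap_congr X T U' v h' fun i hi => by rw [hψ i hi]; omega]
  exact aux _ hc _

/-- The cut at the vertex `0`. -/
def zeroCut : (U : List ℕ) → (∀ u ∈ U, 0 < u) → Cut U 0 U
  | [], _ => .nil
  | u :: U, h => .part u 0 u U (by simp) (h u (by simp))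

lemma split_zero {U : List ℕ} (hU : ∀ u ∈ U, 0 < u) (c : Cut U 0 U) :
    split X c = (λ_ _).inv ≫ un X ▷ XL X U := by
  obtain rfl : c = zeroCut U hU := by simpa using c.unique (zeroCut U hU)
  cases U with
  | nil => rfl
  | cons u U =>
    simp only [zeroCut, split, comul_left', XL]
    exact coh_left _ _ _

lemma comul_zero_whiskerRight (n : ℕ) (h : n = n + 0) (Z : W) :
    comul X n 0 n h ▷ Z ≫ (α_ _ _ _).hom = ob X n ◁ ((λ_ Z).inv ≫ un X ▷ Z) := by
  rw [comul_right']
  exact coh_right _ _ _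

lemma split_split {V V' V'' : List ℕ} {a b r : ℕ} (hV : ∀ u ∈ V, 0 < u) (h : b = a + r)
    (c₁ : Cut V b V') (c₂ : Cut V a V'') (c₃ : Cut V'' r V') :
    split X c₁ ≫ comul X a r b h ▷ XL X V' ≫ (α_ _ _ _).hom =
      split X c₂ ≫ ob X a ◁ split X c₃ := by
  cases c₁ with
  | nil =>
    cases c₂
    cases c₃
    rw [comul_zero_whiskerRight]
    rfl
  | full b V' =>
    cases c₂ with
    | full =>
      obtain rfl : r = 0 := by omega
      rw [comul_zero_whiskerRight, split_zero X (fun u hu => hV u (by simp [hu])) c₃]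
    | part _ _ r' _ h' hr' =>
      obtain rfl : r = r' := by omega
      obtain rfl : c₃ = .full r V' := by simpa using c₃.unique (.full r V')
      simp [split, XL]
  | part v _ q V₀ hv hq =>
    cases c₂ with
    | full => omega
    | part _ _ r' _ h' hr' =>
      obtain rfl : c₃ = .part r' r q V₀ (by omega) hq := by
        simpa using c₃.unique (.part r' r q V₀ (by omega) hq)
      have e : r' = r + q := by omega
      exact coh_assoc _ _ _ _ (comul_assoc X hv h h' e)

/-- Cuts can be composed. -/
lemma Cut.sub {V V' V'' : List ℕ} {a b r : ℕ} (hV : ∀ u ∈ V, 0 < u) (h : b = a + r)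
    (c₁ : Cut V b V') (c₂ : Cut V a V'') : Nonempty (Cut V'' r V') := by
  cases c₁ with
  | nil =>
    cases c₂
    obtain rfl : r = 0 := by omega
    exact ⟨.nil⟩
  | full b V' =>
    cases c₂ with
    | full =>
      obtain rfl : r = 0 := by omega
      exact ⟨zeroCut _ fun u hu => hV u (by simp [hu])⟩
    | part _ _ r' _ h' hr' =>
      obtain rfl : r = r' := by omega
      exact ⟨.full r V'⟩
  | part v _ q V₀ hv hq =>
    cases c₂ with
    | full => omega
    | part _ _ r' _ h' hr' => exact ⟨.part r' r q V₀ (by omega) hq⟩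

lemma nmap_split {U U' V V' : List ℕ} {s w : ℕ} {ψ ψ' : ℕ → ℕ} (h : Valid U V ψ)
    (c : Cut U s U') (d : Cut V w V') (f : (⟨s⟩ : FInt) ⟶ ⟨w⟩)
    (hf : ∀ i ≤ s, FInt.fn f i = ψ i) (hψ : ∀ i ≤ U'.sum, ψ (s + i) = w + ψ' i)
    (h' : Valid U' V' ψ') :
    nmap X U V ψ h ≫ split X c = split X d ≫ (mp X f ⊗ₘ nmap X U' V' ψ' h') := by
  have hw : ψ s = w := by
    rw [← hf s le_rfl]
    exact FInt.fn_last f le_rfl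
  cases c with
  | nil =>
    obtain rfl := h.nil
    cases d
    obtain rfl : f = 𝟙 _ := FInt.hom_ext fun i (hi : i ≤ 0) => by
      obtain rfl : i = 0 := by omega
      rw [FInt.fn_zero, FInt.fn_zero]
    rw [nmap_nil, nmap_nil, Category.id_comp, mp, op_id, X.map_id]
    erw [id_tensorHom_id, Category.comp_id]
  | full u U =>
    rw [nmap_cons X h d f hf hψ h']
    exact Category.comp_id _
  | part u _ r U₀ hu hr =>
    obtain ⟨V₃, e⟩ := cutOf V (ψ u) h.head
    have hle : w ≤ ψ u := by
      rw [← hw]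
      exact h.mono s u (by omega) (by simp)
    have hr' : ψ u = w + ψ' r := by rw [hu]; exact hψ r (by simp)
    obtain ⟨c₃⟩ := Cut.sub h.pos hr' e d
    have hr'' : ψ' r ≤ V'.headD 0 := c₃.le
    have v₃ := h.tail e (fun i hi => h.shift hi) rfl
    rw [nmap_cons X h e h.seg (fun i hi => h.fn_seg hi) (fun i hi => h.shift hi) v₃,
      nmap_cons X h' c₃ h'.seg (fun i hi => h'.fn_seg hi) (ψ := fun i => ψ (u + i) - ψ u)
        (fun i hi => by
          have h1 := hψ (r + i) (by simp; omega)
          rw [show s + (r + i) = u + i by omega] at h1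
          have h2 := h.shift hi
          omega) v₃]
    have hn := comul_nat X hu hr' h.seg f h'.seg (fun i hi => by
      rw [h.fn_seg hi]
      by_cases his : i ≤ s
      · rw [hf i his, Nat.sub_eq_zero_of_le his, FInt.fn_zero, add_zero]
      · rw [FInt.fn_last f (by simp; omega), h'.fn_seg (by omega), ← hψ _ (by simp; omega)]
        congr 1
        omega)
    have hs := split_split X h.pos hr' e d c₃
    exact coh_nat hs hn

lemma nmap_comp {T U V : List ℕ} {φ ψ : ℕ → ℕ} (h : Valid T U φ) (k : Valid U V ψ) :
    nmap X T V _ (h.comp k) = nmap X U V ψ k ≫ nmap X T U φ h := by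
  induction T generalizing U V φ ψ with
  | nil =>
    obtain rfl := h.nil
    obtain rfl := k.nil
    rw [nmap_nil, nmap_nil, nmap_nil, Category.comp_id]
  | cons t T ih =>
    obtain ⟨U', c⟩ := cutOf U (φ t) h.head
    have hk := h.comp k
    obtain ⟨V', d⟩ := cutOf V (ψ (φ t)) hk.head
    have h' := h.tail c (fun i hi => h.shift hi) rfl
    have hsum := c.sum
    have hφ : ∀ i ≤ U'.sum, ψ (φ t + i) = ψ (φ t) + (ψ (φ t + i) - ψ (φ t)) := fun i hi => by
      have := k.mono (φ t) (φ t + i) (by omega) (by omega)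
      omega
    have k' : Valid U' V' (fun i => ψ (φ t + i) - ψ (φ t)) := k.cut c d hφ rfl
    let g : (⟨φ t⟩ : FInt) ⟶ ⟨ψ (φ t)⟩ := FInt.homMk ψ k.zero rfl
      fun i j hij (hj : j ≤ φ t) => k.mono i j hij (by omega)
    have hg : ∀ i ≤ φ t, FInt.fn g i = ψ i := fun i hi => FInt.fn_homMk _ _ _ _ hi
    rw [nmap_cons X h c h.seg (fun i hi => h.fn_seg hi) (fun i hi => h.shift hi) h',
      ← Category.assoc, nmap_split X k c d g hg hφ k', Category.assoc, tensorHom_comp_tensorHom,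
      ← ih h' k', ← X.map_comp, ← op_comp]
    refine nmap_cons X hk d (h.seg ≫ g) (fun i hi => ?_) (fun i hi => ?_) _
    · have := h.mono i t hi (by simp)
      rw [FInt.fn_comp, h.fn_seg hi, hg _ this]
    · have h1 := h.shift hi
      have h2 := h'.mono i T.sum hi le_rfl
      rw [h'.last] at h2
      have h3 := hφ _ h2
      rwa [← h1] at h3 ⊢

lemma nmap_id (T : List ℕ) {φ : ℕ → ℕ} (h : Valid T T φ) (e : ∀ i ≤ T.sum, φ i = i) :
    nmap X T T φ h = 𝟙 _ := by
  induction T generalizing φ with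
  | nil => rfl
  | cons t T ih =>
    have et := e t (by simp)
    have h' : Valid T T id :=
      h.tail (.full t T) (fun i hi => by rw [e _ (by simp; omega)]; rfl) et
    rw [nmap_cons X h (.full t T) (𝟙 _) (fun i hi => by
      rw [FInt.fn_id, e i (by simp; omega)]; exact min_eq_left hi)
      (fun i hi => by rw [e _ (by simp; omega)]; rfl) h', ih h' fun _ _ => rfl, mp, op_id, X.map_id]
    simp [split, XL]

end

end Neck

namespace Neck

lemma valid {T U : Nec} (f : T ⟶ U) : Valid T.beads U.beads (Nec.fn f) where
  zero := Nec.fn_zero f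
  last := Nec.fn_last f le_rfl
  mono _ _ h _ := Nec.fn_mono f h
  joint L hL := by
    obtain ⟨i, ⟨M, hM, rfl⟩, h⟩ := f.joint L.sum ⟨L, hL, rfl⟩
    exact ⟨M, hM, h⟩
  pos := U.pos

variable {W : Type u} [Category.{v} W] [MonoidalCategory W]

lemma coh_nil {A : W} (B : W) (f : 𝟙_ W ⟶ A) :
    (λ_ B).hom ≫ (λ_ B).inv ≫ f ▷ B = ((λ_ (𝟙_ W)).inv ≫ f ▷ 𝟙_ W) ▷ B ≫ (α_ _ _ _).hom ≫
      A ◁ (λ_ B).hom := by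
  simp

lemma coh_join {A A' B C D E F G Z : W} (s : D ⟶ A ⊗ B) (m : A ⟶ A') (n : B ⟶ C) (k : E ⟶ F)
    (j : B ⊗ E ⟶ G) (j' : C ⊗ F ⟶ Z) (l : G ⟶ Z) (e : j ≫ l = (n ⊗ₘ k) ≫ j') :
    (s ▷ E ≫ (α_ A B E).hom ≫ A ◁ j) ≫ (m ⊗ₘ l) =
      ((s ≫ (m ⊗ₘ n)) ⊗ₘ k) ≫ (α_ A' C F).hom ≫ A' ◁ j' := by
  have h1 : A ◁ j ≫ (m ⊗ₘ l) = (m ⊗ₘ (n ⊗ₘ k)) ≫ A' ◁ j' := by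
    rw [← id_tensorHom, ← id_tensorHom, tensorHom_comp_tensorHom, tensorHom_comp_tensorHom, e,
      Category.id_comp, Category.comp_id]
  have h2 : ((s ≫ (m ⊗ₘ n)) ⊗ₘ k) = s ▷ E ≫ ((m ⊗ₘ n) ⊗ₘ k) := by
    rw [← tensorHom_id, tensorHom_comp_tensorHom, Category.id_comp]
  rw [Category.assoc, Category.assoc, h1, h2, Category.assoc, associator_naturality_assoc]

section

variable (X : FIntᵒᵖ ⥤ W)

/-- The canonical map (in fact an isomorphism) `X_T ⊗ X_U → X_{T ∨ U}`. -/
def join : (L M : List ℕ) → (XL X L ⊗ XL X M ⟶ XL X (L ++ M))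
  | [], _ => (λ_ _).hom
  | n :: L, M => (α_ _ _ _).hom ≫ ob X n ◁ join L M

lemma join_cons (n : ℕ) (L M : List ℕ) :
    join X (n :: L) M = (α_ _ _ _).hom ≫ ob X n ◁ join X L M := rfl

lemma eqToHom_cons (n : ℕ) {L M : List ℕ} (h : L = M) (h' : XL X (n :: L) = XL X (n :: M)) :
    eqToHom h' = ob X n ◁ eqToHom (congrArg (XL X) h) := by
  subst h; simp

lemma join_assoc (L M N : List ℕ) :
    join X L M ▷ XL X N ≫ join X (L ++ M) N ≫ eqToHom (by rw [List.append_assoc]) =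
      (α_ _ _ _).hom ≫ XL X L ◁ join X M N ≫ join X L (M ++ N) := by
  induction L with
  | nil => simp [join]
  | cons n L ih =>
    have h := eqToHom_cons X n (List.append_assoc L M N) (by simp)
    have ih' := congrArg (fun t => ob X n ◁ t) ih
    simp only [MonoidalCategory.whiskerLeft_comp] at ih'
    change ((α_ _ _ _).hom ≫ ob X n ◁ join X L M) ▷ XL X N ≫
      ((α_ _ _ _).hom ≫ ob X n ◁ join X (L ++ M) N) ≫ eqToHom _ = _ ≫ _ ≫
        ((α_ _ _ _).hom ≫ ob X n ◁ join X L (M ++ N))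
    erw [h]
    simp only [comp_whiskerRight, Category.assoc, associator_naturality_middle_assoc,
      tensor_whiskerLeft, Iso.inv_hom_id_assoc]
    erw [ih']
    simp

lemma join_nil (L : List ℕ) :
    join X L [] ≫ eqToHom (by rw [List.append_nil]) = (ρ_ (XL X L)).hom := by
  induction L with
  | nil => simp [join, unitors_equal]
  | cons n L ih =>
    have h := eqToHom_cons X n (List.append_nil L) (by simp)
    change ((α_ _ _ _).hom ≫ ob X n ◁ join X L []) ≫ eqToHom _ = _
    erw [h, Category.assoc, ← MonoidalCategory.whiskerLeft_comp, ih]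
    simp

variable [X.OplaxMonoidal] [IsIso (Functor.OplaxMonoidal.η X)]

/-- Cutting the first bead of a wedge. -/
def Cut.append : {L : List ℕ} → {s : ℕ} → {L' : List ℕ} → Cut L s L' → (M : List ℕ) →
    (∀ m ∈ M, 0 < m) → Cut (L ++ M) s (L' ++ M)
  | _, _, _, .nil, M, h => zeroCut M h
  | _, _, _, .full u U, M, _ => .full u (U ++ M)
  | _, _, _, .part u s r U h hr, M, _ => .part u s r (U ++ M) h hr

lemma split_append {L L' M : List ℕ} {s : ℕ} (c : Cut L s L') (h : ∀ m ∈ M, 0 < m) :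
    join X L M ≫ split X (c.append M h) =
      split X c ▷ XL X M ≫ (α_ _ _ _).hom ≫ ob X s ◁ join X L' M := by
  cases c with
  | nil =>
    change _ ≫ split X (zeroCut M h) = _
    rw [split_zero X h]
    exact coh_nil _ _
  | full u U => simp [join, split, Cut.append, XL]
  | part u s r U hu hr =>
    simp only [join, split, Cut.append, XL]
    simp only [Category.assoc, comp_whiskerRight, pentagon_assoc]
    erw [whisker_exchange_assoc, ← associator_naturality_left_assoc]
    simp

lemma nmap_join {T T' U U' : List ℕ} {φ ψ χ : ℕ → ℕ} (h : Valid T T' φ) (k : Valid U U' ψ)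
    (l : Valid (T ++ U) (T' ++ U') χ) (e₁ : ∀ i ≤ T.sum, χ i = φ i)
    (e₂ : ∀ i ≤ U.sum, χ (T.sum + i) = T'.sum + ψ i) :
    join X T' U' ≫ nmap X (T ++ U) (T' ++ U') χ l =
      (nmap X T T' φ h ⊗ₘ nmap X U U' ψ k) ≫ join X T U := by
  induction T generalizing T' φ χ with
  | nil =>
    obtain rfl := h.nil
    have := nmap_congr X U U' (φ := χ) (ψ := ψ) l k fun i hi => by simpa using e₂ i hi
    change _ ≫ nmap X U U' χ l = _
    rw [this, nmap_nil]
    simp [join]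
  | cons t T ih =>
    obtain ⟨T'', c⟩ := cutOf T' (φ t) h.head
    have h' := h.tail c (fun i hi => h.shift hi) rfl
    have hc := c.sum
    have et : χ t = φ t := e₁ t (by simp)
    have hχ : ∀ i ≤ (T ++ U).sum, χ (t + i) = φ t + (χ (t + i) - φ t) := fun i hi => by
      have := l.shift hi
      omega
    have l' : Valid (T ++ U) (T'' ++ U') (fun i => χ (t + i) - φ t) :=
      l.tail (c.append U' k.pos) hχ et
    have hih := ih h' l' (fun i hi => by rw [e₁ _ (by simp; omega)]) (fun i hi => by
      have h1 := e₂ i hi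
      simp only [List.sum_cons] at h1
      rw [← add_assoc, h1, hc]
      omega)
    have hn : nmap X (t :: T ++ U) (T' ++ U') χ l = _ :=
      nmap_cons X (T := T ++ U) l (c.append U' k.pos) h.seg
        (fun i hi => by rw [h.fn_seg hi, e₁ i (by simp; omega)]) hχ l'
    rw [hn, nmap_cons X h c h.seg (fun i hi => h.fn_seg hi) (fun i hi => h.shift hi) h',
      join_cons, ← Category.assoc, split_append]
    exact coh_join _ _ _ _ _ _ _ hih

/-- The functor `nec^op → W`, `T ↦ X_T = X_{n₁} ⊗ ... ⊗ X_{nₖ}` for `T = Δ^{n₁} ∨ ... ∨ Δ^{nₖ}`. -/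
def toNec : Necᵒᵖ ⥤ W where
  obj T := XL X T.unop.beads
  map f := nmap X _ _ (Nec.fn f.unop) (valid f.unop)
  map_id T := nmap_id X _ _ fun i hi => min_eq_left hi
  map_comp f g := by
    rw [← nmap_comp]
    exact nmap_congr X _ _ _ _ fun i _ => Nec.fn_comp _ _ _

lemma join_natural {T T' U U' : Nec} (f : T ⟶ T') (g : U ⟶ U') :
    join X T'.beads U'.beads ≫ (toNec X).map (f ⊗ₘ g).op =
      ((toNec X).map f.op ⊗ₘ (toNec X).map g.op) ≫ join X T.beads U.beads := by
  refine nmap_join X (valid f) (valid g) (valid (f ⊗ₘ g)) (fun i (hi : i ≤ T.len) => ?_)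
    (fun i hi => ?_)
  · rw [Nec.fn_tensorHom, Nat.sub_eq_zero_of_le hi, Nec.fn_zero, add_zero]
  · change Nec.fn (f ⊗ₘ g) (T.len + i) = T'.len + _
    rw [Nec.fn_tensorHom, Nec.fn_last f (Nat.le_add_right _ _), Nat.add_sub_cancel_left]

lemma toNec_eqToHom {T U : Nec} (h : T = U) (h' : XL X U.beads = XL X T.beads) :
    (toNec X).map (eqToHom h).op = eqToHom h' := by
  subst h
  exact (toNec X).map_id _

/-- `X_T ⊗ X_U → X_{T ∨ U}` makes `T ↦ X_T` a (strong) monoidal functor. -/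
instance : (toNec X).LaxMonoidal where
  ε := 𝟙 (𝟙_ W)
  μ T U := join X T.unop.beads U.unop.beads
  μ_natural_left {T T'} f U := by
    have h := (join_natural X f.unop (𝟙 U.unop)).symm
    rw [tensorHom_id, op_id] at h
    have e : ((toNec X).map f.unop.op ⊗ₘ (toNec X).map (𝟙 (op (unop U)))) =
      (toNec X).map f ▷ (toNec X).obj U := by
        rw [← tensorHom_id]
        exact congrArg _ ((toNec X).map_id _)
    exact (congrArg (· ≫ _) e).symm.trans h
  μ_natural_right {T T'} U f := by
    have h := (join_natural X (𝟙 U.unop) f.unop).symm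
    rw [id_tensorHom, op_id] at h
    have e : ((toNec X).map (𝟙 (op (unop U))) ⊗ₘ (toNec X).map f.unop.op) =
      (toNec X).obj U ◁ (toNec X).map f := by
        rw [← id_tensorHom]
        exact congrArg (· ⊗ₘ _) ((toNec X).map_id _)
    exact (congrArg (· ≫ _) e).symm.trans h
  associativity T U V := by
    have h := join_assoc X T.unop.beads U.unop.beads V.unop.beads
    have e : (toNec X).map (α_ T U V).hom = _ :=
      toNec_eqToHom X (Nec.ext (List.append_assoc _ _ _).symm) (by
        exact congrArg (XL X) (List.append_assoc _ _ _))
    exact (congrArg (fun t => _ ≫ _ ≫ t) e).trans h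
  left_unitality T := by
    have e : (toNec X).map (λ_ T).hom = 𝟙 _ := (toNec X).map_id _
    have h : (λ_ (XL X T.unop.beads)).hom =
      𝟙 (𝟙_ W) ▷ XL X T.unop.beads ≫ (λ_ (XL X T.unop.beads)).hom ≫ 𝟙 (XL X T.unop.beads) := by simp
    exact h.trans (congrArg (fun t => _ ≫ _ ≫ t) e).symm
  right_unitality T := by
    have e : (toNec X).map (ρ_ T).hom = _ :=
      toNec_eqToHom X (Nec.ext (List.append_nil _).symm) (by
        exact congrArg (XL X) (List.append_nil _))
    have h : (ρ_ (XL X T.unop.beads)).hom = XL X T.unop.beads ◁ 𝟙 (𝟙_ W) ≫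
        join X T.unop.beads [] ≫ eqToHom (by rw [List.append_nil]) := by
      rw [join_nil]
      simp
    exact h.trans (congrArg (fun t => _ ≫ _ ≫ t) e).symm

end
end Neck

namespace Neck

open Functor.OplaxMonoidal Functor.LaxMonoidal

variable {W : Type u} [Category.{v} W] [MonoidalCategory W] {W' : Type u'} [Category.{v'} W']
  [MonoidalCategory W'] {Φ : W' ⥤ W} [Φ.LaxMonoidal] {X : FIntᵒᵖ ⥤ W} {Y : FIntᵒᵖ ⥤ W'}

/-- The maps `X_T → Φ(Y_T)` induced by maps `X_n → Φ(Y_n)`. -/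
def qL (q : X ⟶ Y ⋙ Φ) : (L : List ℕ) → (XL X L ⟶ Φ.obj (XL Y L))
  | [] => ε Φ
  | n :: L => ((q.app (op ⟨n⟩) : ob X n ⟶ Φ.obj (ob Y n)) ⊗ₘ qL q L) ≫ μ Φ (ob Y n) (XL Y L)

variable (q : X ⟶ Y ⋙ Φ)

/-- The component `X_n → Φ(Y_n)`. -/
abbrev qn (n : ℕ) : ob X n ⟶ Φ.obj (ob Y n) := q.app (op ⟨n⟩)

lemma qL_cons (n : ℕ) (L : List ℕ) :
    qL q (n :: L) = (qn q n ⊗ₘ qL q L) ≫ μ Φ (ob Y n) (XL Y L) := rfl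

lemma qn_nat {m n : ℕ} (f : (⟨m⟩ : FInt) ⟶ ⟨n⟩) : mp X f ≫ qn q m = qn q n ≫ Φ.map (mp Y f) :=
  q.naturality f.op

lemma coh_qL_join {A B C D : W} {A' B' C' D' : W'} (q : A ⟶ Φ.obj A') (l : B ⟶ Φ.obj B')
    (m : C ⟶ Φ.obj C') (n : D ⟶ Φ.obj D') (j : B ⊗ C ⟶ D) (j' : B' ⊗ C' ⟶ D')
    (h : j ≫ n = (l ⊗ₘ m) ≫ μ Φ _ _ ≫ Φ.map j') :
    ((α_ _ _ _).hom ≫ A ◁ j) ≫ (q ⊗ₘ n) ≫ μ Φ _ _ =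
      (((q ⊗ₘ l) ≫ μ Φ _ _) ⊗ₘ m) ≫ μ Φ _ _ ≫ Φ.map ((α_ _ _ _).hom ≫ A' ◁ j') := by
  have h1 : A ◁ j ≫ (q ⊗ₘ n) = (q ⊗ₘ (l ⊗ₘ m)) ≫ Φ.obj A' ◁ μ Φ _ _ ≫ Φ.obj A' ◁ Φ.map j' := by
    simp only [← id_tensorHom, tensorHom_comp_tensorHom, h, Category.id_comp, Category.comp_id]
  have h2 : (((q ⊗ₘ l) ≫ μ Φ _ _) ⊗ₘ m) = ((q ⊗ₘ l) ⊗ₘ m) ≫ μ Φ _ _ ▷ _ := by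
    rw [← tensorHom_id, tensorHom_comp_tensorHom, Category.comp_id]
  rw [Category.assoc, reassoc_of% h1, h2, Φ.map_comp, Category.assoc, Functor.LaxMonoidal.associativity_assoc,
    associator_naturality_assoc, μ_natural_right]

lemma qL_join (L M : List ℕ) :
    join X L M ≫ qL q (L ++ M) = (qL q L ⊗ₘ qL q M) ≫ μ Φ _ _ ≫ Φ.map (join Y L M) := by
  induction L with
  | nil =>
    change (λ_ _).hom ≫ qL q M = (ε Φ ⊗ₘ qL q M) ≫ _ ≫ Φ.map (λ_ _).hom
    rw [tensorHom_def', Category.assoc, ← Functor.LaxMonoidal.left_unitality, leftUnitor_naturality]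
  | cons n L ih => exact coh_qL_join _ _ _ _ _ _ ih

variable [X.OplaxMonoidal] [Y.OplaxMonoidal]

/-- Compatibility with the comultiplications and counits. -/
structure Compat : Prop where
  comul (m n : FIntᵒᵖ) : δ X m n ≫ (q.app m ⊗ₘ q.app n) ≫ μ Φ _ _ =
    q.app (m ⊗ n) ≫ Φ.map (δ Y m n)
  counit : η X ≫ ε Φ = q.app (𝟙_ _) ≫ Φ.map (η Y)

variable {q}

lemma Compat.comul' (h : Compat q) (a b n : ℕ) (e : n = a + b) :
    Neck.comul X a b n e ≫ (qn q a ⊗ₘ qn q b) ≫ μ Φ _ _ = qn q n ≫ Φ.map (Neck.comul Y a b n e) := by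
  unfold Neck.comul
  rw [Φ.map_comp, Category.assoc, ← reassoc_of% (qn_nat q)]
  exact congrArg (fun t => _ ≫ t) (h.comul _ _)

variable [IsIso (η X)] [IsIso (η Y)]

lemma Compat.un (h : Compat q) : un X ≫ qn q 0 = ε Φ ≫ Φ.map (un Y) := by
  unfold Neck.un
  have h1 : coun X ≫ ε Φ = qn q 0 ≫ Φ.map (coun Y) := h.counit
  rw [IsIso.inv_comp_eq, reassoc_of% h1, ← Φ.map_comp, IsIso.hom_inv_id, Φ.map_id, Category.comp_id]

lemma coh_nil_split {A : W} {A' : W'} (u : 𝟙_ W ⟶ A) (u' : 𝟙_ W' ⟶ A') (q : A ⟶ Φ.obj A')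
    (h : u ≫ q = ε Φ ≫ Φ.map u') :
    ((λ_ _).inv ≫ u ▷ 𝟙_ W) ≫ (q ⊗ₘ ε Φ) ≫ μ Φ _ _ =
      ε Φ ≫ Φ.map ((λ_ _).inv ≫ u' ▷ 𝟙_ W') := by
  have h1 : u ▷ 𝟙_ W ≫ (q ⊗ₘ ε Φ) = (𝟙_ W ◁ ε Φ) ≫ ε Φ ▷ _ ≫ Φ.map u' ▷ _ := by
    rw [← comp_whiskerRight, ← h, ← tensorHom_id, tensorHom_comp_tensorHom, Category.id_comp,
      tensorHom_def']
  rw [Category.assoc, reassoc_of% h1, μ_natural_left, ← leftUnitor_inv_naturality_assoc,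
    Φ.map_comp, left_unitality_inv_assoc]

lemma coh_part_split {A A₁ A₂ B : W} {A' A₁' A₂' B' : W'} (c : A ⟶ A₁ ⊗ A₂) (c' : A' ⟶ A₁' ⊗ A₂')
    (q : A ⟶ Φ.obj A') (q₁ : A₁ ⟶ Φ.obj A₁') (q₂ : A₂ ⟶ Φ.obj A₂') (l : B ⟶ Φ.obj B')
    (h : c ≫ (q₁ ⊗ₘ q₂) ≫ μ Φ _ _ = q ≫ Φ.map c') :
    (c ▷ B ≫ (α_ _ _ _).hom) ≫ (q₁ ⊗ₘ ((q₂ ⊗ₘ l) ≫ μ Φ _ _)) ≫ μ Φ _ _ =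
      ((q ⊗ₘ l) ≫ μ Φ _ _) ≫ Φ.map (c' ▷ B' ≫ (α_ _ _ _).hom) := by
  have h1 : (q₁ ⊗ₘ ((q₂ ⊗ₘ l) ≫ μ Φ _ _)) = (q₁ ⊗ₘ (q₂ ⊗ₘ l)) ≫ Φ.obj A₁' ◁ μ Φ _ _ := by
    rw [← id_tensorHom, tensorHom_comp_tensorHom, Category.comp_id]
  have h2 : c ▷ B ≫ ((q₁ ⊗ₘ q₂) ⊗ₘ l) ≫ μ Φ _ _ ▷ _ = (q ⊗ₘ l) ≫ Φ.map c' ▷ _ := by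
    simp only [← tensorHom_id, tensorHom_comp_tensorHom, Category.id_comp, Category.comp_id, h]
  rw [h1, Category.assoc, Category.assoc, ← associator_naturality_assoc, ← Functor.LaxMonoidal.associativity,
    reassoc_of% h2, μ_natural_left_assoc, Category.assoc, Φ.map_comp]

lemma Compat.split (h : Compat q) {U U' : List ℕ} {s : ℕ} (c : Cut U s U') :
    split X c ≫ (qn q s ⊗ₘ qL q U') ≫ μ Φ _ _ = qL q U ≫ Φ.map (split Y c) := by
  cases c with
  | nil => exact coh_nil_split _ _ _ h.un
  | full u U =>
    simp only [Neck.split, XL]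
    rw [Category.id_comp, Φ.map_id, Category.comp_id]
    rfl
  | part u s r U hu hr => exact coh_part_split _ _ _ _ _ _ (h.comul' s r u hu)

lemma coh_nmap {A B C D E : W} {A' B' C' D' E' : W'} {s : A ⟶ B ⊗ C} {s' : A' ⟶ B' ⊗ C'}
    {f : B ⟶ D} {f' : B' ⟶ D'} {g : C ⟶ E} {g' : C' ⟶ E'} {q : A ⟶ Φ.obj A'} {b : B ⟶ Φ.obj B'}
    {c : C ⟶ Φ.obj C'} {d : D ⟶ Φ.obj D'} {e : E ⟶ Φ.obj E'}
    (h : s ≫ (b ⊗ₘ c) ≫ μ Φ _ _ = q ≫ Φ.map s') (hf : f ≫ d = b ≫ Φ.map f')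
    (hg : g ≫ e = c ≫ Φ.map g') :
    (s ≫ (f ⊗ₘ g)) ≫ (d ⊗ₘ e) ≫ μ Φ _ _ = q ≫ Φ.map (s' ≫ (f' ⊗ₘ g')) := by
  rw [Category.assoc, tensorHom_comp_tensorHom_assoc, hf, hg, ← tensorHom_comp_tensorHom,
    Category.assoc, μ_natural, reassoc_of% h, Φ.map_comp]

lemma Compat.nmap (h : Compat q) {T U : List ℕ} {φ : ℕ → ℕ} (v : Valid T U φ) :
    nmap X T U φ v ≫ qL q T = qL q U ≫ Φ.map (nmap Y T U φ v) := by
  induction T generalizing U φ with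
  | nil =>
    obtain rfl := v.nil
    rw [nmap_nil, nmap_nil, Φ.map_id, Category.id_comp, Category.comp_id]
  | cons t T ih =>
    obtain ⟨U', c⟩ := cutOf U (φ t) v.head
    have v' := v.tail c (fun i hi => v.shift hi) rfl
    rw [nmap_cons X v c v.seg (fun i hi => v.fn_seg hi) (fun i hi => v.shift hi) v',
      nmap_cons Y v c v.seg (fun i hi => v.fn_seg hi) (fun i hi => v.shift hi) v']
    exact coh_nmap (h.split c) (qn_nat q v.seg) (ih v')

/-- The natural transformation `X_T → Φ(Y_T)` of functors of `T` in `nec^op`. -/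
def Compat.toNec (h : Compat q) : toNec X ⟶ toNec Y ⋙ Φ where
  app T := qL q T.unop.beads
  naturality _ _ f := h.nmap (valid f.unop)

end Neck

/-- The category `V^{nec^op}` with the Day convolution. -/
abbrev NecV (V : Type u) [Category.{v} V] [MonoidalCategory V] := DayFunctor Necᵒᵖ V

namespace NecV

variable {V : Type u} [Category.{v} V] [MonoidalCategory V] [SymmetricCategory V]
  [MonoidalClosed V] [HasColimits V]

instance monoidal : MonoidalCategory (NecV V) := inferInstance

instance lawful : LawfulDayConvolutionMonoidalCategoryStruct Necᵒᵖ V (NecV V) := inferInstance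

open LawfulDayConvolutionMonoidalCategoryStruct

/-- The value at a necklace. -/
abbrev at_ (F : NecV V) (T : Necᵒᵖ) : V := F.functor.obj T

/-- The component of a morphism at a necklace. -/
abbrev ap {F G : NecV V} (f : F ⟶ G) (T : Necᵒᵖ) : F.at_ T ⟶ G.at_ T := f.natTrans.app T

/-- The universal map `F_T ⊗ G_U → (F ⊗ G)_{T ∨ U}`. -/
def dη (F G : NecV V) (T U : Necᵒᵖ) : F.at_ T ⊗ G.at_ U ⟶ (F ⊗ G).at_ (T ⊗ U) :=
  (DayFunctor.η F G).app (T, U)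

lemma dη_nat (F G : NecV V) {T T' U U' : Necᵒᵖ} (f : T ⟶ T') (g : U ⟶ U') :
    (F.functor.map f ⊗ₘ G.functor.map g) ≫ dη F G T' U' =
      dη F G T U ≫ (F ⊗ G).functor.map (f ⊗ₘ g) := by
  have h := (DayFunctor.η F G).naturality (X := (T, U)) (Y := (T', U')) (f, g)
  rw [MonoidalCategory.tensorHom_def]
  exact h

lemma dη_nat_left (F G : NecV V) (T : Necᵒᵖ) {U U' : Necᵒᵖ} (g : U ⟶ U') :
    (F.at_ T ◁ G.functor.map g) ≫ dη F G T U' = dη F G T U ≫ (F ⊗ G).functor.map (T ◁ g) := by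
  rw [← id_tensorHom, ← id_tensorHom, ← F.functor.map_id, dη_nat]

lemma dη_tensorHom {F F' G G' : NecV V} (f : F ⟶ F') (g : G ⟶ G') (T U : Necᵒᵖ) :
    dη F G T U ≫ ap (f ⊗ₘ g) (T ⊗ U) = (ap f T ⊗ₘ ap g U) ≫ dη F' G' T U :=
  convolutionExtensionUnit_comp_ι_map_tensorHom_app Necᵒᵖ V f g T U

lemma dη_whiskerLeft (F : NecV V) {G G' : NecV V} (g : G ⟶ G') (T U : Necᵒᵖ) :
    dη F G T U ≫ ap (F ◁ g) (T ⊗ U) = F.at_ T ◁ ap g U ≫ dη F G' T U :=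
  convolutionExtensionUnit_comp_ι_map_whiskerLeft_app V F g T U

lemma dη_whiskerRight {F F' : NecV V} (f : F ⟶ F') (G : NecV V) (T U : Necᵒᵖ) :
    dη F G T U ≫ ap (f ▷ G) (T ⊗ U) = ap f T ▷ G.at_ U ≫ dη F' G T U :=
  convolutionExtensionUnit_comp_ι_map_whiskerRight_app Necᵒᵖ V f G T U

lemma dη_assoc (F G H : NecV V) (T U W : Necᵒᵖ) :
    dη F G T U ▷ H.at_ W ≫ dη (F ⊗ G) H (T ⊗ U) W ≫ ap (α_ F G H).hom ((T ⊗ U) ⊗ W) =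
      (α_ _ _ _).hom ≫ F.at_ T ◁ dη G H U W ≫ dη F (G ⊗ H) T (U ⊗ W) ≫
        (F ⊗ G ⊗ H).functor.map (α_ T U W).inv :=
  associator_hom_unit_unit V F G H T U W

variable (V) in
/-- The universal map `I → I_{Δ^0}`. -/
def dν : 𝟙_ V ⟶ (𝟙_ (NecV V)).at_ (𝟙_ Necᵒᵖ) := DayFunctor.ν Necᵒᵖ V

lemma dη_left (F : NecV V) (T : Necᵒᵖ) :
    dν V ▷ F.at_ T ≫ dη (𝟙_ _) F (𝟙_ _) T ≫ ap (λ_ F).hom (𝟙_ _ ⊗ T) =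
      (λ_ _).hom ≫ F.functor.map (λ_ T).inv :=
  leftUnitor_hom_unit_app V F T

lemma dη_right (F : NecV V) (T : Necᵒᵖ) :
    F.at_ T ◁ dν V ≫ dη F (𝟙_ _) T (𝟙_ _) ≫ ap (ρ_ F).hom (T ⊗ 𝟙_ _) =
      (ρ_ _).hom ≫ F.functor.map (ρ_ T).inv :=
  rightUnitor_hom_unit_app V F T

lemma tensor_ext {F G H : NecV V} {f g : F ⊗ G ⟶ H}
    (h : ∀ T U, dη F G T U ≫ ap f (T ⊗ U) = dη F G T U ≫ ap g (T ⊗ U)) : f = g :=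
  DayFunctor.tensor_hom_ext h

lemma unit_ext {F : NecV V} {f g : 𝟙_ (NecV V) ⟶ F}
    (h : dν V ≫ ap f (𝟙_ _) = dν V ≫ ap g (𝟙_ _)) : f = g :=
  DayFunctor.unit_hom_ext h

lemma ap_comp {F G H : NecV V} (f : F ⟶ G) (g : G ⟶ H) (T : Necᵒᵖ) :
    ap (f ≫ g) T = ap f T ≫ ap g T := rfl

lemma ap_nat {F G : NecV V} (f : F ⟶ G) {T U : Necᵒᵖ} (a : T ⟶ U) :
    F.functor.map a ≫ ap f U = ap f T ≫ G.functor.map a := f.natTrans.naturality a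

lemma hom_ext {F G : NecV V} {f g : F ⟶ G} (h : ∀ T, ap f T = ap g T) : f = g :=
  DayFunctor.hom_ext (NatTrans.ext (funext h))

lemma at_ext {G K : NecV V} {Z : Necᵒᵖ} {Y A : V} {f g : Y ⊗ (G ⊗ K).at_ Z ⟶ A}
    (h : ∀ (U W : Necᵒᵖ) (a : U ⊗ W ⟶ Z), Y ◁ (dη G K U W ≫ (G ⊗ K).functor.map a) ≫ f =
      Y ◁ (dη G K U W ≫ (G ⊗ K).functor.map a) ≫ g) : f = g :=
  (isColimitOfPreserves (tensorLeft Y) (isPointwiseLeftKanExtensionConvolutionExtensionUnit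
    (C := Necᵒᵖ) (V := V) G K Z)).hom_ext fun j => h j.left.1 j.left.2 j.hom

lemma tensor₃_aux {F G K H : NecV V} (f : F ⊗ (G ⊗ K) ⟶ H) (T Z U W : Necᵒᵖ) (a : U ⊗ W ⟶ Z) :
    F.at_ T ◁ (dη G K U W ≫ (G ⊗ K).functor.map a) ≫ dη F (G ⊗ K) T Z ≫ ap f (T ⊗ Z) =
      (F.at_ T ◁ dη G K U W ≫ dη F (G ⊗ K) T (U ⊗ W) ≫ ap f (T ⊗ U ⊗ W)) ≫
        H.functor.map (T ◁ a) := by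
  have h1 := dη_nat_left F (G ⊗ K) T a
  have h2 := ap_nat f (T ◁ a)
  rw [MonoidalCategory.whiskerLeft_comp, Category.assoc, reassoc_of% h1, h2, Category.assoc,
    Category.assoc]

lemma tensor₃_ext {F G K H : NecV V} {f g : F ⊗ (G ⊗ K) ⟶ H}
    (h : ∀ T U W, F.at_ T ◁ dη G K U W ≫ dη F (G ⊗ K) T (U ⊗ W) ≫ ap f (T ⊗ U ⊗ W) =
      F.at_ T ◁ dη G K U W ≫ dη F (G ⊗ K) T (U ⊗ W) ≫ ap g (T ⊗ U ⊗ W)) : f = g :=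
  tensor_ext fun T Z => at_ext fun U W a => by rw [tensor₃_aux, tensor₃_aux, h]

end NecV

/-- A necklace category: a (small) category enriched in `V^{nec^op}` with the Day convolution. -/
structure NecCat (V : Type u) [Category.{v} V] [MonoidalCategory V] [SymmetricCategory V]
    [MonoidalClosed V] [HasColimits V] where
  Obj : Type v
  [enriched : EnrichedCategory (NecV V) Obj]

attribute [instance] NecCat.enriched

namespace NecCat

variable {V : Type u} [Category.{v} V] [MonoidalCategory V] [SymmetricCategory V]
  [MonoidalClosed V] [HasColimits V]

/-- The category `V Cat_nec` of necklace categories and enriched functors. -/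
instance : Category (NecCat V) where
  Hom C D := EnrichedFunctor (NecV V) C.Obj D.Obj
  id C := EnrichedFunctor.id (NecV V) C.Obj
  comp F G := EnrichedFunctor.comp (NecV V) F G
  id_comp F := EnrichedFunctor.ext _ (fun _ => rfl)
    (fun a b => (Category.comp_id _).trans (Category.id_comp (F.map a b)))
  comp_id F := EnrichedFunctor.ext _ (fun _ => rfl)
    (fun a b => (Category.comp_id _).trans (Category.comp_id (F.map a b)))
  assoc F G H := EnrichedFunctor.ext _ (fun _ => rfl)
    (fun a b => (Category.comp_id _).trans (Category.assoc (F.map a b) (G.map _ _) (H.map _ _)))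

end NecCat

namespace NecV

open VQuiv Functor.LaxMonoidal

variable {V : Type u} [Category.{v} V] [MonoidalCategory V] [SymmetricCategory V]
  [MonoidalClosed V] [HasColimits V]

/-- Maps out of a Day convolution. -/
def tdesc {F G H : NecV V} (m : ∀ T U : Necᵒᵖ, F.at_ T ⊗ G.at_ U ⟶ H.at_ (T ⊗ U))
    (h : ∀ {T T' U U' : Necᵒᵖ} (f : T ⟶ T') (g : U ⟶ U'),
      (F.functor.map f ⊗ₘ G.functor.map g) ≫ m T' U' = m T U ≫ H.functor.map (f ⊗ₘ g)) :
    F ⊗ G ⟶ H :=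
  DayFunctor.tensorDesc
    { app := fun Z => m Z.1 Z.2
      naturality := fun Z Z' f => by
        refine Eq.trans ?_ (h f.1 f.2)
        rw [MonoidalCategory.tensorHom_def]
        rfl }

lemma dη_tdesc {F G H : NecV V} (m : ∀ T U : Necᵒᵖ, F.at_ T ⊗ G.at_ U ⟶ H.at_ (T ⊗ U)) (h)
    (T U : Necᵒᵖ) : dη F G T U ≫ ap (tdesc m h) (T ⊗ U) = m T U :=
  DayFunctor.η_comp_tensorDesc_app _ _ _

/-- Maps out of the unit of the Day convolution. -/
def udesc {F : NecV V} (e : 𝟙_ V ⟶ F.at_ (𝟙_ Necᵒᵖ)) : 𝟙_ (NecV V) ⟶ F := DayFunctor.unitDesc e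

lemma dν_udesc {F : NecV V} (e : 𝟙_ V ⟶ F.at_ (𝟙_ Necᵒᵖ)) : dν V ≫ ap (udesc e) (𝟙_ _) = e :=
  DayFunctor.ν_comp_unitDesc _

variable {S : Type v} (F : Necᵒᵖ ⥤ VQuiv V S)

/-- The functor `T ↦ F_T(a, b)`. -/
def homObj (a b : S) : NecV V where
  functor :=
    { obj := fun T => (F.obj T).obj a b
      map := fun f => app (F.map f) a b
      map_id := fun T => by rw [F.map_id]; rfl
      map_comp := fun f g => by rw [F.map_comp]; rfl }

variable [F.LaxMonoidal]

/-- `F_T(a, b) ⊗ F_U(b, c) → F_{T ∨ U}(a, c)`. -/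
def homMul (a b c : S) (T U : Necᵒᵖ) :
    (homObj F a b).at_ T ⊗ (homObj F b c).at_ U ⟶ (homObj F a c).at_ (T ⊗ U) :=
  inj (F.obj T) (F.obj U) a b c ≫ app (μ F T U) a c

lemma homMul_nat (a b c : S) {T T' U U' : Necᵒᵖ} (f : T ⟶ T') (g : U ⟶ U') :
    ((homObj F a b).functor.map f ⊗ₘ (homObj F b c).functor.map g) ≫ homMul F a b c T' U' =
      homMul F a b c T U ≫ (homObj F a c).functor.map (f ⊗ₘ g) := by
  have h := congrArg (fun t => inj _ _ a b c ≫ app t a c) (μ_natural F f g)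
  simp only [app_comp, inj_tensorHom_assoc] at h
  refine h.trans ?_
  exact (Category.assoc _ _ _).symm

/-- The identity `I → F_{Δ^0}(a, a)`. -/
def homOne (a : S) : 𝟙_ V ⟶ (homObj F a a).at_ (𝟙_ Necᵒᵖ) := uinj rfl ≫ app (ε F) a a

/-- The composition of the enriched category associated to `F`. -/
def homComp (a b c : S) : homObj F a b ⊗ homObj F b c ⟶ homObj F a c :=
  tdesc (homMul F a b c) (homMul_nat F a b c)

/-- The identities of the enriched category associated to `F`. -/
def homId (a : S) : 𝟙_ (NecV V) ⟶ homObj F a a := udesc (homOne F a)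

lemma dη_homComp (a b c : S) (T U : Necᵒᵖ) :
    dη _ _ T U ≫ ap (homComp F a b c) (T ⊗ U) = homMul F a b c T U := dη_tdesc _ _ _ _

lemma dν_homId (a : S) : dν V ≫ ap (homId F a) (𝟙_ _) = homOne F a := dν_udesc _

lemma dη_assoc' (F G H : NecV V) (T U Z : Necᵒᵖ) :
    F.at_ T ◁ dη G H U Z ≫ dη F (G ⊗ H) T (U ⊗ Z) ≫ ap (α_ F G H).inv (T ⊗ U ⊗ Z) =
      (α_ _ _ _).inv ≫ dη F G T U ▷ H.at_ Z ≫ dη (F ⊗ G) H (T ⊗ U) Z ≫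
        ((F ⊗ G) ⊗ H).functor.map (α_ T U Z).hom := by
  have h1 := dη_assoc F G H T U Z
  have h2 := ap_nat (α_ F G H).inv (α_ T U Z).inv
  have h3 : ap (α_ F G H).hom ((T ⊗ U) ⊗ Z) ≫ ap (α_ F G H).inv ((T ⊗ U) ⊗ Z) = 𝟙 _ := by
    rw [← ap_comp, Iso.hom_inv_id]; rfl
  have h4 := congrArg (fun t => (α_ _ _ _).inv ≫ t ≫ ap (α_ F G H).inv ((T ⊗ U) ⊗ Z) ≫
    ((F ⊗ G) ⊗ H).functor.map (α_ T U Z).hom) h1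
  simp only [Category.assoc, Iso.inv_hom_id_assoc] at h4
  rw [reassoc_of% h3, reassoc_of% h2, ← CategoryTheory.Functor.map_comp, Iso.inv_hom_id, CategoryTheory.Functor.map_id,
    Category.comp_id] at h4
  exact h4.symm

lemma ap_leftUnitor_inv (F : NecV V) (T : Necᵒᵖ) :
    ap (λ_ F).inv T = (λ_ _).inv ≫ dν V ▷ F.at_ T ≫ dη (𝟙_ _) F (𝟙_ _) T ≫
      (𝟙_ _ ⊗ F).functor.map (λ_ T).hom := by
  have h1 := dη_left F T
  have h2 := ap_nat (λ_ F).inv (λ_ T).inv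
  have h3 : ap (λ_ F).hom (𝟙_ _ ⊗ T) ≫ ap (λ_ F).inv (𝟙_ _ ⊗ T) = 𝟙 _ := by
    rw [← ap_comp, Iso.hom_inv_id]; rfl
  have h4 := congrArg (fun t => (λ_ _).inv ≫ t ≫ ap (λ_ F).inv (𝟙_ _ ⊗ T) ≫
    (𝟙_ _ ⊗ F).functor.map (λ_ T).hom) h1
  simp only [Category.assoc, Iso.inv_hom_id_assoc] at h4
  rw [reassoc_of% h3, reassoc_of% h2, ← CategoryTheory.Functor.map_comp, Iso.inv_hom_id, CategoryTheory.Functor.map_id,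
    Category.comp_id] at h4
  exact h4.symm

lemma ap_rightUnitor_inv (F : NecV V) (T : Necᵒᵖ) :
    ap (ρ_ F).inv T = (ρ_ _).inv ≫ F.at_ T ◁ dν V ≫ dη F (𝟙_ _) T (𝟙_ _) ≫
      (F ⊗ 𝟙_ _).functor.map (ρ_ T).hom := by
  have h1 := dη_right F T
  have h2 := ap_nat (ρ_ F).inv (ρ_ T).inv
  have h3 : ap (ρ_ F).hom (T ⊗ 𝟙_ _) ≫ ap (ρ_ F).inv (T ⊗ 𝟙_ _) = 𝟙 _ := by
    rw [← ap_comp, Iso.hom_inv_id]; rfl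
  have h4 := congrArg (fun t => (ρ_ _).inv ≫ t ≫ ap (ρ_ F).inv (T ⊗ 𝟙_ _) ≫
    (F ⊗ 𝟙_ _).functor.map (ρ_ T).hom) h1
  simp only [Category.assoc, Iso.inv_hom_id_assoc] at h4
  rw [reassoc_of% h3, reassoc_of% h2, ← CategoryTheory.Functor.map_comp, Iso.inv_hom_id, CategoryTheory.Functor.map_id,
    Category.comp_id] at h4
  exact h4.symm

lemma homMul_assoc (a b c d : S) (T U Z : Necᵒᵖ) :
    homMul F a b c T U ▷ _ ≫ homMul F a c d (T ⊗ U) Z ≫ (homObj F a d).functor.map (α_ T U Z).hom =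
      (α_ _ _ _).hom ≫ _ ◁ homMul F b c d U Z ≫ homMul F a b d T (U ⊗ Z) := by
  have h := congrArg (fun t => inj _ _ a b c ▷ (F.obj Z).obj c d ≫ inj _ _ a c d ≫ app t a d)
    (associativity F T U Z)
  simp only [app_comp] at h
  rw [inj_whiskerRight, reassoc_of% inj_associator_hom, inj_whiskerLeft, ← comp_whiskerRight_assoc,
    ← MonoidalCategory.whiskerLeft_comp_assoc, ← Category.assoc (inj _ _ a c d)] at h
  exact h

lemma homMul_left (a b : S) (T : Necᵒᵖ) :
    homOne F a ▷ _ ≫ homMul F a a b (𝟙_ _) T ≫ (homObj F a b).functor.map (λ_ T).hom =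
      (λ_ _).hom := by
  have h := congrArg (fun t => uinj rfl ▷ (F.obj T).obj a b ≫ inj _ _ a a b ≫ app t a b)
    (left_unitality F T)
  simp only [app_comp] at h
  rw [inj_leftUnitor_hom, inj_whiskerRight, ← comp_whiskerRight_assoc,
    ← Category.assoc (inj _ _ a a b)] at h
  exact h.symm

lemma homMul_right (a b : S) (T : Necᵒᵖ) :
    _ ◁ homOne F b ≫ homMul F a b b T (𝟙_ _) ≫ (homObj F a b).functor.map (ρ_ T).hom =
      (ρ_ _).hom := by
  have h := congrArg (fun t => (F.obj T).obj a b ◁ uinj rfl ≫ inj _ _ a b b ≫ app t a b)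
    (right_unitality F T)
  simp only [app_comp] at h
  rw [inj_rightUnitor_hom, inj_whiskerLeft, ← MonoidalCategory.whiskerLeft_comp_assoc,
    ← Category.assoc (inj _ _ a b b)] at h
  exact h.symm

lemma homId_comp (a b : S) :
    (λ_ (homObj F a b)).inv ≫ homId F a ▷ homObj F a b ≫ homComp F a a b = 𝟙 _ := by
  refine hom_ext fun T => ?_
  have h1 := ap_nat (homId F a ▷ homObj F a b ≫ homComp F a a b) (λ_ T).hom
  rw [ap_comp, ap_leftUnitor_inv]
  simp only [Category.assoc]
  rw [h1, ap_comp, Category.assoc, reassoc_of% (dη_whiskerRight (homId F a) (homObj F a b)),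
    ← comp_whiskerRight_assoc, dν_homId, reassoc_of% (dη_homComp F a a b), homMul_left,
    Iso.inv_hom_id]
  rfl

lemma homComp_id (a b : S) :
    (ρ_ (homObj F a b)).inv ≫ homObj F a b ◁ homId F b ≫ homComp F a b b = 𝟙 _ := by
  refine hom_ext fun T => ?_
  have h1 := ap_nat (homObj F a b ◁ homId F b ≫ homComp F a b b) (ρ_ T).hom
  rw [ap_comp, ap_rightUnitor_inv]
  simp only [Category.assoc]
  rw [h1, ap_comp, Category.assoc, reassoc_of% (dη_whiskerLeft (homObj F a b) (homId F b)),
    ← MonoidalCategory.whiskerLeft_comp_assoc, dν_homId, reassoc_of% (dη_homComp F a b b),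
    homMul_right, Iso.inv_hom_id]
  rfl

lemma homComp_assoc (a b c d : S) :
    (α_ _ _ _).inv ≫ homComp F a b c ▷ homObj F c d ≫ homComp F a c d =
      homObj F a b ◁ homComp F b c d ≫ homComp F a b d := by
  refine tensor₃_ext fun T U Z => ?_
  have h1 := ap_nat (homComp F a b c ▷ homObj F c d ≫ homComp F a c d) (α_ T U Z).hom
  rw [ap_comp, reassoc_of% dη_assoc', h1, ap_comp, Category.assoc,
    reassoc_of% (dη_whiskerRight (homComp F a b c) (homObj F c d)),
    ← comp_whiskerRight_assoc, dη_homComp, reassoc_of% (dη_homComp F a c d), homMul_assoc,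
    Iso.inv_hom_id_assoc, ap_comp, reassoc_of% (dη_whiskerLeft (homObj F a b) (homComp F b c d)),
    ← MonoidalCategory.whiskerLeft_comp_assoc, dη_homComp, dη_homComp]

/-- The enriched category with object set `S` and hom-objects `T ↦ F_T(a, b)`. -/
@[reducible]
def enrichedOfLax : EnrichedCategory (NecV V) S where
  Hom := homObj F
  id := homId F
  comp := homComp F
  id_comp := homId_comp F
  comp_id := homComp_id F
  assoc a b c d := homComp_assoc F a b c d

end NecV

namespace Templicial

open VQuiv NecV Neck Functor.LaxMonoidal

variable {V : Type u} [Category.{v} V] [MonoidalCategory V] [SymmetricCategory V]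
  [MonoidalClosed V] [HasColimits V]

/-- The necklace category `X^nec`: its objects are the vertices of `X`, its hom-objects are
`T ↦ X_T(a, b)`, and its composition and identities are induced by
`X_T(a, b) ⊗ X_U(b, c) → X_{T ∨ U}(a, c)` and by `I = I_S(a, a)`. -/
def necObj (X : Templicial V) : NecCat V where
  Obj := X.S
  enriched := enrichedOfLax (Neck.toNec X.X)

variable {X Y Z : Templicial V}

lemma Hom.compat (p : Hom X Y) : Compat p.q where
  comul := p.comul
  counit := p.counit

/-- The map `X_T(a, b) → Y_T(f a, f b)`. -/
def Hom.at_ (p : Hom X Y) (a b : X.S) (L : List ℕ) :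
    (XL X.X L).obj a b ⟶ (XL Y.X L).obj (p.f a) (p.f b) := app (qL p.q L) a b

/-- The natural transformation `X_T(a, b) → Y_T(f a, f b)`, for `T` in `nec^op`. -/
def Hom.necMap (p : Hom X Y) (a b : X.S) :
    homObj (Neck.toNec X.X) a b ⟶ homObj (Neck.toNec Y.X) (p.f a) (p.f b) where
  natTrans :=
    { app := fun T => p.at_ a b T.unop.beads
      naturality := fun T U f =>
        congrArg (fun t => app t a b) (p.compat.nmap (valid f.unop)) }

lemma Hom.at_nil (p : Hom X Y) (a : X.S) :
    homOne (Neck.toNec X.X) a ≫ p.at_ a a [] = homOne (Neck.toNec Y.X) (p.f a) := by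
  have h1 : homOne (Neck.toNec X.X) a = uinj rfl := Category.comp_id _
  have h2 : homOne (Neck.toNec Y.X) (p.f a) = uinj rfl := Category.comp_id _
  rw [h1, h2]
  exact uinj_pullUnit (V := V) p.f (rfl : a = a)

lemma Hom.at_append (p : Hom X Y) (a b c : X.S) (T U : Necᵒᵖ) :
    homMul (Neck.toNec X.X) a b c T U ≫ p.at_ a c (T.unop.beads ++ U.unop.beads) =
      (p.at_ a b T.unop.beads ⊗ₘ p.at_ b c U.unop.beads) ≫
        homMul (Neck.toNec Y.X) (p.f a) (p.f b) (p.f c) T U := by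
  have h := congrArg (fun t => inj _ _ a b c ≫ app t a c)
    (qL_join p.q T.unop.beads U.unop.beads)
  simp only [app_comp, inj_tensorHom_assoc] at h
  refine (Category.assoc _ _ _).trans (h.trans ?_)
  exact congrArg (fun t => _ ≫ t) (inj_pullMul_assoc p.f _ _ a b c _)

lemma Hom.necMap_id (p : Hom X Y) (a : X.S) :
    homId (Neck.toNec X.X) a ≫ p.necMap a a = homId (Neck.toNec Y.X) (p.f a) := by
  refine NecV.unit_ext ?_
  rw [ap_comp, reassoc_of% (dν_homId (Neck.toNec X.X) a), dν_homId]
  exact p.at_nil a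

lemma Hom.necMap_comp (p : Hom X Y) (a b c : X.S) :
    homComp (Neck.toNec X.X) a b c ≫ p.necMap a c =
      (p.necMap a b ⊗ₘ p.necMap b c) ≫ homComp (Neck.toNec Y.X) (p.f a) (p.f b) (p.f c) := by
  refine NecV.tensor_ext fun T U => ?_
  rw [ap_comp, reassoc_of% (dη_homComp (Neck.toNec X.X) a b c), ap_comp,
    reassoc_of% (dη_tensorHom (p.necMap a b) (p.necMap b c)), dη_homComp]
  exact p.at_append a b c T U

lemma qL_id (L : List ℕ) : qL (Hom.id X).q L = 𝟙 (XL X.X L) := by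
  induction L with
  | nil => exact pullUnit_id
  | cons n L ih =>
    have h := pullMul_id (ob X.X n) (XL X.X L)
    have e : (𝟙 (ob X.X n) ⊗ₘ 𝟙 (XL X.X L)) ≫ 𝟙 (ob X.X n ⊗ XL X.X L) = 𝟙 _ := by simp
    refine Eq.trans ?_ e
    exact congrArg₂ (fun s t => (𝟙 (ob X.X n) ⊗ₘ s) ≫ t) ih h

lemma comp_cons {W : Type*} [Category W] [MonoidalCategory W] {A A' A'' B B' B'' C D E : W}
    {q : A ⟶ A'} {q' : A' ⟶ A''} {r : B ⟶ B'} {r' : B' ⟶ B''} {m : A'' ⊗ B'' ⟶ C}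
    {n : C ⟶ D} {m' : A' ⊗ B' ⟶ E} {l : E ⟶ C} (h : (q' ⊗ₘ r') ≫ m = m' ≫ l) :
    ((q ≫ q') ⊗ₘ (r ≫ r')) ≫ m ≫ n = ((q ⊗ₘ r) ≫ m') ≫ l ≫ n := by
  rw [← tensorHom_comp_tensorHom, Category.assoc, reassoc_of% h, Category.assoc]

lemma qL_comp (p : Hom X Y) (r : Hom Y Z) (L : List ℕ) :
    qL (p.comp r).q L = qL p.q L ≫ (pullback V p.f).map (qL r.q L) := by
  induction L with
  | nil => exact pullUnit_comp p.f r.f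
  | cons n L ih =>
    have h3 := pullMul_comp p.f r.f (ob Z.X n) (XL Z.X L)
    have h4 := μ_pull p.f (r.q.app (op ⟨n⟩)) (qL r.q L)
    refine (congrArg₂ (fun s t => ((p.q.app (op ⟨n⟩) ≫ (pullback V p.f).map (r.q.app (op ⟨n⟩))) ⊗ₘ
      s) ≫ t) ih h3).trans ?_
    refine (comp_cons h4).trans ?_
    exact congrArg (fun t => _ ≫ t) ((pullback V p.f).map_comp _ _).symm

variable (V) in
/-- The functor `(-)^nec : ts V → V Cat_nec`. -/
def nec : Templicial V ⥤ NecCat V where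
  obj := necObj
  map p :=
    { obj := p.f
      map := p.necMap
      map_id := p.necMap_id
      map_comp := p.necMap_comp }
  map_id X := EnrichedFunctor.ext _ (fun _ => rfl) fun a b =>
    (Category.comp_id _).trans (NecV.hom_ext fun T =>
      congrArg (fun t => app t a b) (qL_id T.unop.beads))
  map_comp p r := EnrichedFunctor.ext _ (fun _ => rfl) fun a b =>
    (Category.comp_id _).trans (NecV.hom_ext fun T =>
      congrArg (fun t => app t a b) (qL_comp p r T.unop.beads))

end Templicial

namespace Nec

/-- The simplex `Δ^n = {0 < n}`, seen as a necklace; `Δ^0` is the necklace `{0}`. -/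
def simplex : ℕ → Nec
  | 0 => ⟨[], by simp⟩
  | n + 1 => ⟨[n + 1], by simp⟩

lemma len_simplex (n : ℕ) : (simplex n).len = n := by
  cases n <;> simp [simplex, len]

lemma isJoint_simplex {n j : ℕ} : (simplex n).IsJoint j ↔ j = 0 ∨ j = n := by
  cases n with
  | zero => simp [simplex, IsJoint, eq_comm]
  | succ n =>
    simp only [simplex, IsJoint, List.prefix_cons_iff, List.prefix_nil]
    constructor
    · rintro ⟨L, rfl | ⟨L', rfl, rfl⟩, rfl⟩ <;> simp
    · rintro (rfl | rfl)
      · exact ⟨[], by simp⟩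
      · exact ⟨[n + 1], by simp⟩

/-- A map of intervals `[m] → [n]` as a map of necklaces `Δ^m → Δ^n`. -/
def simplexMap {m n : ℕ} (f : (⟨m⟩ : FInt) ⟶ ⟨n⟩) : simplex m ⟶ simplex n where
  toHom := (FInt.cast (len_simplex m) : (simplex m).vertices ⟶ ⟨m⟩) ≫ f ≫
    (FInt.cast (len_simplex n).symm : ⟨n⟩ ⟶ (simplex n).vertices)
  joint j hj := by
    rcases isJoint_simplex.1 hj with rfl | rfl
    · exact ⟨0, isJoint_simplex.2 (Or.inl rfl), FInt.fn_zero _⟩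
    · refine ⟨m, isJoint_simplex.2 (Or.inr rfl), ?_⟩
      rw [FInt.fn_last _ (by simp only [len_simplex]; exact le_rfl)]
      exact len_simplex j

/-- The inert map `ν_{k,l} : Δ^k ∨ Δ^l → Δ^n` for `n = k + l`, which is the identity on vertices. -/
def inert (k l n : ℕ) (h : n = k + l) : simplex k ⊗ simplex l ⟶ simplex n where
  toHom := FInt.cast (by simp only [len_tensor, len_simplex, h])
  joint j hj := by
    rcases isJoint_simplex.1 hj with rfl | rfl
    · exact ⟨0, isJoint_wedge.2 (Or.inl (isJoint_simplex.2 (Or.inl rfl))), FInt.fn_zero _⟩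
    · refine ⟨k + l, isJoint_wedge.2 (Or.inr ⟨l, isJoint_simplex.2 (Or.inr rfl),
        by rw [len_simplex]⟩), ?_⟩
      rw [FInt.fn_cast]
      simp only [len_tensor, len_simplex, h, min_self]

end Nec

namespace NecCat

open VQuiv NecV Neck

variable {V : Type u} [Category.{v} V] [MonoidalCategory V] [SymmetricCategory V]
  [MonoidalClosed V] [HasColimits V] (C : NecCat V)

/-- The hom-object `C(a, b)` in `V^{nec^op}`. -/
abbrev hom (a b : C.Obj) : NecV V := EnrichedCategory.Hom a b

/-- The quiver `C_T = (C_T(a, b))_{a, b}`. -/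
def quiv (T : Nec) : VQuiv V C.Obj where
  obj a b := (C.hom a b).at_ (op T)

/-- The action of a map of necklaces, `C(f) : C_U → C_T`. -/
def act {T U : Nec} (f : T ⟶ U) : C.quiv U ⟶ C.quiv T where
  app a b := (C.hom a b).functor.map f.op

/-- The map `m_{T,U} : C_T ⊗ C_U → C_{T ∨ U}` induced by the composition of `C`. -/
def mul (T U : Nec) : C.quiv T ⊗ C.quiv U ⟶ C.quiv (T ⊗ U) where
  app a c := VQuiv.tdesc fun b =>
    dη (C.hom a b) (C.hom b c) (op T) (op U) ≫ ap (eComp (NecV V) a b c) (op (T ⊗ U))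

/-- The map `u : I_S → C_{{0}}` induced by the identities of `C`. -/
def one : 𝟙_ (VQuiv V C.Obj) ⟶ C.quiv (Nec.simplex 0) where
  app a b := VQuiv.udesc fun h =>
    dν V ≫ ap (eId (NecV V) a) (𝟙_ _) ≫ eqToHom (by subst h; rfl)

section

variable (X : FIntᵒᵖ ⥤ VQuiv V C.Obj) [X.OplaxMonoidal]
  (p : ∀ n, ob X n ⟶ C.quiv (Nec.simplex n))

/-- A cone with vertex `Q` over the diagram
`C_{Δ^n} → ∏_{k,l} C_{Δ^k ∨ Δ^l} ← ∏_{k,l} X_k ⊗ X_l ⇉ ∏_{r,s,t} X_r ⊗ X_s ⊗ X_t`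
of quivers, where all indices are positive, `k + l = n` and `r + s + t = n`, and where the maps are
given by `C(ν_{k,l})`, by `m ∘ (p_k ⊗ p_l)`, and by `id ⊗ μ_{s,t}` and `μ_{r,s} ⊗ id`. -/
structure TempCone (n : ℕ) (Q : VQuiv V C.Obj) where
  fst : Q ⟶ C.quiv (Nec.simplex n)
  snd (k l : ℕ) (hk : 0 < k) (hl : 0 < l) (h : n = k + l) : Q ⟶ ob X k ⊗ ob X l
  mul (k l : ℕ) (hk : 0 < k) (hl : 0 < l) (h : n = k + l) :
    snd k l hk hl h ≫ (p k ⊗ₘ p l) ≫ C.mul (Nec.simplex k) (Nec.simplex l) =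
      fst ≫ C.act (Nec.inert k l n h)
  coassoc (r s t : ℕ) (hr : 0 < r) (hs : 0 < s) (ht : 0 < t) (h : n = r + s + t) :
    snd r (s + t) hr (by omega) (by omega) ≫ ob X r ◁ comul X s t (s + t) rfl =
      snd (r + s) t (by omega) ht h ≫ comul X r s (r + s) rfl ▷ ob X t ≫ (α_ _ _ _).hom

/-- The inductive construction of `C^temp` and of the maps `p_n : C^temp_n → C_{Δ^n}`:
`C^temp_0 ≅ I_S` by the counit, and `p_0` is induced by `u : I_S → C_{{0}}`; for `n > 0`, `C^temp_n` with the maps `p_n` and `μ_{k,l}`,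
`k, l > 0`, is the limit of the diagram above; and, for a map of intervals `f`, the map `C^temp(f)`
is compatible with the `μ_{k,l}` (which is the naturality of the colax structure) and the `p_n`. -/
structure IsTemp : Prop where
  unit : p 0 = coun X ≫ C.one
  map {m n : ℕ} (f : (⟨m⟩ : FInt) ⟶ ⟨n⟩) : mp X f ≫ p m = p n ≫ C.act (Nec.simplexMap f)
  mul (k l n : ℕ) (hk : 0 < k) (hl : 0 < l) (h : n = k + l) :
    comul X k l n h ≫ (p k ⊗ₘ p l) ≫ C.mul (Nec.simplex k) (Nec.simplex l) =
      p n ≫ C.act (Nec.inert k l n h)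
  limit (n : ℕ) (hn : 0 < n) (Q : VQuiv V C.Obj) (c : C.TempCone X p n Q) :
    ∃! z : Q ⟶ ob X n, z ≫ p n = c.fst ∧
      ∀ (k l : ℕ) (hk : 0 < k) (hl : 0 < l) (h : n = k + l), z ≫ comul X k l n h = c.snd k l hk hl h

end

/-- A result `C^temp` of the inductive limit construction (which depends on a choice of limits). -/
structure Temp where
  X : FIntᵒᵖ ⥤ VQuiv V C.Obj
  [oplax : X.OplaxMonoidal]
  [unital : IsIso (Functor.OplaxMonoidal.η X)]
  p (n : ℕ) : ob X n ⟶ C.quiv (Nec.simplex n)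
  isTemp : C.IsTemp X p

/-- `C^temp` as a templicial object with set of vertices the set of objects of `C`. -/
def Temp.toTemplicial {C : NecCat V} (D : C.Temp) : Templicial V where
  S := C.Obj
  X := D.X
  oplax := D.oplax
  unital := D.unital

end NecCat

end

/-! By the universal property of the Day convolution, a necklace category `C` with object set `S`
amounts to a lax monoidal functor `T ↦ C_T` from `nec^op` to quivers on `S` (`NecCat.toLax`). An
enriched functor into `C` from the necklace category of a lax monoidal functor `F`, acting on
objects by `f`, amounts to a monoidal transformation `F → f^* C` (`homOfTrans`, `transOfHom`).

For `Y^nec` the value at a necklace is the tensor product of the values at its beads, so a monoidal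
transformation `Y^nec → G` is determined by its components `Y_n → G_{Δ^n}` (`eq_extendL`).
Conversely, a family `Y_n → G_{Δ^n}` extends as soon as it respects interval maps, the inert maps
`Δ^k ∨ Δ^l → Δ^n` and the unit (`SimplexMaps`). The reason is that a map of necklaces decomposes
bead by bead: the target is cut at the image of the end of the first bead, an interval map acts on
that bead, and a map with fewer beads remains (`SimplexMaps.split`, `SimplexMaps.natural`).

A family of this kind with values in `f^* C` is the same as a map of templicial objects into
`C^temp` over `f`. In degree `n` the limit defining `C^temp_n` asks for a map to `C_{Δ^n}` and
compatible, coassociative maps to `C^temp_k ⊗ C^temp_l`; the comultiplications of `Y` followed by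
the lifts in lower degrees provide these. Uniqueness in the limit gives naturality and uniqueness of
the lift (`exists_lift`, `lift_unique`). The limit may be used over any `f`, since `f^*` is a right
adjoint (`Temp.isRelLimit`). Hence composition with the counit `(C^temp)^nec → C` is bijective
(`Temp.bijective`), and the functor `(-)^temp` and the adjunction follow formally.

For full faithfulness, `X` is itself a possible choice of `(X^nec)^temp` (`selfTemp`): the maps `X_n
→ X^nec_{Δ^n}` and the multiplications of `X^nec` are isomorphisms, so a cone is determined by its
first leg. For this choice the counit is the identity, and `Temp.bijective` becomes the bijectivity
of `(-)^nec` on morphisms (`nec_map_bijective`).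

For existence, a first recursion on the degree produces the objects, the maps `p_n` and the
nondegenerate comultiplications (`nonempty_limitTower`). A second one, on the length of the source,
produces the actions of interval maps (`GoodMap.exists_good`). Functoriality again comes from
uniqueness in the limit.

Throughout, maps of necklaces are determined by their values on vertices, so that equations between
them are checked by arithmetic. -/

noncomputable section

/-! ### Maps of necklaces that are the identity on vertices; cuts -/

namespace Nec

/-- The map of necklaces which is the identity on vertices. -/
def idMap {T U : Nec} (h : T.len = U.len) (hj : ∀ j, U.IsJoint j → T.IsJoint j) : T ⟶ U where
  toHom := FInt.cast h
  joint j hU := ⟨j, hj j hU, by rw [FInt.fn_cast, min_eq_left (hj j hU).le]⟩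

lemma fn_idMap {T U : Nec} (h : T.len = U.len) (hj : ∀ j, U.IsJoint j → T.IsJoint j) (i : ℕ) :
    fn (idMap h hj) i = min i T.len := FInt.fn_cast (m := T.vertices) (n := U.vertices) h i

lemma fn_inert (k l n : ℕ) (h : n = k + l) (i : ℕ) : fn (inert k l n h) i = min i n := by
  have e : (simplex k ⊗ simplex l).vertices.len = (simplex n).vertices.len := by
    simp only [len_tensor, len_simplex, h]
  refine (FInt.fn_cast e i).trans ?_
  rw [e]
  exact congrArg _ (len_simplex n)

lemma fn_simplexMap {m n : ℕ} (f : (⟨m⟩ : FInt) ⟶ ⟨n⟩) (i : ℕ) :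
    fn (simplexMap f) i = FInt.fn f i := by
  refine (FInt.fn_comp _ _ _).trans ?_
  rw [FInt.fn_comp, FInt.fn_cast, FInt.fn_cast]
  have := FInt.fn_le f i
  have h2 := FInt.fn_min f i
  simp only [len_simplex] at *
  rw [h2]
  omega

lemma simplexMap_id (n : ℕ) : simplexMap (𝟙 (⟨n⟩ : FInt)) = 𝟙 _ :=
  hom_ext fun i hi => by
    rw [fn_simplexMap, FInt.fn_id, fn_id, len_simplex]

lemma simplexMap_comp {m n k : ℕ} (f : (⟨m⟩ : FInt) ⟶ ⟨n⟩) (g : (⟨n⟩ : FInt) ⟶ ⟨k⟩) :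
    simplexMap (f ≫ g) = simplexMap f ≫ simplexMap g :=
  hom_ext fun i hi => by
    rw [fn_simplexMap, FInt.fn_comp, fn_comp, fn_simplexMap, fn_simplexMap]

lemma isJoint_cons {u : ℕ} {U : List ℕ} {h : ∀ n ∈ u :: U, 0 < n} {h' : ∀ n ∈ U, 0 < n} {j : ℕ} :
    (⟨u :: U, h⟩ : Nec).IsJoint j ↔ j = 0 ∨ ∃ i, (⟨U, h'⟩ : Nec).IsJoint i ∧ j = u + i := by
  simp only [IsJoint, List.prefix_cons_iff]
  constructor
  · rintro ⟨L, rfl | ⟨L', rfl, hL⟩, rfl⟩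
    · exact Or.inl rfl
    · exact Or.inr ⟨L'.sum, ⟨L', hL, rfl⟩, by simp⟩
  · rintro (rfl | ⟨i, ⟨L, hL, rfl⟩, rfl⟩)
    · exact ⟨[], Or.inl rfl, rfl⟩
    · exact ⟨u :: L, Or.inr ⟨L, rfl, hL⟩, by simp⟩

/-- Uniform in `s`: for `s = 0` the necklace `simplex 0` has no beads, and its two joints `0` and
`s` coincide. Cuts at the vertex `0` are therefore covered. -/
lemma isJoint_simplex_wedge {s : ℕ} {T : Nec} {j : ℕ} :
    (simplex s ⊗ T).IsJoint j ↔ j = 0 ∨ ∃ i, T.IsJoint i ∧ j = s + i := by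
  refine isJoint_wedge.trans ?_
  rw [isJoint_simplex, len_simplex]
  constructor
  · rintro ((h | rfl) | h)
    · exact Or.inl h
    · exact Or.inr ⟨0, ⟨[], List.nil_prefix, rfl⟩, rfl⟩
    · exact Or.inr h
  · rintro (h | h)
    · exact Or.inl (Or.inl h)
    · exact Or.inr h

lemma len_cons (u : ℕ) (U : List ℕ) (h : ∀ n ∈ u :: U, 0 < n) (h' : ∀ n ∈ U, 0 < n) :
    (⟨u :: U, h⟩ : Nec).len = u + (⟨U, h'⟩ : Nec).len := by simp [len]

/-- The identification of a necklace with the wedge of its first bead and its other beads. -/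
def consMap (u : ℕ) (U : List ℕ) (h : ∀ n ∈ u :: U, 0 < n) (h' : ∀ n ∈ U, 0 < n) :
    (⟨u :: U, h⟩ : Nec) ⟶ simplex u ⊗ ⟨U, h'⟩ :=
  idMap (by rw [len_tensor, len_simplex, len_cons u U h h'])
    fun j hj => isJoint_cons.2 (isJoint_simplex_wedge.1 hj)

/-- The map from the wedge of a simplex with the remaining beads induced by a cut. -/
def cutMap {U : List ℕ} {s : ℕ} {U' : List ℕ} (c : Neck.Cut U s U') (h : ∀ n ∈ U, 0 < n)
    (h' : ∀ n ∈ U', 0 < n) : simplex s ⊗ ⟨U', h'⟩ ⟶ (⟨U, h⟩ : Nec) :=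
  idMap (by rw [len_tensor, len_simplex]; exact c.sum.symm) fun j hj => by
    -- Cutting may create the joint `s` but destroys none, which is the direction required of a map
    -- `Δ^s ∨ U' → U`. In the case of a cut inside a bead, a later joint `u + i` reappears as `s +
    -- (r + i)`.
    rw [isJoint_simplex_wedge]
    cases c with
    | nil =>
      obtain ⟨L, hL, rfl⟩ := hj
      rw [List.prefix_nil.1 hL]
      exact Or.inl rfl
    | full u U => exact (isJoint_cons (h' := h')).1 hj
    | part u s r U e hr =>
      rcases (isJoint_cons (h' := fun n hn => h n (List.mem_cons_of_mem _ hn))).1 hj with rfl | ⟨i, hi, rfl⟩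
      · exact Or.inl rfl
      · exact Or.inr ⟨r + i, (isJoint_cons (h' := fun n hn => h n (List.mem_cons_of_mem _ hn))).2
          (Or.inr ⟨i, hi, rfl⟩), by omega⟩

lemma fn_consMap (u : ℕ) (U : List ℕ) (h : ∀ n ∈ u :: U, 0 < n) (h' : ∀ n ∈ U, 0 < n) (i : ℕ) :
    fn (consMap u U h h') i = min i (u + U.sum) :=
  (fn_idMap _ _ i).trans (congrArg _ (by simp [len]))

lemma fn_cutMap {U : List ℕ} {s : ℕ} {U' : List ℕ} (c : Neck.Cut U s U') (h : ∀ n ∈ U, 0 < n)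
    (h' : ∀ n ∈ U', 0 < n) (i : ℕ) : fn (cutMap c h h') i = min i (s + U'.sum) :=
  (fn_idMap _ _ i).trans (congrArg _ (by rw [len_tensor, len_simplex]; rfl))

lemma fn_whiskerLeft (T : Nec) {U U' : Nec} (f : U ⟶ U') (i : ℕ) :
    fn (T ◁ f) i = min i T.len + fn f (i - T.len) := by
  rw [← id_tensorHom, fn_tensorHom, fn_id]

lemma fn_whiskerRight {T T' : Nec} (f : T ⟶ T') (U : Nec) (i : ℕ) :
    fn (f ▷ U) i = fn f i + min (i - T.len) U.len := by
  rw [← tensorHom_id, fn_tensorHom, fn_id]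

lemma fn_assoc_inv (T U V : Nec) (i : ℕ) :
    fn (α_ T U V).inv i = min i (T.len + (U.len + V.len)) := by
  rw [← len_tensor, ← len_tensor]
  exact fn_eqToHom (Nec.ext (List.append_assoc _ _ _)).symm _

/-- The left unitor, as a map of necklaces `Δ^0 ∨ T → T`. -/
def leftMap (T : Nec) : simplex 0 ⊗ T ⟶ T := (λ_ T).hom

/-- The right unitor, as a map of necklaces `T ∨ Δ^0 → T`. -/
def rightMap (T : Nec) : T ⊗ simplex 0 ⟶ T := (ρ_ T).hom

lemma fn_leftMap (T : Nec) (i : ℕ) : fn (leftMap T) i = min i T.len := fn_left T i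

lemma fn_rightMap (T : Nec) (i : ℕ) : fn (rightMap T) i = min i T.len := fn_right T i

end Nec

/-! ### Extending maps on simplices to maps on all necklaces -/

namespace Neck

open Functor.LaxMonoidal

variable {W : Type u} [Category.{v} W] [MonoidalCategory W]

section lax

variable (G : Necᵒᵖ ⥤ W)

/-- The action `G_U → G_T` of a map of necklaces `T → U`. -/
abbrev lmap {T U : Nec} (f : T ⟶ U) : G.obj (op U) ⟶ G.obj (op T) := G.map f.op

lemma lmap_comp {T U Z : Nec} (f : T ⟶ U) (g : U ⟶ Z) : lmap G (f ≫ g) = lmap G g ≫ lmap G f :=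
  G.map_comp _ _

lemma lmap_id (T : Nec) : lmap G (𝟙 T) = 𝟙 _ := G.map_id _

variable [G.LaxMonoidal]

/-- The multiplication `G_T ⊗ G_U → G_{T ∨ U}`. -/
def lmul (T U : Nec) : G.obj (op T) ⊗ G.obj (op U) ⟶ G.obj (op (T ⊗ U)) := μ G (op T) (op U)

/-- The unit `I → G_{Δ^0}`. -/
def lone : 𝟙_ W ⟶ G.obj (op (Nec.simplex 0)) := ε G

lemma lmul_nat {T T' U U' : Nec} (f : T ⟶ T') (g : U ⟶ U') :
    (lmap G f ⊗ₘ lmap G g) ≫ lmul G T U = lmul G T' U' ≫ lmap G (f ⊗ₘ g) :=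
  μ_natural G f.op g.op

/-- The associator of `Necᵒᵖ` acts through the inverse of the associator of `Nec`. Its action is
moved to the other side, so that only maps of necklaces remain. -/
lemma lmul_assoc (T U Z : Nec) :
    lmul G T U ▷ _ ≫ lmul G (T ⊗ U) Z =
      (α_ _ _ _).hom ≫ _ ◁ lmul G U Z ≫ lmul G T (U ⊗ Z) ≫ lmap G (α_ T U Z).hom := by
  have h := associativity G (op T) (op U) (op Z)
  have e : G.map (α_ (op T) (op U) (op Z)).hom = lmap G (α_ T U Z).inv := rfl
  have e' : lmap G (α_ T U Z).inv ≫ lmap G (α_ T U Z).hom = 𝟙 _ := by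
    rw [← lmap_comp, Iso.hom_inv_id, lmap_id]
  rw [e] at h
  have h' := congrArg (· ≫ lmap G (α_ T U Z).hom) h
  simp only [Category.assoc] at h'
  refine Eq.trans ?_ h'
  refine (Category.comp_id _).symm.trans ?_
  rw [Category.assoc]
  exact congrArg (fun t => _ ≫ _ ≫ t) e'.symm

lemma lmul_left (T : Nec) :
    lone G ▷ _ ≫ lmul G (Nec.simplex 0) T = (λ_ _).hom ≫ lmap G (Nec.leftMap T) := by
  have h := left_unitality G (op T)
  have e : G.map (λ_ (op T)).hom = lmap G (λ_ T).inv := rfl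
  have e' : lmap G (λ_ T).inv ≫ lmap G (λ_ T).hom = 𝟙 _ := by
    rw [← lmap_comp, Iso.hom_inv_id, lmap_id]
  rw [h, e, Category.assoc, Category.assoc]
  refine (Category.comp_id _).symm.trans ?_
  rw [Category.assoc]
  exact congrArg (fun t => _ ≫ _ ≫ t) e'.symm

lemma lmul_right (T : Nec) :
    _ ◁ lone G ≫ lmul G T (Nec.simplex 0) = (ρ_ _).hom ≫ lmap G (Nec.rightMap T) := by
  have h := right_unitality G (op T)
  have e : G.map (ρ_ (op T)).hom = lmap G (ρ_ T).inv := rfl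
  have e' : lmap G (ρ_ T).inv ≫ lmap G (ρ_ T).hom = 𝟙 _ := by
    rw [← lmap_comp, Iso.hom_inv_id, lmap_id]
  rw [h, e, Category.assoc, Category.assoc]
  refine (Category.comp_id _).symm.trans ?_
  rw [Category.assoc]
  exact congrArg (fun t => _ ≫ _ ≫ t) e'.symm

end lax

variable (Y : FIntᵒᵖ ⥤ W) [Y.OplaxMonoidal] (G : Necᵒᵖ ⥤ W) [G.LaxMonoidal]

/-- A family of maps `Y_n → G_{Δ^n}` compatible with the actions of maps of intervals and with the
(co)multiplications and (co)units. -/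
structure SimplexMaps (r : ∀ n, ob Y n ⟶ G.obj (op (Nec.simplex n))) : Prop where
  unit : r 0 = coun Y ≫ lone G
  map {m n : ℕ} (f : (⟨m⟩ : FInt) ⟶ ⟨n⟩) : mp Y f ≫ r m = r n ≫ lmap G (Nec.simplexMap f)
  mul (k l n : ℕ) (hk : 0 < k) (hl : 0 < l) (h : n = k + l) :
    comul Y k l n h ≫ (r k ⊗ₘ r l) ≫ lmul G (Nec.simplex k) (Nec.simplex l) =
      r n ≫ lmap G (Nec.inert k l n h)

variable {Y G} {r : ∀ n, ob Y n ⟶ G.obj (op (Nec.simplex n))}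

variable (r) in
/-- The extension of maps `Y_n → G_{Δ^n}` to maps `Y_T → G_T` for all necklaces `T`. -/
def extendL : (L : List ℕ) → (h : ∀ n ∈ L, 0 < n) → (XL Y L ⟶ G.obj (op ⟨L, h⟩))
  | [], _ => lone G
  | n :: L, h => (r n ⊗ₘ extendL L (fun m hm => h m (List.mem_cons_of_mem _ hm))) ≫
      lmul G _ _ ≫ lmap G (Nec.consMap n L h _)

lemma extendL_cons (n : ℕ) (L : List ℕ) (h : ∀ m ∈ n :: L, 0 < m) (h' : ∀ m ∈ L, 0 < m) :
    extendL r (n :: L) h = (r n ⊗ₘ extendL r L h') ≫ lmul G _ _ ≫ lmap G (Nec.consMap n L h h') :=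
  rfl

lemma lmul_nat_left {T T' : Nec} (f : T ⟶ T') (U : Nec) :
    lmap G f ▷ _ ≫ lmul G T U = lmul G T' U ≫ lmap G (f ▷ U) := by
  have := lmul_nat G f (𝟙 U)
  rwa [lmap_id, tensorHom_id, tensorHom_id] at this

lemma lmul_nat_right {T T' : Nec} (U : Nec) (f : T ⟶ T') :
    _ ◁ lmap G f ≫ lmul G U T = lmul G U T' ≫ lmap G (U ◁ f) := by
  have := lmul_nat G (𝟙 U) f
  rwa [lmap_id, id_tensorHom, id_tensorHom] at this

/-- The monoidal bookkeeping for a cut inside a bead: splitting that bead and multiplying from the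
right agrees, by the associativity of `G`, with multiplying first and then restricting along the map
`f` on the bead. -/
lemma extendL_part {A A₁ A₂ B : W} {F F' X₁ X₂ X : Nec}
    (c : A ⟶ A₁ ⊗ A₂) (q : A ⟶ G.obj (op X)) (q₁ : A₁ ⟶ G.obj (op X₁)) (q₂ : A₂ ⟶ G.obj (op X₂))
    (l : B ⟶ G.obj (op F)) (f : X₁ ⊗ X₂ ⟶ X) (κ : F' ⟶ X₂ ⊗ F)
    (h : c ≫ (q₁ ⊗ₘ q₂) ≫ lmul G _ _ = q ≫ lmap G f) :
    (c ▷ B ≫ (α_ _ _ _).hom) ≫ (q₁ ⊗ₘ ((q₂ ⊗ₘ l) ≫ lmul G _ _ ≫ lmap G κ)) ≫ lmul G X₁ F' =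
      ((q ⊗ₘ l) ≫ lmul G _ _) ≫ lmap G (X₁ ◁ κ ≫ (α_ X₁ X₂ F).inv ≫ f ▷ F) := by
  have h1 : (q₁ ⊗ₘ ((q₂ ⊗ₘ l) ≫ lmul G X₂ F ≫ lmap G κ)) =
      (q₁ ⊗ₘ (q₂ ⊗ₘ l)) ≫ G.obj _ ◁ lmul G _ _ ≫ G.obj _ ◁ lmap G κ := by
    simp only [← id_tensorHom, tensorHom_comp_tensorHom, Category.comp_id, Category.assoc]
  have h2 : c ▷ B ≫ ((q₁ ⊗ₘ q₂) ⊗ₘ l) ≫ lmul G _ _ ▷ _ = (q ⊗ₘ l) ≫ lmap G f ▷ _ := by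
    simp only [← tensorHom_id, tensorHom_comp_tensorHom, Category.id_comp, Category.comp_id, h]
  have h5 : lmap G (α_ X₁ X₂ F).hom ≫ lmap G (α_ X₁ X₂ F).inv = 𝟙 _ := by
    rw [← lmap_comp, Iso.inv_hom_id, lmap_id]
  have h6 := congrArg (· ≫ lmap G (α_ X₁ X₂ F).inv) (lmul_assoc G X₁ X₂ F)
  simp only [Category.assoc] at h6
  rw [h5, Category.comp_id] at h6
  simp only [h1, Category.assoc, lmap_comp]
  rw [lmul_nat_right, ← associator_naturality_assoc, ← reassoc_of% h6, reassoc_of% h2,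
    reassoc_of% (lmul_nat_left f F)]

/-- A map that is the identity on vertices must be the inverse of the left unitor, so the unit law
of `G` applies. -/
lemma lmul_left_cancel {A : W} {T : Nec} (f : T ⟶ Nec.simplex 0 ⊗ T)
    (hf : ∀ i ≤ T.len, Nec.fn f i = i) (x : A ⟶ G.obj (op T)) :
    (lone G ⊗ₘ x) ≫ lmul G (Nec.simplex 0) T ≫ lmap G f = (λ_ A).hom ≫ x := by
  have : lmap G (Nec.leftMap T) ≫ lmap G f = 𝟙 _ := by
    rw [← lmap_id, ← lmap_comp]
    refine congrArg (fun t => lmap G t) (Nec.hom_ext fun i hi => ?_)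
    rw [Nec.fn_comp, hf i hi, Nec.fn_leftMap, Nec.fn_id]
  rw [tensorHom_def', Category.assoc, reassoc_of% (lmul_left G T), this, Category.comp_id,
    leftUnitor_naturality]

lemma lmul_right_cancel {A : W} {T : Nec} (f : T ⟶ T ⊗ Nec.simplex 0)
    (hf : ∀ i ≤ T.len, Nec.fn f i = i) (x : A ⟶ G.obj (op T)) :
    (x ⊗ₘ lone G) ≫ lmul G T (Nec.simplex 0) ≫ lmap G f = (ρ_ A).hom ≫ x := by
  have : lmap G (Nec.rightMap T) ≫ lmap G f = 𝟙 _ := by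
    rw [← lmap_id, ← lmap_comp]
    refine congrArg (fun t => lmap G t) (Nec.hom_ext fun i hi => ?_)
    rw [Nec.fn_comp, hf i hi, Nec.fn_rightMap, Nec.fn_id]
  rw [MonoidalCategory.tensorHom_def, Category.assoc, reassoc_of% (lmul_right G T), this,
    Category.comp_id, rightUnitor_naturality]

/-- The induction step of `extendL_join`. The hypothesis `e` compares two composites of necklace
maps and is verified on vertices when the lemma is used. -/
lemma extendL_coh {A B C D : W} {S T U Z Z' F : Nec} (q : A ⟶ G.obj (op S)) (l : B ⟶ G.obj (op T))
    (m : C ⟶ G.obj (op U)) (n : D ⟶ G.obj (op Z)) (j : B ⊗ C ⟶ D) (f₀ : Z ⟶ T ⊗ U)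
    (κ : F ⟶ S ⊗ Z) (κ' : Z' ⟶ S ⊗ T) (f : F ⟶ Z' ⊗ U)
    (h : j ≫ n = (l ⊗ₘ m) ≫ lmul G _ _ ≫ lmap G f₀)
    (e : κ ≫ S ◁ f₀ = f ≫ κ' ▷ U ≫ (α_ S T U).hom) :
    ((α_ _ _ _).hom ≫ A ◁ j) ≫ (q ⊗ₘ n) ≫ lmul G _ _ ≫ lmap G κ =
      (((q ⊗ₘ l) ≫ lmul G _ _ ≫ lmap G κ') ⊗ₘ m) ≫ lmul G _ _ ≫ lmap G f := by
  have h1 : A ◁ j ≫ (q ⊗ₘ n) = (q ⊗ₘ (l ⊗ₘ m)) ≫ _ ◁ lmul G _ _ ≫ _ ◁ lmap G f₀ := by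
    simp only [← id_tensorHom, tensorHom_comp_tensorHom, h, Category.id_comp, Category.comp_id,
      Category.assoc]
  have h2 : (((q ⊗ₘ l) ≫ lmul G _ _ ≫ lmap G κ') ⊗ₘ m) =
      ((q ⊗ₘ l) ⊗ₘ m) ≫ lmul G _ _ ▷ _ ≫ lmap G κ' ▷ _ := by
    simp only [← tensorHom_id, tensorHom_comp_tensorHom, Category.comp_id, Category.assoc]
  have e' := congrArg (fun t => lmap G t) e
  simp only [lmap_comp] at e'
  simp only [Category.assoc]
  rw [reassoc_of% h1, h2]
  simp only [Category.assoc]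
  rw [reassoc_of% (lmul_nat_left κ' U), reassoc_of% (lmul_assoc G S T U),
    reassoc_of% (lmul_nat_right S f₀), associator_naturality_assoc, e', Category.assoc]

/-- Each bead of `L` costs one use of the associativity of `G`. The map `f`, the identity on
vertices, stands for the identification of the two necklaces; keeping it arbitrary replaces
transport along equalities by a comparison of vertices. -/
lemma extendL_join (L M : List ℕ) (hL : ∀ n ∈ L, 0 < n) (hM : ∀ n ∈ M, 0 < n)
    (hLM : ∀ n ∈ L ++ M, 0 < n) (f : (⟨L ++ M, hLM⟩ : Nec) ⟶ ⟨L, hL⟩ ⊗ ⟨M, hM⟩)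
    (hf : ∀ i ≤ (L ++ M).sum, Nec.fn f i = i) :
    join Y L M ≫ extendL r (L ++ M) hLM =
      (extendL r L hL ⊗ₘ extendL r M hM) ≫ lmul G ⟨L, hL⟩ ⟨M, hM⟩ ≫ lmap G f := by
  induction L with
  | nil => exact (lmul_left_cancel (T := ⟨M, hM⟩) f hf (extendL r M hM)).symm
  | cons n L ih =>
    have hL' : ∀ n ∈ L, 0 < n := fun n hn => hL n (List.mem_cons_of_mem _ hn)
    have hLM' : ∀ n ∈ L ++ M, 0 < n := fun n hn => hLM n (List.mem_cons_of_mem _ hn)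
    let f₀ : (⟨L ++ M, hLM'⟩ : Nec) ⟶ ⟨L, hL'⟩ ⊗ ⟨M, hM⟩ :=
      Nec.idMap (by rw [Nec.len_tensor]; simp [Nec.len]) fun j hj => hj
    have hf₀ : ∀ i ≤ (L ++ M).sum, Nec.fn f₀ i = i :=
      fun i hi => (Nec.fn_idMap _ _ _).trans (min_eq_left hi)
    refine extendL_coh (r n) (extendL r L hL') (extendL r M hM) (extendL r (L ++ M) hLM')
      (join Y L M) f₀ (Nec.consMap n (L ++ M) hLM hLM') (Nec.consMap n L hL hL') f
      (ih hL' hLM' f₀ hf₀) (Nec.hom_ext fun i hi => ?_)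
    have hi' : i ≤ n + (L ++ M).sum := hi
    simp only [Nec.fn_comp, Nec.fn_whiskerLeft, Nec.fn_whiskerRight, Nec.fn_assoc,
      Nec.fn_consMap, Nec.len_simplex]
    rw [min_eq_left hi', hf₀ _ (by omega), hf i hi']
    simp only [Nec.len, List.sum_append, List.sum_cons] at hi' ⊢
    omega

lemma extendL_append (T U : Nec) :
    join Y T.beads U.beads ≫ extendL r (T ⊗ U).beads (T ⊗ U).pos =
      (extendL r T.beads T.pos ⊗ₘ extendL r U.beads U.pos) ≫ lmul G T U := by
  have := extendL_join (r := r) T.beads U.beads T.pos U.pos (T ⊗ U).pos (𝟙 (T ⊗ U))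
    fun i hi => min_eq_left hi
  refine this.trans (congrArg (fun t => _ ≫ t) ?_)
  exact (congrArg (fun t => _ ≫ t) (lmap_id G (T ⊗ U))).trans (Category.comp_id _)

variable [IsIso (Functor.OplaxMonoidal.η Y)]

lemma SimplexMaps.un (hr : SimplexMaps Y G r) : un Y ≫ r 0 = lone G := by
  rw [hr.unit, Neck.un, IsIso.inv_hom_id_assoc]

/-- The compatibility with multiplications also holds for the degenerate decompositions. -/
lemma SimplexMaps.mul' (hr : SimplexMaps Y G r) (k l n : ℕ) (h : n = k + l) :
    comul Y k l n h ≫ (r k ⊗ₘ r l) ≫ lmul G (Nec.simplex k) (Nec.simplex l) =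
      r n ≫ lmap G (Nec.inert k l n h) := by
  rcases Nat.eq_zero_or_pos k with rfl | hk
  · obtain rfl : n = l := by omega
    rw [comul_left', MonoidalCategory.tensorHom_def, Category.assoc, Category.assoc,
      ← comp_whiskerRight_assoc, hr.un, ← whisker_exchange_assoc, lmul_left,
      leftUnitor_naturality_assoc, Iso.inv_hom_id_assoc]
    refine congrArg (fun t => _ ≫ lmap G t) (Nec.hom_ext fun i hi => ?_)
    rw [Nec.fn_leftMap, Nec.fn_inert, Nec.len_simplex]
  · rcases Nat.eq_zero_or_pos l with rfl | hl
    · obtain rfl : n = k := by omega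
      rw [comul_right', tensorHom_def', Category.assoc, Category.assoc,
        ← MonoidalCategory.whiskerLeft_comp_assoc, hr.un, whisker_exchange_assoc, lmul_right,
        rightUnitor_naturality_assoc, Iso.inv_hom_id_assoc]
      refine congrArg (fun t => _ ≫ lmap G t) (Nec.hom_ext fun i hi => ?_)
      rw [Nec.fn_rightMap, Nec.fn_inert, Nec.len_simplex]
    · exact hr.mul k l n hk hl h

/-- Compatibility of the extension with cuts. The empty necklace is the unit law, a cut at the end
of the first bead is the recursive definition of `extendL`, and a cut inside that bead is the
compatibility with the inert map. There `s = 0` may occur, which is why `mul'` is used. -/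
lemma SimplexMaps.split (hr : SimplexMaps Y G r) {U U' : List ℕ} {s : ℕ} (c : Cut U s U')
    (h : ∀ n ∈ U, 0 < n) (h' : ∀ n ∈ U', 0 < n) :
    Neck.split Y c ≫ (r s ⊗ₘ extendL r U' h') ≫ lmul G _ _ =
      extendL r U h ≫ lmap G (Nec.cutMap c h h') := by
  cases c with
  | nil =>
    have h1 : ((λ_ (𝟙_ W)).inv ≫ Neck.un Y ▷ 𝟙_ W) ≫ (r 0 ⊗ₘ lone G) =
        lone G ≫ (λ_ _).inv ≫ lone G ▷ _ := by
      rw [Category.assoc, MonoidalCategory.tensorHom_def, ← comp_whiskerRight_assoc, hr.un,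
        ← whisker_exchange, leftUnitor_inv_naturality_assoc]
    refine ((Category.assoc _ _ _).symm.trans (congrArg (· ≫ lmul G _ _) h1)).trans ?_
    rw [Category.assoc, Category.assoc]
    refine congrArg (fun t => lone G ≫ t) ?_
    refine (congrArg (fun t => _ ≫ t) (lmul_left G (Nec.simplex 0))).trans ?_
    rw [Iso.inv_hom_id_assoc]
    refine congrArg (fun t => lmap G t) (Nec.hom_ext fun i hi => ?_)
    refine (Nec.fn_leftMap _ _).trans (Eq.trans ?_ (Nec.fn_cutMap _ _ _ _).symm)
    rfl
  | full _ _ =>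
    simp only [Neck.split]
    rw [extendL_cons _ _ h h', Category.assoc, Category.assoc, ← lmap_comp]
    have : Nec.cutMap (.full _ _) h h' ≫ Nec.consMap _ _ h h' = 𝟙 _ :=
      Nec.hom_ext fun i hi => by
        rw [Nec.len_tensor, Nec.len_simplex] at hi
        rw [Nec.fn_comp, Nec.fn_cutMap, Nec.fn_consMap, Nec.fn_id, Nec.len_tensor, Nec.len_simplex]
        simp only [Nec.len] at hi ⊢
        omega
    rw [this, lmap_id, Category.comp_id]
    exact Category.id_comp _
  | part u _ r' U hu hr' =>
    have hU : ∀ n ∈ U, 0 < n := fun n hn => h n (List.mem_cons_of_mem _ hn)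
    rw [extendL_cons u U h hU, extendL_cons r' U h' hU]
    have key := extendL_part (comul Y s r' u hu) (r u) (r s) (r r') (extendL r U hU) _
      (Nec.consMap r' U h' hU) (hr.mul' s r' u hu)
    refine key.trans ?_
    rw [Category.assoc, Category.assoc, Category.assoc, ← lmap_comp]
    refine congrArg (fun t => _ ≫ _ ≫ lmap G t) (Nec.hom_ext fun i hi => ?_)
    simp only [Nec.len_tensor, Nec.len_simplex] at hi
    simp only [Nec.fn_comp, Nec.fn_whiskerLeft, Nec.fn_whiskerRight, Nec.fn_assoc_inv,
      Nec.fn_inert, Nec.fn_consMap, Nec.fn_cutMap, Nec.len_tensor, Nec.len_simplex]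
    simp only [Nec.len, List.sum_cons] at hi ⊢
    omega

/-- Induction on the beads of `T`. The action of `f` on `Y` is a cut of `U` at `φ t`, followed by
the interval map on the first bead and the action of a map on the remaining beads; these are handled
by `split`, by `map` and by induction. The equation left over says that `f` is recovered from these
pieces. -/
lemma SimplexMaps.natural (hr : SimplexMaps Y G r) {T U : List ℕ} (hT : ∀ n ∈ T, 0 < n)
    (hU : ∀ n ∈ U, 0 < n) {φ : ℕ → ℕ} (v : Valid T U φ) (f : (⟨T, hT⟩ : Nec) ⟶ ⟨U, hU⟩)
    (hf : ∀ i ≤ T.sum, Nec.fn f i = φ i) :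
    nmap Y T U φ v ≫ extendL r T hT = extendL r U hU ≫ lmap G f := by
  induction T generalizing U φ with
  | nil =>
    obtain rfl : U = [] := v.nil
    obtain rfl : f = 𝟙 _ := Nec.hom_ext fun i hi => by
      obtain rfl : i = 0 := by simpa [Nec.len] using hi
      rw [Nec.fn_zero, Nec.fn_zero]
    rw [lmap_id, nmap_nil, Category.comp_id, Category.id_comp]
  | cons t T ih =>
    obtain ⟨U', c⟩ := cutOf U (φ t) v.head
    have v' := v.tail c (fun i hi => v.shift hi) rfl
    have hT' : ∀ n ∈ T, 0 < n := fun n hn => hT n (List.mem_cons_of_mem _ hn)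
    have hU' := c.pos hU
    -- The map `g` is `f` on the beads after the first one, with vertices renumbered from `0`. Its
    -- joint condition is part of `Valid.tail`.
    let g₀ : (⟨T, hT'⟩ : Nec).vertices ⟶ (⟨U', hU'⟩ : Nec).vertices :=
      FInt.homMk (fun i => φ (t + i) - φ t) v'.zero v'.last v'.mono
    have hg₀ : ∀ i ≤ T.sum, FInt.fn g₀ i = φ (t + i) - φ t := fun i hi =>
      FInt.fn_homMk (fun i => φ (t + i) - φ t) v'.zero v'.last v'.mono hi
    let g : (⟨T, hT'⟩ : Nec) ⟶ ⟨U', hU'⟩ :=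
      { toHom := g₀
        joint := by
          rintro j ⟨L, hL, rfl⟩
          obtain ⟨M, hM, e⟩ := v'.joint L hL
          refine ⟨M.sum, ⟨M, hM, rfl⟩, ?_⟩
          rw [← e]
          obtain ⟨N, rfl⟩ := hM
          exact hg₀ _ (by simp) }
    have hg : ∀ i ≤ T.sum, Nec.fn g i = φ (t + i) - φ t := hg₀
    rw [nmap_cons Y v c v.seg (fun i hi => v.fn_seg hi) (fun i hi => v.shift hi) v',
      extendL_cons t T hT hT', Category.assoc, tensorHom_comp_tensorHom_assoc, hr.map,
      ih hT' hU' v' g hg, ← tensorHom_comp_tensorHom_assoc, reassoc_of% (lmul_nat G),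
      reassoc_of% (hr.split c hU hU'), ← lmap_comp, ← lmap_comp]
    refine congrArg (fun t => _ ≫ lmap G t) (Nec.hom_ext fun i hi => ?_)
    have hi' : i ≤ t + T.sum := by simpa [Nec.len] using hi
    rw [Nec.fn_comp, Nec.fn_comp, Nec.fn_consMap, Nec.fn_tensorHom, Nec.fn_simplexMap,
      Nec.fn_cutMap, Nec.len_simplex, min_eq_left hi', hf i (by simpa using hi'),
      hg _ (by omega)]
    have hc := c.sum
    have h1 := v.mono i _ (by simpa using hi') le_rfl
    rw [v.last] at h1
    by_cases hit : i ≤ t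
    · rw [v.fn_seg hit, Nat.sub_eq_zero_of_le hit]
      simp only [add_zero, Nat.sub_self]
      omega
    · have h2 := v.mono t i (by omega) (by simpa using hi')
      rw [FInt.fn_last v.seg (by simp only; omega), show t + (i - t) = i by omega]
      simp only
      omega

lemma SimplexMaps.natural_toNec (hr : SimplexMaps Y G r) {T U : Nec} (f : T ⟶ U) :
    (toNec Y).map f.op ≫ extendL r T.beads T.pos = extendL r U.beads U.pos ≫ lmap G f :=
  hr.natural T.pos U.pos (valid f) f fun _ _ => rfl

/-- The natural transformation `Y_T → G_T` extending the given maps on simplices. -/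
def SimplexMaps.extend (hr : SimplexMaps Y G r) : toNec Y ⟶ G where
  app T := extendL r T.unop.beads T.unop.pos
  naturality _ _ f := hr.natural_toNec f.unop

lemma coh_canon_mul (A B : W) : ((ρ_ A).inv ⊗ₘ (ρ_ B).inv) ≫ (α_ _ _ _).hom ≫
    A ◁ (λ_ (B ⊗ 𝟙_ W)).hom = (ρ_ (A ⊗ B)).inv ≫ (α_ _ _ _).hom := by
  simp [MonoidalCategory.tensorHom_def]

lemma coh_canon_cons (A B : W) : ((ρ_ A).inv ⊗ₘ 𝟙 B) ≫ ((α_ _ _ _).hom ≫ A ◁ (λ_ B).hom) ≫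
    𝟙 (A ⊗ B) = 𝟙 _ := by
  simp

/-! ### The canonical maps into the value at a simplex -/

section canonical

variable (Y)

/-- The canonical isomorphisms `Y_n → Y_{Δ^n}`. -/
def canon : ∀ n, ob Y n ⟶ (toNec Y).obj (op (Nec.simplex n))
  | 0 => coun Y
  | n + 1 => (ρ_ (ob Y (n + 1))).inv

instance (n : ℕ) : IsIso (canon Y n) := by
  cases n
  · exact inferInstanceAs (IsIso (coun Y))
  · exact inferInstanceAs (IsIso (ρ_ _).inv)

/-- A map between simplices of positive dimension acts on `Y_n ⊗ I` by its action on the single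
bead, so the claim is naturality of the right unitor. Dimension `0` has to be treated apart, since
`Δ^0` has no bead. -/
lemma canon_map {m n : ℕ} (f : (⟨m⟩ : FInt) ⟶ ⟨n⟩) :
    mp Y f ≫ canon Y m = canon Y n ≫ lmap (toNec Y) (Nec.simplexMap f) := by
  have hv := valid (Nec.simplexMap f)
  cases m with
  | zero =>
    obtain rfl : n = 0 := by
      have h1 := FInt.fn_last f (i := 0) le_rfl
      rw [FInt.fn_zero] at h1
      exact h1.symm
    obtain rfl : f = 𝟙 _ := FInt.hom_ext fun i hi => by
      obtain rfl : i = 0 := Nat.le_zero.1 hi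
      rw [FInt.fn_zero, FInt.fn_zero]
    rw [Nec.simplexMap_id, lmap_id, mp, op_id, Y.map_id, Category.comp_id, Category.id_comp]
  | succ m =>
    cases n with
    | zero =>
      have h' : Valid [] [] (fun _ => 0) := ⟨rfl, rfl, fun _ _ _ _ => le_rfl,
        fun L hL => ⟨[], List.nil_prefix, by rw [List.prefix_nil.1 hL]; rfl⟩, by simp⟩
      have h0 : ∀ i, FInt.fn f i = 0 := fun i => Nat.le_zero.1 (FInt.fn_le f i)
      -- For a collapse `[m + 1] → [0]` the empty target is cut at `0`, so the action begins with
      -- `un Y`. This cancels against `canon Y 0`, which is the counit.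
      have key := nmap_cons Y (t := m + 1) (T := []) (U := []) hv .nil f
        (fun i hi => (Nec.fn_simplexMap f i).symm)
        (fun i hi => (Nec.fn_simplexMap f _).trans (h0 _)) h'
      rw [nmap_nil] at key
      refine Eq.trans ?_ (congrArg (fun t => canon Y 0 ≫ t) key).symm
      change mp Y f ≫ (ρ_ _).inv = coun Y ≫ ((λ_ _).inv ≫ un Y ▷ 𝟙_ W) ≫ (mp Y f ⊗ₘ 𝟙 (𝟙_ W))
      rw [tensorHom_id, Category.assoc, ← comp_whiskerRight, unitors_inv_equal,
        ← rightUnitor_inv_naturality, un, Category.assoc,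
        IsIso.hom_inv_id_assoc]
    | succ n =>
      have h' : Valid [] [] (fun _ => 0) := ⟨rfl, rfl, fun _ _ _ _ => le_rfl,
        fun L hL => ⟨[], List.nil_prefix, by rw [List.prefix_nil.1 hL]; rfl⟩, by simp⟩
      have key := nmap_cons Y (t := m + 1) (T := []) (U := [n + 1]) hv (.full (n + 1) []) f
        (fun i hi => (Nec.fn_simplexMap f i).symm)
        (fun i hi => (Nec.fn_simplexMap f _).trans (FInt.fn_last f (by simp))) h'
      rw [nmap_nil] at key
      refine Eq.trans ?_ (congrArg (fun t => canon Y (n + 1) ≫ t) key).symm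
      change mp Y f ≫ (ρ_ _).inv = (ρ_ _).inv ≫ 𝟙 (ob Y (n + 1) ⊗ 𝟙_ W) ≫ (mp Y f ⊗ₘ 𝟙 (𝟙_ W))
      rw [Category.id_comp, tensorHom_id, rightUnitor_inv_naturality]

/-- The inert map acts through one cut inside the only bead, that is, through the comultiplication
itself. Up to unitors there is nothing else to compare. -/
lemma canon_mul (k l n : ℕ) (hk : 0 < k) (hl : 0 < l) (h : n = k + l) :
    comul Y k l n h ≫ (canon Y k ⊗ₘ canon Y l) ≫ lmul (toNec Y) (Nec.simplex k) (Nec.simplex l) =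
      canon Y n ≫ lmap (toNec Y) (Nec.inert k l n h) := by
  have hv := valid (Nec.inert k l n h)
  obtain ⟨k, rfl⟩ := Nat.exists_eq_succ_of_ne_zero hk.ne'
  obtain ⟨l, rfl⟩ := Nat.exists_eq_succ_of_ne_zero hl.ne'
  obtain ⟨n, rfl⟩ := Nat.exists_eq_succ_of_ne_zero (show n ≠ 0 by omega)
  have h' : Valid [l + 1] [l + 1] id := ⟨rfl, rfl, fun _ _ h _ => h,
    fun L hL => ⟨L, hL, rfl⟩, by simp⟩
  have key := nmap_cons Y (t := k + 1) (T := [l + 1]) (U := [n + 1]) hv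
    (.part (n + 1) (k + 1) (l + 1) [] h (by omega)) (𝟙 _)
    (fun i hi => by rw [FInt.fn_id, Nec.fn_inert]; simp only; omega)
    (fun i hi => by
      rw [Nec.fn_inert]
      simp only [List.sum_cons, List.sum_nil] at hi
      change _ = k + 1 + i
      omega) h'
  rw [nmap_id Y _ h' fun _ _ => rfl] at key
  refine Eq.trans ?_ (congrArg (fun t => canon Y (n + 1) ≫ t) key).symm
  change comul Y (k + 1) (l + 1) (n + 1) h ≫ ((ρ_ _).inv ⊗ₘ (ρ_ _).inv) ≫
    (α_ _ _ _).hom ≫ ob Y (k + 1) ◁ (λ_ (ob Y (l + 1) ⊗ 𝟙_ W)).hom =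
      (ρ_ _).inv ≫ (comul Y (k + 1) (l + 1) (n + 1) h ▷ 𝟙_ W ≫ (α_ _ _ _).hom) ≫
        (mp Y (𝟙 _) ⊗ₘ 𝟙 (ob Y (l + 1) ⊗ 𝟙_ W))
  rw [mp, op_id, Y.map_id, id_tensorHom_id, Category.comp_id,
    ← rightUnitor_inv_naturality_assoc]
  exact congrArg (fun t => _ ≫ t) (coh_canon_mul _ _)

lemma canon_simplexMaps : SimplexMaps Y (toNec Y) (canon Y) where
  unit := (Category.comp_id _).symm
  map := canon_map Y
  mul := canon_mul Y

/-- The family `canon` corresponds to the identity of `Y^nec`. With `extendL_comp`, this shows that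
a monoidal transformation is recovered from its values on simplices. -/
lemma extendL_canon (L : List ℕ) (h : ∀ n ∈ L, 0 < n) :
    extendL (G := toNec Y) (canon Y) L h = 𝟙 (XL Y L) := by
  induction L with
  | nil => rfl
  | cons n L ih =>
    have h' : ∀ n ∈ L, 0 < n := fun n hn => h n (List.mem_cons_of_mem _ hn)
    obtain ⟨n, rfl⟩ := Nat.exists_eq_succ_of_ne_zero (h n (by simp)).ne'
    have e : lmap (toNec Y) (Nec.consMap (n + 1) L h h') = 𝟙 _ := by
      refine (congrArg (fun t => lmap (toNec Y) t) (Nec.hom_ext (g := 𝟙 _) fun i hi => ?_)).trans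
        (lmap_id _ _)
      refine (Nec.fn_consMap _ _ _ _ _).trans (Eq.trans ?_ (Nec.fn_id _ _).symm)
      simp only [Nec.len, List.sum_cons]
    refine (congrArg₂ (fun s t => (canon Y (n + 1) ⊗ₘ s) ≫ lmul _ _ _ ≫ t) (ih h') e).trans ?_
    change ((ρ_ (ob Y (n + 1))).inv ⊗ₘ 𝟙 (XL Y L)) ≫ ((α_ _ _ _).hom ≫
      ob Y (n + 1) ◁ (λ_ (XL Y L)).hom) ≫ 𝟙 (ob Y (n + 1) ⊗ XL Y L) = 𝟙 _
    exact coh_canon_cons _ _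

end canonical

/-- A natural transformation of lax monoidal functors is monoidal. -/
structure IsMonoidalNat {G G' : Necᵒᵖ ⥤ W} [G.LaxMonoidal] [G'.LaxMonoidal] (θ : G ⟶ G') :
    Prop where
  mul (T U : Nec) : lmul G T U ≫ θ.app (op (T ⊗ U)) =
    (θ.app (op T) ⊗ₘ θ.app (op U)) ≫ lmul G' T U
  unit : lone G ≫ θ.app (op (Nec.simplex 0)) = lone G'

section comp

variable {G' : Necᵒᵖ ⥤ W} [G'.LaxMonoidal] {θ : G ⟶ G'}

lemma SimplexMaps.extend_isMonoidalNat (hr : SimplexMaps Y G r) : IsMonoidalNat hr.extend where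
  mul T U := extendL_append T U
  unit := Category.id_comp _

lemma lmap_app (θ : G ⟶ G') {T U : Nec} (f : T ⟶ U) :
    lmap G f ≫ θ.app (op T) = θ.app (op U) ≫ lmap G' f := θ.naturality _

lemma SimplexMaps.comp (hr : SimplexMaps Y G r) (hθ : IsMonoidalNat θ) :
    SimplexMaps Y G' (fun n => r n ≫ θ.app (op (Nec.simplex n))) where
  unit := by rw [hr.unit, Category.assoc, hθ.unit]
  map f := by rw [reassoc_of% (hr.map f), lmap_app, Category.assoc]
  mul k l n hk hl h := by
    rw [← tensorHom_comp_tensorHom, Category.assoc, ← hθ.mul, reassoc_of% (hr.mul k l n hk hl h),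
      lmap_app, Category.assoc]

/-- A monoidal transformation commutes with the operations from which `extendL` is built bead by
bead: unit, multiplication and restriction. -/
lemma extendL_comp (hθ : IsMonoidalNat θ) (L : List ℕ) (h : ∀ n ∈ L, 0 < n) :
    extendL (fun n => r n ≫ θ.app (op (Nec.simplex n))) L h =
      extendL r L h ≫ θ.app (op ⟨L, h⟩) := by
  induction L with
  | nil => exact hθ.unit.symm
  | cons n L ih =>
    have h' : ∀ n ∈ L, 0 < n := fun n hn => h n (List.mem_cons_of_mem _ hn)
    rw [extendL_cons n L h h', extendL_cons n L h h', ih h', ← tensorHom_comp_tensorHom,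
      Category.assoc, Category.assoc, Category.assoc, lmap_app, reassoc_of% (hθ.mul)]

end comp

/-- A monoidal transformation out of `Y^nec` is determined by its values on simplices. -/
lemma eq_extendL {θ : toNec Y ⟶ G} (hθ : IsMonoidalNat θ) (L : List ℕ) (h : ∀ n ∈ L, 0 < n) :
    θ.app (op ⟨L, h⟩) = extendL (fun n => canon Y n ≫ θ.app (op (Nec.simplex n))) L h := by
  rw [extendL_comp hθ, extendL_canon]
  exact (Category.id_comp _).symm

end Neck

/-! ### Necklace categories as lax monoidal functors into quivers -/

namespace NecCat

open VQuiv NecV Neck Functor.LaxMonoidal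

variable {V : Type u} [Category.{v} V] [MonoidalCategory V] [SymmetricCategory V]
  [MonoidalClosed V] [HasColimits V] (C : NecCat V)

/-- The map `C_T(a, b) ⊗ C_U(b, c) → C_{T ∨ U}(a, c)` induced by the composition of `C`. -/
def cmul (a b c : C.Obj) (T U : Necᵒᵖ) :
    (C.hom a b).at_ T ⊗ (C.hom b c).at_ U ⟶ (C.hom a c).at_ (T ⊗ U) :=
  dη (C.hom a b) (C.hom b c) T U ≫ ap (eComp (NecV V) a b c) (T ⊗ U)

/-- The map `I → C_{Δ^0}(a, a)` induced by the identity of `a`. -/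
def cone (a : C.Obj) : 𝟙_ V ⟶ (C.hom a a).at_ (𝟙_ Necᵒᵖ) := dν V ≫ ap (eId (NecV V) a) (𝟙_ _)

/-- The components of the multiplication of the quivers `C_T`. -/
def qmul (a b c : C.Obj) (T U : Nec) :
    (C.quiv T).obj a b ⊗ (C.quiv U).obj b c ⟶ (C.quiv (T ⊗ U)).obj a c :=
  C.cmul a b c (op T) (op U)

/-- The components of the unit of the quivers `C_T`. -/
def qone (a : C.Obj) : 𝟙_ V ⟶ (C.quiv (Nec.simplex 0)).obj a a := C.cone a

lemma inj_mul (a b c : C.Obj) (T U : Nec) :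
    inj (C.quiv T) (C.quiv U) a b c ≫ app (C.mul T U) a c = C.qmul a b c T U :=
  tι_tdesc _ _

lemma uinj_one (a : C.Obj) : uinj (rfl : a = a) ≫ app C.one a a = C.qone a := by
  have h := uι_udesc (V := V) (a := a) (b := a) (Z := (C.quiv (Nec.simplex 0)).obj a a)
    (fun h => dν V ≫ ap (eId (NecV V) a) (𝟙_ _) ≫ eqToHom rfl) rfl
  exact h.trans (congrArg (fun t => dν V ≫ t) (Category.comp_id _))

lemma cmul_nat (a b c : C.Obj) {T T' U U' : Necᵒᵖ} (f : T ⟶ T') (g : U ⟶ U') :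
    ((C.hom a b).functor.map f ⊗ₘ (C.hom b c).functor.map g) ≫ C.cmul a b c T' U' =
      C.cmul a b c T U ≫ (C.hom a c).functor.map (f ⊗ₘ g) := by
  unfold cmul
  rw [reassoc_of% (dη_nat (C.hom a b) (C.hom b c) f g), ap_nat, Category.assoc]

/-- The associativity of the enriched composition, evaluated on the universal maps `dη` into the Day
convolution. The lemmas `dη_assoc'` and `dη_whiskerRight`, `dη_whiskerLeft` carry these maps through
the associator and the whiskered compositions. The unit laws below are obtained in the same way,
from the explicit inverse unitors. -/
lemma cmul_assoc (a b c d : C.Obj) (T U Z : Necᵒᵖ) :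
    C.cmul a b c T U ▷ _ ≫ C.cmul a c d (T ⊗ U) Z ≫ (C.hom a d).functor.map (α_ T U Z).hom =
      (α_ _ _ _).hom ≫ _ ◁ C.cmul b c d U Z ≫ C.cmul a b d T (U ⊗ Z) := by
  have h := e_assoc (NecV V) a b c d
  have h0 := congrArg (fun t => (C.hom a b).at_ T ◁ dη (C.hom b c) (C.hom c d) U Z ≫
    dη (C.hom a b) (C.hom b c ⊗ C.hom c d) T (U ⊗ Z) ≫ ap t (T ⊗ U ⊗ Z)) h
  simp only [ap_comp] at h0
  have h1 := ap_nat (eComp (NecV V) a b c ▷ C.hom c d ≫ eComp (NecV V) a c d) (α_ T U Z).hom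
  rw [ap_comp, ap_comp] at h1
  rw [reassoc_of% dη_assoc', h1, Category.assoc,
    reassoc_of% (dη_whiskerRight (eComp (NecV V) a b c) (C.hom c d)),
    reassoc_of% (dη_whiskerLeft (C.hom a b) (eComp (NecV V) b c d)),
    ← comp_whiskerRight_assoc, ← MonoidalCategory.whiskerLeft_comp_assoc] at h0
  rw [← cancel_epi (α_ _ _ _).inv, Iso.inv_hom_id_assoc]
  unfold cmul
  simpa only [Category.assoc] using h0

lemma cmul_left (a b : C.Obj) (T : Necᵒᵖ) :
    C.cone a ▷ _ ≫ C.cmul a a b (𝟙_ _) T ≫ (C.hom a b).functor.map (λ_ T).hom =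
      (λ_ _).hom := by
  have h0 := congrArg (fun t => ap t T) (e_id_comp (NecV V) a b)
  simp only [ap_comp] at h0
  have h1 := ap_nat (eId (NecV V) a ▷ C.hom a b ≫ eComp (NecV V) a a b) (λ_ T).hom
  rw [ap_comp, ap_comp] at h1
  rw [ap_leftUnitor_inv] at h0
  simp only [Category.assoc] at h0
  rw [h1, Category.assoc, reassoc_of% (dη_whiskerRight (eId (NecV V) a) (C.hom a b)),
    ← comp_whiskerRight_assoc] at h0
  rw [← cancel_epi (λ_ _).inv, Iso.inv_hom_id]
  unfold cmul cone
  simp only [Category.assoc]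
  exact h0

lemma cmul_right (a b : C.Obj) (T : Necᵒᵖ) :
    _ ◁ C.cone b ≫ C.cmul a b b T (𝟙_ _) ≫ (C.hom a b).functor.map (ρ_ T).hom =
      (ρ_ _).hom := by
  have h0 := congrArg (fun t => ap t T) (e_comp_id (NecV V) a b)
  simp only [ap_comp] at h0
  have h1 := ap_nat (C.hom a b ◁ eId (NecV V) b ≫ eComp (NecV V) a b b) (ρ_ T).hom
  rw [ap_comp, ap_comp] at h1
  rw [ap_rightUnitor_inv] at h0
  simp only [Category.assoc] at h0
  rw [h1, Category.assoc, reassoc_of% (dη_whiskerLeft (C.hom a b) (eId (NecV V) b)),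
    ← MonoidalCategory.whiskerLeft_comp_assoc] at h0
  rw [← cancel_epi (ρ_ _).inv, Iso.inv_hom_id]
  unfold cmul cone
  simp only [Category.assoc]
  exact h0

/-- The functor `T ↦ C_T` on necklaces. -/
def toLax : Necᵒᵖ ⥤ VQuiv V C.Obj where
  obj T := C.quiv T.unop
  map f := C.act f.unop
  map_id T := VQuiv.hom_ext fun a b => (C.hom a b).functor.map_id T
  map_comp f g := VQuiv.hom_ext fun a b => (C.hom a b).functor.map_comp f g

lemma mul_natural {T T' U U' : Nec} (f : T ⟶ T') (g : U ⟶ U') :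
    (C.act f ⊗ₘ C.act g) ≫ C.mul T U = C.mul T' U' ≫ C.act (f ⊗ₘ g) :=
  VQuiv.hom_ext fun a c => inj_ext fun b => by
    rw [app_comp, app_comp, inj_tensorHom_assoc, inj_mul, reassoc_of% (C.inj_mul a b c T' U')]
    exact C.cmul_nat a b c f.op g.op

/-- Tested on the coprojections of the quiver tensor products, the identity becomes `cmul_assoc` at
each quadruple of objects. -/
lemma mul_assoc (T U Z : Nec) :
    C.mul T U ▷ C.quiv Z ≫ C.mul (T ⊗ U) Z ≫ C.act (α_ T U Z).inv =
      (α_ _ _ _).hom ≫ C.quiv T ◁ C.mul U Z ≫ C.mul T (U ⊗ Z) :=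
  VQuiv.hom_ext fun a d => inj_ext fun c => inj_ext_right fun b => by
    have h1 : C.qmul a b c T U ▷ _ ≫ C.qmul a c d (T ⊗ U) Z ≫ app (C.act (α_ T U Z).inv) a d =
      (α_ _ _ _).hom ≫ _ ◁ C.qmul b c d U Z ≫ C.qmul a b d T (U ⊗ Z) :=
        C.cmul_assoc a b c d (op T) (op U) (op Z)
    simp only [app_comp]
    rw [inj_whiskerRight, reassoc_of% inj_associator_hom, inj_whiskerLeft, inj_mul,
      reassoc_of% (C.inj_mul a c d (T ⊗ U) Z), ← comp_whiskerRight_assoc,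
      ← MonoidalCategory.whiskerLeft_comp_assoc, inj_mul, inj_mul, h1]

lemma one_mul (T : Nec) :
    C.one ▷ C.quiv T ≫ C.mul (Nec.simplex 0) T ≫ C.act (λ_ T).inv = (λ_ _).hom :=
  VQuiv.hom_ext fun a b => inj_ext fun c => uinj_ext_right fun e => by
    subst e
    have h1 := C.cmul_left a b (op T)
    simp only [app_comp]
    rw [inj_leftUnitor_hom, inj_whiskerRight, ← comp_whiskerRight_assoc, uinj_one,
      reassoc_of% (C.inj_mul a a b (Nec.simplex 0) T)]
    exact h1

lemma mul_one (T : Nec) :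
    C.quiv T ◁ C.one ≫ C.mul T (Nec.simplex 0) ≫ C.act (ρ_ T).inv = (ρ_ _).hom :=
  VQuiv.hom_ext fun a b => inj_ext fun c => uinj_ext_left fun e => by
    subst e
    have h1 := C.cmul_right a c (op T)
    simp only [app_comp]
    rw [inj_rightUnitor_hom, inj_whiskerLeft, ← MonoidalCategory.whiskerLeft_comp_assoc, uinj_one,
      reassoc_of% (C.inj_mul a c c T (Nec.simplex 0))]
    exact h1

/-- This replaces the Day convolution by the tensor product of quivers, in which `(-)^nec` and
`(-)^temp` are formulated. -/
instance : C.toLax.LaxMonoidal where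
  ε := C.one
  μ T U := C.mul T.unop U.unop
  μ_natural_left {T T'} f U := by
    have h := C.mul_natural f.unop (𝟙 U.unop)
    have e : C.act (𝟙 U.unop) = 𝟙 _ := C.toLax.map_id U
    rw [e, tensorHom_id, tensorHom_id] at h
    exact h
  μ_natural_right {T T'} U f := by
    have h := C.mul_natural (𝟙 U.unop) f.unop
    have e : C.act (𝟙 U.unop) = 𝟙 _ := C.toLax.map_id U
    rw [e, id_tensorHom, id_tensorHom] at h
    exact h
  associativity T U Z := C.mul_assoc T.unop U.unop Z.unop
  left_unitality T := (C.one_mul T.unop).symm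
  right_unitality T := (C.mul_one T.unop).symm

/-! ### Enriched functors as monoidal transformations -/

section functors

variable {S : Type v} (F : Necᵒᵖ ⥤ VQuiv V S) [F.LaxMonoidal]

/-- The necklace category associated to a lax monoidal functor on necklaces. -/
def ofLax : NecCat V where
  Obj := S
  enriched := enrichedOfLax F

variable {F C} {f : S → C.Obj} (θ : F ⟶ C.toLax ⋙ pullback V f)

/-- The map of hom-objects induced by a transformation of lax monoidal functors. -/
def transMap (a b : S) : homObj F a b ⟶ C.hom (f a) (f b) where
  natTrans :=
    { app := fun T => app (θ.app T) a b
      naturality := fun T U g => congrArg (fun t => app t a b) (θ.naturality g) }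

variable {θ}

lemma transMap_one (hθ : IsMonoidalNat θ) (a : S) :
    homOne F a ≫ app (θ.app (𝟙_ _)) a a = C.cone (f a) := by
  have h : ε F ≫ θ.app (𝟙_ _) = pullUnit V f ≫ (pullback V f).map C.one := hθ.unit
  have h' := congrArg (fun t => uinj (rfl : a = a) ≫ app t a a) h
  simp only [app_comp] at h'
  refine (Category.assoc _ _ _).trans (h'.trans ?_)
  exact ((reassoc_of% (uinj_pullUnit (V := V) f (rfl : a = a))) _).trans (C.uinj_one (f a))

/-- The component of the monoidality of `θ` at `a`, `b`, `c`. The structure map of `f^*` sends the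
summand of the middle vertex `b` to that of `f b`, which leaves the composition of `C` at `f a`, `f
b`, `f c`. -/
lemma transMap_mul (hθ : IsMonoidalNat θ) (a b c : S) (T U : Necᵒᵖ) :
    homMul F a b c T U ≫ app (θ.app (T ⊗ U)) a c =
      (app (θ.app T) a b ⊗ₘ app (θ.app U) b c) ≫ C.cmul (f a) (f b) (f c) T U := by
  have h : μ F T U ≫ θ.app (T ⊗ U) = (θ.app T ⊗ₘ θ.app U) ≫ pullMul f _ _ ≫
    (pullback V f).map (C.mul T.unop U.unop) := hθ.mul T.unop U.unop
  have h' := congrArg (fun t => inj _ _ a b c ≫ app t a c) h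
  simp only [app_comp, inj_tensorHom_assoc] at h'
  refine (Category.assoc _ _ _).trans (h'.trans ?_)
  refine (inj_tensorHom_assoc a c b (θ.app T) (θ.app U) _).trans ?_
  refine congrArg (fun t => (app (θ.app T) a b ⊗ₘ app (θ.app U) b c) ≫ t) ?_
  refine (inj_pullMul_assoc f _ _ a b c _).trans ?_
  exact C.inj_mul (f a) (f b) (f c) T.unop U.unop

/-- The functor out of the necklace category of a lax monoidal functor given by a monoidal
transformation. -/
def homOfTrans (hθ : IsMonoidalNat θ) : ofLax F ⟶ C where
  obj := f
  map a b := transMap θ a b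
  map_id a := NecV.unit_ext (by
    refine Eq.trans ?_ (transMap_one hθ a)
    exact (reassoc_of% (dν_homId F a)) (app (θ.app (𝟙_ _)) a a))
  map_comp a b c := NecV.tensor_ext fun T U => by
    refine Eq.trans ((reassoc_of% (dη_homComp F a b c T U)) (app (θ.app (T ⊗ U)) a c)) ?_
    refine (transMap_mul hθ a b c T U).trans ?_
    rw [ap_comp]
    exact ((reassoc_of% (dη_tensorHom (transMap θ a b) (transMap θ b c) T U)) _).symm

/-- The map on objects of a functor out of the necklace category of a lax monoidal functor. -/
def objMap (E : ofLax F ⟶ C) : S → C.Obj :=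
  EnrichedFunctor.obj (C := (ofLax F).Obj) (D := C.Obj) (V := NecV V) E

/-- The maps of hom-objects of a functor out of the necklace category of a lax monoidal functor. -/
def homMap (E : ofLax F ⟶ C) (a b : S) : homObj F a b ⟶ C.hom (objMap E a) (objMap E b) :=
  EnrichedFunctor.map (C := (ofLax F).Obj) (D := C.Obj) (V := NecV V) E a b

lemma homComp_homMap (E : ofLax F ⟶ C) (a b c : S) :
    homComp F a b c ≫ homMap E a c = (homMap E a b ⊗ₘ homMap E b c) ≫
      eComp (NecV V) (objMap E a) (objMap E b) (objMap E c) :=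
  EnrichedFunctor.map_comp (C := (ofLax F).Obj) (D := C.Obj) (V := NecV V) E a b c

lemma homId_homMap (E : ofLax F ⟶ C) (a : S) :
    homId F a ≫ homMap E a a = eId (NecV V) (objMap E a) :=
  EnrichedFunctor.map_id (C := (ofLax F).Obj) (D := C.Obj) (V := NecV V) E a

/-- The law of an enriched functor for compositions, read off at the universal map of the Day
convolution. -/
lemma homMul_homMap (E : ofLax F ⟶ C) (a b c : S) (T U : Necᵒᵖ) :
    homMul F a b c T U ≫ ap (homMap E a c) (T ⊗ U) =
      (ap (homMap E a b) T ⊗ₘ ap (homMap E b c) U) ≫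
        C.cmul (objMap E a) (objMap E b) (objMap E c) T U := by
  have h := congrArg (fun t => dη _ _ T U ≫ ap t (T ⊗ U)) (homComp_homMap E a b c)
  simp only [ap_comp] at h
  rw [reassoc_of% (dη_tensorHom (homMap E a b) (homMap E b c)),
    reassoc_of% (dη_homComp F a b c T U)] at h
  exact h

lemma homOne_homMap (E : ofLax F ⟶ C) (a : S) :
    homOne F a ≫ ap (homMap E a a) (𝟙_ _) = C.cone (objMap E a) := by
  have h := congrArg (fun t => dν V ≫ ap t (𝟙_ _)) (homId_homMap E a)
  simp only [ap_comp] at h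
  rw [reassoc_of% (dν_homId F a)] at h
  exact h

/-- The transformation underlying a functor out of the necklace category of a lax monoidal
functor. -/
def transOfHom (E : ofLax F ⟶ C) :
    F ⟶ C.toLax ⋙ VQuiv.pullback V (objMap E) where
  app T := ⟨fun a b => ap (homMap E a b) T⟩
  naturality T U g := VQuiv.hom_ext fun a b => ap_nat (homMap E a b) g

/-- The converse of `homOfTrans`: maps out of a tensor product of quivers are determined on its
summands, where monoidality is the functor law at three objects; for the unit it is the law for
identities. -/
lemma transOfHom_isMonoidalNat (E : ofLax F ⟶ C) : IsMonoidalNat (transOfHom E) where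
  mul T U := VQuiv.hom_ext fun a c => inj_ext fun b => by
    have h := homMul_homMap E a b c (op T) (op U)
    refine (Category.assoc _ _ _).symm.trans (h.trans ?_)
    refine Eq.trans ?_ (inj_tensorHom_assoc a c b ((transOfHom E).app (op T))
      ((transOfHom E).app (op U)) _).symm
    refine congrArg (fun t => (ap (homMap E a b) (op T) ⊗ₘ ap (homMap E b c) (op U)) ≫ t) ?_
    refine (C.inj_mul _ _ _ T U).symm.trans ?_
    exact (inj_pullMul_assoc (objMap E) _ _ a b c _).symm
  unit := VQuiv.hom_ext fun a b => uinj_ext fun e => by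
    subst e
    refine (Category.assoc _ _ _).symm.trans ((homOne_homMap E a).trans ?_)
    refine (C.uinj_one _).symm.trans ?_
    exact ((reassoc_of% (uinj_pullUnit (V := V) (objMap E) (rfl : a = a))) _).symm

end functors

end NecCat

/-! ### Recursion with existence in place of construction -/

/-- Strong recursion for sequences whose terms are only known to exist, each subject to a condition
relating it to the previous ones. -/
theorem exists_strong_rec {A : ℕ → Type*} (Good : ∀ n, A n → (∀ k, k < n → A k) → Prop)
    (h : ∀ n (hist : ∀ k, k < n → A k),
      (∀ k hk, Good k (hist k hk) (fun j hj => hist j (hj.trans hk))) → ∃ a, Good n a hist) :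
    ∃ a : ∀ n, A n, ∀ n, Good n (a n) (fun k _ => a k) := by
  classical
  -- Good terms exist only over good histories, so the recursion runs in `Option`, with `none` where
  -- no good continuation exists. The induction in `key` shows that `none` never occurs.
  let step (n : ℕ) (hist : ∀ k, k < n → Option (A k)) : Option (A n) :=
    if e : ∃ (a : A n) (s : ∀ k hk, (hist k hk).isSome), Good n a (fun k hk => (hist k hk).get (s k hk))
    then some e.choose else none
  let g : ∀ n, Option (A n) := WellFounded.fix Nat.lt_wfRel.wf step
  have hg : ∀ n, g n = step n (fun k _ => g k) := fun n => WellFounded.fix_eq _ _ _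
  have key : ∀ n, ∃ (s : (g n).isSome) (s' : ∀ k, k < n → (g k).isSome),
      Good n ((g n).get s) (fun k hk => (g k).get (s' k hk)) := by
    intro n
    induction n using Nat.strong_induction_on with
    | _ n ih =>
      have s' : ∀ k, k < n → (g k).isSome := fun k hk => (ih k hk).1
      obtain ⟨a, ha⟩ := h n (fun k hk => (g k).get (s' k hk)) fun k hk => (ih k hk).2.2
      have e : ∃ (a : A n) (s : ∀ k, k < n → (g k).isSome),
        Good n a (fun k hk => (g k).get (s k hk)) := ⟨a, s', ha⟩
      have hn : g n = some e.choose := (hg n).trans (dif_pos e)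
      refine ⟨by rw [hn]; rfl, s', ?_⟩
      obtain ⟨_, h2⟩ := e.choose_spec
      simp only [hn, Option.get_some]
      exact h2
  exact ⟨fun n => (g n).get (key n).1, fun n => (key n).2.2⟩

/-! ### Decomposing maps of intervals -/

namespace FInt

/-- The restriction of a map of intervals to an initial segment. -/
def segL {m n : ℕ} (f : (⟨m⟩ : FInt) ⟶ ⟨n⟩) (k : ℕ) : (⟨k⟩ : FInt) ⟶ ⟨fn f k⟩ :=
  homMk (fn f) (fn_zero f) rfl fun _ _ h _ => fn_mono f h

/-- The restriction of a map of intervals to a final segment. -/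
def segR {m n : ℕ} (f : (⟨m⟩ : FInt) ⟶ ⟨n⟩) (k l : ℕ) (h : m = k + l) :
    (⟨l⟩ : FInt) ⟶ ⟨n - fn f k⟩ :=
  homMk (fun i => fn f (k + i) - fn f k) (Nat.sub_self _)
    (by change fn f (k + l) - _ = n - _; rw [fn_last f (h ▸ le_rfl)])
    fun _ _ h _ => Nat.sub_le_sub_right (fn_mono f (Nat.add_le_add_left h k)) _

lemma fn_segL {m n : ℕ} (f : (⟨m⟩ : FInt) ⟶ ⟨n⟩) {k i : ℕ} (hi : i ≤ k) :
    fn (segL f k) i = fn f i := fn_homMk (m := ⟨k⟩) _ _ _ _ hi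

lemma fn_segR {m n : ℕ} (f : (⟨m⟩ : FInt) ⟶ ⟨n⟩) {k l : ℕ} (h : m = k + l) {i : ℕ} (hi : i ≤ l) :
    fn (segR f k l h) i = fn f (k + i) - fn f k :=
  fn_homMk (m := ⟨l⟩) (fun i => fn f (k + i) - fn f k) _ _ _ hi

/-- `f` is the sum of `f₁` and `f₂`. -/
def IsSum {m n a b a' b' : ℕ} (f : (⟨m⟩ : FInt) ⟶ ⟨n⟩) (f₁ : (⟨a⟩ : FInt) ⟶ ⟨a'⟩)
    (f₂ : (⟨b⟩ : FInt) ⟶ ⟨b'⟩) : Prop :=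
  ∀ i ≤ m, fn f i = fn f₁ i + fn f₂ (i - a)

lemma isSum_seg {m n : ℕ} (f : (⟨m⟩ : FInt) ⟶ ⟨n⟩) (k l : ℕ) (h : m = k + l) :
    IsSum f (segL f k) (segR f k l h) := fun i hi => by
  by_cases hik : i ≤ k
  · rw [Nat.sub_eq_zero_of_le hik, fn_zero, fn_segL f hik, add_zero]
  · have := fn_mono f (show k ≤ i by omega)
    rw [fn_last (segL f k) (by simp only; omega), fn_segR f h (by omega),
      show k + (i - k) = i by omega]
    simp only
    omega

lemma fn_le' {m n : ℕ} (f : (⟨m⟩ : FInt) ⟶ ⟨n⟩) (k : ℕ) : fn f k ≤ n := fn_le f k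

lemma cast_rfl {n : ℕ} (h : (⟨n⟩ : FInt).len = (⟨n⟩ : FInt).len) : cast h = 𝟙 (⟨n⟩ : FInt) :=
  hom_ext fun i hi => by rw [fn_cast, fn_id]

lemma eq_zero_of_hom {n : ℕ} (f : (⟨0⟩ : FInt) ⟶ ⟨n⟩) : n = 0 := by
  have h1 := fn_last f (i := 0) le_rfl
  rw [fn_zero] at h1
  exact h1.symm

lemma hom_zero_eq (f : (⟨0⟩ : FInt) ⟶ ⟨0⟩) : f = 𝟙 _ := hom_ext fun i hi => by
  obtain rfl : i = 0 := Nat.le_zero.1 hi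
  rw [fn_zero, fn_zero]

end FInt

/-! ### Lifting compatible families through the defining limits -/

namespace Neck

open Functor.LaxMonoidal

variable {W : Type u} [Category.{v} W] [MonoidalCategory W] {W' : Type u'} [Category.{v'} W']
  [MonoidalCategory W']

/-- `X_n` with the maps `p_n` and `μ_{k,l}`, `k, l > 0`, is the limit defining the templicial object
of `G` in degree `n`, and this limit is preserved by `Φ`. -/
def IsRelLimit (Φ : W' ⥤ W) (X : FIntᵒᵖ ⥤ W') [X.OplaxMonoidal] (G : Necᵒᵖ ⥤ W')
    [G.LaxMonoidal] (p : ∀ n, ob X n ⟶ G.obj (op (Nec.simplex n))) (n : ℕ) : Prop :=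
  ∀ (Q : W) (fst : Q ⟶ Φ.obj (G.obj (op (Nec.simplex n))))
    (snd : ∀ k l : ℕ, 0 < k → 0 < l → n = k + l → (Q ⟶ Φ.obj (ob X k ⊗ ob X l))),
    (∀ (k l : ℕ) (hk : 0 < k) (hl : 0 < l) (h : n = k + l),
      snd k l hk hl h ≫ Φ.map ((p k ⊗ₘ p l) ≫ lmul G (Nec.simplex k) (Nec.simplex l)) =
        fst ≫ Φ.map (lmap G (Nec.inert k l n h))) →
    (∀ (r s t : ℕ) (hr : 0 < r) (hs : 0 < s) (ht : 0 < t) (h : n = r + s + t),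
      snd r (s + t) hr (by omega) (by omega) ≫ Φ.map (ob X r ◁ comul X s t (s + t) rfl) =
        snd (r + s) t (by omega) ht h ≫ Φ.map (comul X r s (r + s) rfl ▷ ob X t ≫ (α_ _ _ _).hom)) →
    ∃! z : Q ⟶ Φ.obj (ob X n), z ≫ Φ.map (p n) = fst ∧
      ∀ (k l : ℕ) (hk : 0 < k) (hl : 0 < l) (h : n = k + l),
        z ≫ Φ.map (comul X k l n h) = snd k l hk hl h

variable {Φ : W' ⥤ W} [Φ.LaxMonoidal] {X : FIntᵒᵖ ⥤ W'} [X.OplaxMonoidal] {G : Necᵒᵖ ⥤ W'}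
  [G.LaxMonoidal] {p : ∀ n, ob X n ⟶ G.obj (op (Nec.simplex n))}

/-- Uniqueness in the limit, applied to the cone induced by `z`. Its two conditions are the
compatibility of `p` with inert maps and the coassociativity of `X`. -/
lemma IsRelLimit.hom_ext {n : ℕ} (hl : IsRelLimit Φ X G p n) (hp : SimplexMaps X G p) {Q : W}
    {z z' : Q ⟶ Φ.obj (ob X n)} (h₁ : z ≫ Φ.map (p n) = z' ≫ Φ.map (p n))
    (h₂ : ∀ (k l : ℕ) (hk : 0 < k) (hl : 0 < l) (h : n = k + l),
      z ≫ Φ.map (comul X k l n h) = z' ≫ Φ.map (comul X k l n h)) : z = z' := by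
  obtain ⟨y, _, hy⟩ := hl Q (z ≫ Φ.map (p n)) (fun k l _ _ h => z ≫ Φ.map (comul X k l n h))
    (fun k l hk hl h => by
      rw [Category.assoc, Category.assoc, ← Φ.map_comp, ← Φ.map_comp, hp.mul k l n hk hl h])
    (fun r s t hr hs ht h => by
      rw [Category.assoc, Category.assoc, ← Φ.map_comp, ← Φ.map_comp,
        comul_assoc X h rfl (by omega) rfl])
  rw [hy z ⟨rfl, fun _ _ _ _ _ => rfl⟩, hy z' ⟨h₁.symm, fun k l hk hl h => (h₂ k l hk hl h).symm⟩]

lemma lmul_comp (T U : Nec) : lmul (G ⋙ Φ) T U = μ Φ _ _ ≫ Φ.map (lmul G T U) := rfl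

lemma lone_comp : lone (G ⋙ Φ) = ε Φ ≫ Φ.map (lone G) := rfl

/-- With its mirror image below, this settles the decompositions with a zero summand, where the
comultiplication is a unitor followed by the unit `I ≅ X_0`. -/
lemma coh_left_comul {A B : W} {A' B' : W'} (u : 𝟙_ W ⟶ A) (u' : 𝟙_ W' ⟶ A') (q : A ⟶ Φ.obj A')
    (z : B ⟶ Φ.obj B') (h : u ≫ q = ε Φ ≫ Φ.map u') :
    ((λ_ _).inv ≫ u ▷ B) ≫ (q ⊗ₘ z) ≫ μ Φ _ _ = z ≫ Φ.map ((λ_ _).inv ≫ u' ▷ B') := by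
  have h1 : u ▷ B ≫ (q ⊗ₘ z) = (𝟙_ W ◁ z) ≫ ε Φ ▷ _ ≫ Φ.map u' ▷ _ := by
    rw [← comp_whiskerRight, ← h, ← tensorHom_id, tensorHom_comp_tensorHom, Category.id_comp,
      tensorHom_def']
  rw [Category.assoc, reassoc_of% h1, μ_natural_left, ← leftUnitor_inv_naturality_assoc,
    Φ.map_comp, left_unitality_inv_assoc]

lemma coh_right_comul {A B : W} {A' B' : W'} (u : 𝟙_ W ⟶ A) (u' : 𝟙_ W' ⟶ A') (q : A ⟶ Φ.obj A')
    (z : B ⟶ Φ.obj B') (h : u ≫ q = ε Φ ≫ Φ.map u') :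
    ((ρ_ _).inv ≫ B ◁ u) ≫ (z ⊗ₘ q) ≫ μ Φ _ _ = z ≫ Φ.map ((ρ_ _).inv ≫ B' ◁ u') := by
  have h1 : B ◁ u ≫ (z ⊗ₘ q) = (z ▷ 𝟙_ W) ≫ _ ◁ ε Φ ≫ _ ◁ Φ.map u' := by
    rw [← MonoidalCategory.whiskerLeft_comp, ← h, ← id_tensorHom, tensorHom_comp_tensorHom,
      Category.id_comp, MonoidalCategory.tensorHom_def]
  rw [Category.assoc, reassoc_of% h1, μ_natural_right, ← rightUnitor_inv_naturality_assoc,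
    Φ.map_comp, right_unitality_inv_assoc]

/-- This and its mirror image bring the two composites in the coassociativity condition of a cone to
a common form: an iterated comultiplication of the source, followed by three lifts. -/
lemma coh_comul_left {A B A₁ A₂ E : W} {B' A' A₁' A₂' : W'} {d : E ⟶ B ⊗ A} {c : A ⟶ A₁ ⊗ A₂}
    {c' : A' ⟶ A₁' ⊗ A₂'} {b : B ⟶ Φ.obj B'} {q : A ⟶ Φ.obj A'} {q₁ : A₁ ⟶ Φ.obj A₁'}
    {q₂ : A₂ ⟶ Φ.obj A₂'} (h : q ≫ Φ.map c' = c ≫ (q₁ ⊗ₘ q₂) ≫ μ Φ _ _) :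
    (d ≫ (b ⊗ₘ q) ≫ μ Φ _ _) ≫ Φ.map (B' ◁ c') =
      (d ≫ B ◁ c) ≫ (b ⊗ₘ (q₁ ⊗ₘ q₂)) ≫ _ ◁ μ Φ _ _ ≫ μ Φ _ _ := by
  simp only [Category.assoc]
  rw [← μ_natural_right]
  have h1 : (b ⊗ₘ q) ≫ _ ◁ Φ.map c' = B ◁ c ≫ (b ⊗ₘ (q₁ ⊗ₘ q₂)) ≫ _ ◁ μ Φ _ _ := by
    simp only [← id_tensorHom, tensorHom_comp_tensorHom, h, Category.id_comp, Category.comp_id]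
  rw [reassoc_of% h1]

lemma coh_comul_right {A B A₁ A₂ E : W} {B' A' A₁' A₂' : W'} {d : E ⟶ A ⊗ B} {c : A ⟶ A₁ ⊗ A₂}
    {c' : A' ⟶ A₁' ⊗ A₂'} {b : B ⟶ Φ.obj B'} {q : A ⟶ Φ.obj A'} {q₁ : A₁ ⟶ Φ.obj A₁'}
    {q₂ : A₂ ⟶ Φ.obj A₂'} (h : q ≫ Φ.map c' = c ≫ (q₁ ⊗ₘ q₂) ≫ μ Φ _ _) :
    (d ≫ (q ⊗ₘ b) ≫ μ Φ _ _) ≫ Φ.map (c' ▷ B' ≫ (α_ _ _ _).hom) =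
      (d ≫ c ▷ B ≫ (α_ _ _ _).hom) ≫ (q₁ ⊗ₘ (q₂ ⊗ₘ b)) ≫ _ ◁ μ Φ _ _ ≫ μ Φ _ _ := by
  simp only [Category.assoc, Φ.map_comp]
  rw [← μ_natural_left_assoc]
  have h1 : (q ⊗ₘ b) ≫ Φ.map c' ▷ _ = c ▷ B ≫ ((q₁ ⊗ₘ q₂) ⊗ₘ b) ≫ μ Φ _ _ ▷ _ := by
    simp only [← tensorHom_id, tensorHom_comp_tensorHom, h, Category.id_comp, Category.comp_id]
  rw [reassoc_of% h1, Functor.LaxMonoidal.associativity, associator_naturality_assoc]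

instance (Y : FIntᵒᵖ ⥤ W) [Y.OplaxMonoidal] [IsIso (Functor.OplaxMonoidal.η Y)] : IsIso (un Y) :=
  inferInstanceAs (IsIso (inv (coun Y)))

variable [IsIso (Functor.OplaxMonoidal.η X)]
  {Y : FIntᵒᵖ ⥤ W} [Y.OplaxMonoidal] [IsIso (Functor.OplaxMonoidal.η Y)]
  {r : ∀ n, ob Y n ⟶ (G ⋙ Φ).obj (op (Nec.simplex n))}

/-- In degree `0` the lift is forced by the units. In degree `n > 0` the cone consists of `r n` and
of the comultiplications of `Y` followed by the lifts in degrees `k, l < n`. Naturality plays no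
role yet; it is a consequence of uniqueness in `lift_natural`. -/
lemma exists_lift_family (hl : ∀ n, 0 < n → IsRelLimit Φ X G p n) (hp : SimplexMaps X G p)
    (hr : SimplexMaps Y (G ⋙ Φ) r) :
    ∃ q : ∀ n, ob Y n ⟶ Φ.obj (ob X n), (un Y ≫ q 0 = ε Φ ≫ Φ.map (un X)) ∧
      (∀ n, q n ≫ Φ.map (p n) = r n) ∧
      ∀ (k l n : ℕ) (hk : 0 < k) (hl : 0 < l) (h : n = k + l),
        q n ≫ Φ.map (comul X k l n h) = comul Y k l n h ≫ (q k ⊗ₘ q l) ≫ μ Φ _ _ := by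
  obtain ⟨q, hq⟩ := exists_strong_rec (A := fun n => (ob Y n ⟶ Φ.obj (ob X n)))
    -- The degree is a variable here, so the unit condition is stated through the identity `[n] →
    -- [0]` for a proof of `n = 0`. It reduces to the plain one at the end.
    (fun n a hist => (∀ h : n = 0, un Y ≫ mp Y (FInt.cast h : (⟨n⟩ : FInt) ⟶ ⟨0⟩) ≫ a =
        ε Φ ≫ Φ.map (un X ≫ mp X (FInt.cast h : (⟨n⟩ : FInt) ⟶ ⟨0⟩))) ∧
      a ≫ Φ.map (p n) = r n ∧
      ∀ (k l : ℕ) (hk : 0 < k) (hl : 0 < l) (h : n = k + l),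
        a ≫ Φ.map (comul X k l n h) =
          comul Y k l n h ≫ (hist k (by omega) ⊗ₘ hist l (by omega)) ≫ μ Φ _ _) (by
    intro n hist hh
    rcases Nat.eq_zero_or_pos n with rfl | hn
    · refine ⟨coun Y ≫ ε Φ ≫ Φ.map (un X), fun h => ?_, ?_, fun k l hk hl h => by omega⟩
      · rw [FInt.cast_rfl, mp, mp, op_id, Y.map_id, X.map_id, Category.id_comp, Category.comp_id,
          un, IsIso.inv_hom_id_assoc]
      · rw [hr.unit, lone_comp, Category.assoc, Category.assoc, ← Φ.map_comp, hp.un]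
    · obtain ⟨z, ⟨h1, h2⟩, _⟩ := hl n hn (ob Y n) (r n) (fun k l hk hl h =>
          comul Y k l n h ≫ (hist k (by omega) ⊗ₘ hist l (by omega)) ≫ μ Φ _ _)
        (fun k l hk hl h => by
          have h1 := (hh k (by omega)).2.1
          have h2 := (hh l (by omega)).2.1
          have h3 := hr.mul k l n hk hl h
          rw [lmul_comp, ← h1, ← h2, ← tensorHom_comp_tensorHom, Category.assoc, μ_natural_assoc,
            ← Φ.map_comp] at h3
          simp only [Category.assoc]
          exact h3)
        -- The conditions already known in degrees `l + m` and `k + l` reduce the coassociativity of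
        -- the cone to that of `Y`.
        (fun k l m hk hl hm h => by
          have h1 := (hh (l + m) (by omega)).2.2 l m hl hm rfl
          have h2 := (hh (k + l) (by omega)).2.2 k l hk hl rfl
          rw [coh_comul_left h1, coh_comul_right h2, comul_assoc Y h rfl (by omega) rfl])
      exact ⟨z, fun h => by omega, h1, h2⟩)
  refine ⟨q, ?_, fun n => (hq n).2.1, fun k l n hk hl h => (hq n).2.2 k l hk hl h⟩
  have h := (hq 0).1 rfl
  rwa [FInt.cast_rfl, mp, mp, op_id, Y.map_id, X.map_id, Category.id_comp, Category.comp_id] at h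

/-- The compatibility with the comultiplications also holds for the degenerate decompositions. -/
lemma comul_lift {q : ∀ n, ob Y n ⟶ Φ.obj (ob X n)} (h₀ : un Y ≫ q 0 = ε Φ ≫ Φ.map (un X))
    (h₁ : ∀ (k l n : ℕ) (hk : 0 < k) (hl : 0 < l) (h : n = k + l),
      q n ≫ Φ.map (comul X k l n h) = comul Y k l n h ≫ (q k ⊗ₘ q l) ≫ μ Φ _ _)
    (k l n : ℕ) (h : n = k + l) :
    comul Y k l n h ≫ (q k ⊗ₘ q l) ≫ μ Φ _ _ = q n ≫ Φ.map (comul X k l n h) := by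
  rcases Nat.eq_zero_or_pos k with rfl | hk
  · obtain rfl : n = l := by omega
    rw [comul_left', comul_left']
    exact coh_left_comul _ _ _ _ h₀
  · rcases Nat.eq_zero_or_pos l with rfl | hl
    · obtain rfl : n = k := by omega
      rw [comul_right', comul_right']
      exact coh_right_comul _ _ _ _ h₀
    · exact (h₁ k l n hk hl h).symm

/-- Induction on the length of the source. Both sides agree after `p`, and after `μ_{k,l}` they
agree by induction, since `f` is the sum of its restrictions to `[0, k]` and to `[k, m]`. -/
lemma lift_natural (hl : ∀ n, 0 < n → IsRelLimit Φ X G p n) (hp : SimplexMaps X G p)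
    (hr : SimplexMaps Y (G ⋙ Φ) r) {q : ∀ n, ob Y n ⟶ Φ.obj (ob X n)}
    (h₀ : un Y ≫ q 0 = ε Φ ≫ Φ.map (un X)) (hq : ∀ n, q n ≫ Φ.map (p n) = r n)
    (h₁ : ∀ (k l n : ℕ) (h : n = k + l),
      comul Y k l n h ≫ (q k ⊗ₘ q l) ≫ μ Φ _ _ = q n ≫ Φ.map (comul X k l n h))
    {m n : ℕ} (f : (⟨m⟩ : FInt) ⟶ ⟨n⟩) : mp Y f ≫ q m = q n ≫ Φ.map (mp X f) := by
  induction m using Nat.strong_induction_on generalizing n with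
  | _ m ih =>
    rcases Nat.eq_zero_or_pos m with rfl | hm
    · obtain rfl := FInt.eq_zero_of_hom f
      obtain rfl := FInt.hom_zero_eq f
      rw [mp, mp, op_id, Y.map_id, X.map_id, Φ.map_id, Category.id_comp, Category.comp_id]
    · refine (hl m hm).hom_ext hp ?_ fun k l hk hl h => ?_
      · rw [Category.assoc, hq, hr.map f, Category.assoc, ← Φ.map_comp, hp.map f, Φ.map_comp,
          ← Category.assoc, hq]
        rfl
      -- The value of `f` at `k` may be `0` or `n`, as `f` need not be injective. Hence `h₁` is
      -- required for all decompositions, not only the positive ones.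
      · have hn : n = FInt.fn f k + (n - FInt.fn f k) := by
          have := FInt.fn_le' f k
          omega
        have e1 := comul_nat Y h hn f _ _ (FInt.isSum_seg f k l h)
        have e2 := comul_nat X h hn f _ _ (FInt.isSum_seg f k l h)
        rw [Category.assoc, Category.assoc, ← Φ.map_comp, e2, Φ.map_comp, ← h₁, reassoc_of% e1,
          tensorHom_comp_tensorHom_assoc, ih k (by omega), ih l (by omega),
          ← tensorHom_comp_tensorHom, Category.assoc, μ_natural, reassoc_of% (h₁ _ _ n hn)]

/-- Compatible maps `Y_n → Φ(G_{Δ^n})` lift to a map of templicial objects. -/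
lemma exists_lift (hl : ∀ n, 0 < n → IsRelLimit Φ X G p n) (hp : SimplexMaps X G p)
    (hr : SimplexMaps Y (G ⋙ Φ) r) :
    ∃ q : Y ⟶ X ⋙ Φ, Compat q ∧ ∀ n, qn q n ≫ Φ.map (p n) = r n := by
  obtain ⟨q, h₀, hq, h₁⟩ := exists_lift_family hl hp hr
  have h₂ := comul_lift h₀ h₁
  refine ⟨{ app := fun n => q n.unop.len,
            naturality := fun m n f => lift_natural hl hp hr h₀ hq h₂ f.unop }, ⟨fun m n => ?_, ?_⟩, hq⟩
  · have h := h₂ m.unop.len n.unop.len _ rfl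
    rw [comul_rfl, comul_rfl] at h
    exact h
  -- The recursion controls the unit `un`; since it is inverse to the counit, the condition on
  -- counits follows by cancellation.
  · have h : coun Y ≫ ε Φ = q 0 ≫ Φ.map (coun X) := by
      rw [← cancel_epi (un Y), reassoc_of% h₀, un, IsIso.inv_hom_id_assoc, ← Φ.map_comp, un,
        IsIso.inv_hom_id, Φ.map_id, Category.comp_id]
    exact h

/-- Degree `0` is forced by the units. In positive degree both candidates have the same first leg by
assumption and the same other legs by induction. -/
lemma lift_unique (hl : ∀ n, 0 < n → IsRelLimit Φ X G p n) (hp : SimplexMaps X G p)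
    {q q' : Y ⟶ X ⋙ Φ} (hq : Compat q) (hq' : Compat q')
    (h : ∀ n, qn q n ≫ Φ.map (p n) = qn q' n ≫ Φ.map (p n)) : q = q' := by
  have key : ∀ n, qn q n = qn q' n := fun n => by
    induction n using Nat.strong_induction_on with
    | _ n ih =>
      rcases Nat.eq_zero_or_pos n with rfl | hn
      · rw [← cancel_epi (un Y), hq.un, hq'.un]
      · refine (hl n hn).hom_ext hp (h n) fun k l hk hl e => ?_
        rw [← hq.comul', ← hq'.comul', ih k (by omega), ih l (by omega)]
  exact NatTrans.ext (funext fun n => key n.unop.len)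

/-- Composing `q^nec` with the extension of `p` is the extension of the composites on simplices.
This turns composition with the counit of the adjunction into a statement about the family `q_n ≫
p_n`. -/
lemma qL_extendL (q : Y ⟶ X ⋙ Φ) (L : List ℕ) (h : ∀ n ∈ L, 0 < n) :
    qL q L ≫ Φ.map (extendL p L h) =
      extendL (G := G ⋙ Φ) (fun n => qn q n ≫ Φ.map (p n)) L h := by
  induction L with
  | nil => rfl
  | cons n L ih =>
    have h' : ∀ n ∈ L, 0 < n := fun n hn => h n (List.mem_cons_of_mem _ hn)
    rw [extendL_cons n L h h', extendL_cons n L h h', ← ih h', qL_cons, lmul_comp,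
      ← tensorHom_comp_tensorHom, Category.assoc, Category.assoc, Category.assoc, μ_natural_assoc,
      Φ.map_comp, Φ.map_comp]
    rfl

end Neck

/-! ### Recovering a family from its extension -/

namespace Neck

open Functor.LaxMonoidal

variable {W : Type u} [Category.{v} W] [MonoidalCategory W] {Y : FIntᵒᵖ ⥤ W} [Y.OplaxMonoidal]
  [IsIso (Functor.OplaxMonoidal.η Y)] {G : Necᵒᵖ ⥤ W} [G.LaxMonoidal]

/-- On one bead the extension multiplies `r` with the unit of `G`, which the unit law removes again.
-/
lemma canon_extendL (r : ∀ n, ob Y n ⟶ G.obj (op (Nec.simplex n))) (n : ℕ) :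
    canon Y (n + 1) ≫ extendL r (Nec.simplex (n + 1)).beads (Nec.simplex (n + 1)).pos =
      r (n + 1) := by
  have h := lmul_right_cancel (G := G) (T := Nec.simplex (n + 1))
    (Nec.consMap (n + 1) [] (Nec.simplex (n + 1)).pos (Nec.simplex 0).pos)
    (fun i hi => (Nec.fn_consMap _ _ _ _ _).trans (by
      rw [Nec.len_simplex] at hi
      simpa using hi)) (r (n + 1))
  exact (congrArg (fun t => (ρ_ (ob Y (n + 1))).inv ≫ t) h).trans (Iso.inv_hom_id_assoc _ _)

variable {W' : Type u'} [Category.{v'} W'] [MonoidalCategory W'] {Φ : W' ⥤ W} [Φ.LaxMonoidal]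
  {X : FIntᵒᵖ ⥤ W'} [X.OplaxMonoidal] [IsIso (Functor.OplaxMonoidal.η X)] {G' : Necᵒᵖ ⥤ W'}
  [G'.LaxMonoidal] {p : ∀ n, ob X n ⟶ G'.obj (op (Nec.simplex n))}

/-- Uniqueness in the form in which it is used: an equality of enriched functors gives equal
extensions on simplices of positive dimension, and degree `0` follows from the units. -/
lemma lift_unique_extendL (hl : ∀ n, 0 < n → IsRelLimit Φ X G' p n) (hp : SimplexMaps X G' p)
    {q q' : Y ⟶ X ⋙ Φ} (hq : Compat q) (hq' : Compat q')
    (h : ∀ n, extendL (G := G' ⋙ Φ) (fun n => qn q n ≫ Φ.map (p n)) (Nec.simplex (n + 1)).beads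
        (Nec.simplex (n + 1)).pos =
      extendL (G := G' ⋙ Φ) (fun n => qn q' n ≫ Φ.map (p n)) (Nec.simplex (n + 1)).beads
        (Nec.simplex (n + 1)).pos) : q = q' := by
  refine lift_unique hl hp hq hq' fun n => ?_
  cases n with
  | zero => rw [← cancel_epi (un Y), reassoc_of% hq.un, reassoc_of% hq'.un]
  | succ n =>
    exact (canon_extendL (G := G' ⋙ Φ) (fun n => qn q n ≫ Φ.map (p n)) n).symm.trans
      ((congrArg (fun t => canon Y (n + 1) ≫ t) (h n)).trans
        (canon_extendL (G := G' ⋙ Φ) (fun n => qn q' n ≫ Φ.map (p n)) n))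

end Neck

/-! ### The universal property of `C^temp` -/

namespace NecCat

open VQuiv NecV Neck Functor.LaxMonoidal

variable {V : Type u} [Category.{v} V] [MonoidalCategory V] [SymmetricCategory V]
  [MonoidalClosed V] [HasColimits V] {C : NecCat V}

attribute [instance] Temp.oplax Temp.unital

lemma Temp.simplexMaps (D : C.Temp) : SimplexMaps D.X C.toLax D.p where
  unit := D.isTemp.unit
  map := D.isTemp.map
  mul := D.isTemp.mul

/-- The functor `f^*` has the left adjoint `f_!`. A cone from `Q` over the restricted diagram is
transposed to a cone from `f_! Q`, and the resulting map is transposed back. -/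
lemma Temp.isRelLimit (D : C.Temp) {S : Type v} (f : S → C.Obj) (n : ℕ) (hn : 0 < n) :
    IsRelLimit (VQuiv.pullback V f) D.X C.toLax D.p n := by
  intro Q fst snd hmul hco
  let adj := pushAdj V f
  let c : C.TempCone D.X D.p n ((pushforward V f).obj Q) :=
    { fst := (adj.homEquiv _ _).symm fst
      snd := fun k l hk hl h => (adj.homEquiv _ _).symm (snd k l hk hl h)
      mul := fun k l hk hl h => by
        have e := congrArg (adj.homEquiv _ _).symm (hmul k l hk hl h)
        rw [adj.homEquiv_naturality_right_symm, adj.homEquiv_naturality_right_symm] at e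
        exact e
      coassoc := fun r s t hr hs ht h => by
        have e := congrArg (adj.homEquiv _ _).symm (hco r s t hr hs ht h)
        rw [adj.homEquiv_naturality_right_symm, adj.homEquiv_naturality_right_symm] at e
        exact e }
  obtain ⟨z, ⟨h1, h2⟩, hu⟩ := D.isTemp.limit n hn _ c
  refine ⟨adj.homEquiv _ _ z, ⟨?_, fun k l hk hl h => ?_⟩, fun z' hz' => ?_⟩
  · exact (adj.homEquiv_naturality_right z (D.p n)).symm.trans
      ((congrArg (adj.homEquiv _ _) h1).trans (Equiv.apply_symm_apply _ _))
  · exact (adj.homEquiv_naturality_right z (comul D.X k l n h)).symm.trans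
      ((congrArg (adj.homEquiv _ _) (h2 k l hk hl h)).trans (Equiv.apply_symm_apply _ _))
  · refine (Equiv.symm_apply_eq _).1 (hu ((adj.homEquiv _ _).symm z') ⟨?_, fun k l hk hl h => ?_⟩)
    · exact (adj.homEquiv_naturality_right_symm z' (D.p n)).symm.trans
        (congrArg (adj.homEquiv _ _).symm hz'.1)
    · exact (adj.homEquiv_naturality_right_symm z' (comul D.X k l n h)).symm.trans
        (congrArg (adj.homEquiv _ _).symm (hz'.2 k l hk hl h))

/-- A transformation into `C`, over the identity map of objects. -/
def overId {F : Necᵒᵖ ⥤ VQuiv V C.Obj} (θ : F ⟶ C.toLax) :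
    F ⟶ C.toLax ⋙ VQuiv.pullback V (fun a : C.Obj => a) where
  app T := θ.app T
  naturality _ _ f := θ.naturality f

/-- The lax structure of the restriction along the identity map is trivial (`pullMul_id`,
`pullUnit_id`). -/
lemma overId_isMonoidalNat {F : Necᵒᵖ ⥤ VQuiv V C.Obj} [F.LaxMonoidal] {θ : F ⟶ C.toLax}
    (hθ : IsMonoidalNat θ) : IsMonoidalNat (overId θ) where
  mul T U := by
    refine (hθ.mul T U).trans (congrArg (fun t => (θ.app (op T) ⊗ₘ θ.app (op U)) ≫ t) ?_)
    refine (Category.id_comp _).symm.trans ?_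
    exact congrArg (fun t => t ≫ C.mul T U) (pullMul_id (C.quiv T) (C.quiv U)).symm
  unit := by
    refine hθ.unit.trans ((Category.id_comp _).symm.trans ?_)
    exact congrArg (fun t => t ≫ C.one) pullUnit_id.symm

/-- The counit `(C^temp)^nec → C`. -/
def Temp.counit (D : C.Temp) : (Templicial.nec V).obj D.toTemplicial ⟶ C :=
  homOfTrans (F := toNec D.X) (overId_isMonoidalNat D.simplexMaps.extend_isMonoidalNat)

section

variable (D : C.Temp) {Y : Templicial V}

/-- The map on vertices of a map to `C^temp`. -/
def Temp.vert (h : Y ⟶ D.toTemplicial) : Y.S → C.Obj := Templicial.Hom.f h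

/-- The natural transformation underlying a map to `C^temp`. -/
def Temp.trans (h : Y ⟶ D.toTemplicial) : Y.X ⟶ D.X ⋙ VQuiv.pullback V (D.vert h) :=
  Templicial.Hom.q h

lemma Temp.map_comp_counit (h : Y ⟶ D.toTemplicial) (a b : Y.S) (T : Necᵒᵖ) :
    ap (homMap (F := toNec Y.X) ((Templicial.nec V).map h ≫ D.counit) a b) T =
      app (extendL (G := C.toLax ⋙ VQuiv.pullback V (D.vert h))
        (fun n => qn (D.trans h) n ≫ (VQuiv.pullback V (D.vert h)).map (D.p n))
        T.unop.beads T.unop.pos) a b :=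
  congrArg (fun t => app t a b) (qL_extendL (D.trans h) T.unop.beads T.unop.pos)

/-- The target of `homMap E a b` depends on the action of `E` on objects, so an equality of functors
first yields a heterogeneous equality of hom maps. -/
lemma homMap_heq {S : Type v} {F : Necᵒᵖ ⥤ VQuiv V S} [F.LaxMonoidal] {E E' : ofLax F ⟶ C}
    (e : E = E') (a b : S) : HEq (homMap E a b) (homMap E' a b) := by
  subst e
  rfl

lemma Temp.injective (h h' : Y ⟶ D.toTemplicial)
    (e : (Templicial.nec V).map h ≫ D.counit = (Templicial.nec V).map h' ≫ D.counit) : h = h' := by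
  have ef : Templicial.Hom.f h = Templicial.Hom.f h' :=
    congrArg (fun E : ofLax (toNec Y.X) ⟶ C => objMap E) e
  -- The vertex maps are identified before anything else, because the types of `q` and `q'` involve
  -- restriction along them. The morphisms are then reassembled over the common `f`.
  obtain ⟨f, q, hc, hu⟩ := h
  obtain ⟨f', q', hc', hu'⟩ := h'
  obtain rfl : f = f' := ef
  let h : Y ⟶ D.toTemplicial := ⟨f, q, hc, hu⟩
  let h' : Y ⟶ D.toTemplicial := ⟨f, q', hc', hu'⟩
  have hq : Compat (D.trans h) := ⟨hc, hu⟩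
  have hq' : Compat (D.trans h') := ⟨hc', hu'⟩
  have key : D.trans h = D.trans h' := by
    refine lift_unique_extendL (D.isRelLimit _) D.simplexMaps (q := D.trans h) (q' := D.trans h')
      hq hq' fun n => VQuiv.hom_ext fun a b => ?_
    refine (D.map_comp_counit h a b (op (Nec.simplex (n + 1)))).symm.trans
      (Eq.trans ?_ (D.map_comp_counit h' a b (op (Nec.simplex (n + 1)))))
    have e' : homMap (F := toNec Y.X) ((Templicial.nec V).map h ≫ D.counit) a b =
      homMap (F := toNec Y.X) ((Templicial.nec V).map h' ≫ D.counit) a b :=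
        eq_of_heq (homMap_heq e a b)
    exact congrArg (fun t => ap t (op (Nec.simplex (n + 1)))) e'
  obtain rfl : q = q' := key
  rfl

end

/-- For surjectivity, a functor `Y^nec → C` is a monoidal transformation over its object map. Its
values on simplices lift to `C^temp`, and composing the lift with the counit returns the extension
of these values, which is the given transformation by `eq_extendL`. -/
lemma Temp.bijective (D : C.Temp) (Y : Templicial V) :
    Function.Bijective fun h : Y ⟶ D.toTemplicial => (Templicial.nec V).map h ≫ D.counit := by
  refine ⟨fun h h' => D.injective h h', ?_⟩
  · intro g
    let g' : ofLax (toNec Y.X) ⟶ C := g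
    have hθ := transOfHom_isMonoidalNat g'
    have hr := (canon_simplexMaps Y.X).comp hθ
    obtain ⟨q, hq, hp⟩ := exists_lift (D.isRelLimit (objMap g')) D.simplexMaps hr
    let h : Templicial.Hom Y D.toTemplicial :=
      { f := objMap g'
        q := q
        comul := hq.comul
        counit := hq.counit }
    refine ⟨h, EnrichedFunctor.ext _ (fun _ => rfl) fun a b =>
      (Category.comp_id _).trans (NecV.hom_ext fun T => ?_)⟩
    refine (D.map_comp_counit h a b T).trans ?_
    have e : (fun n => qn q n ≫ (VQuiv.pullback V (objMap g')).map (D.p n)) = _ := funext hp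
    refine (congrArg (fun t => app (extendL (G := C.toLax ⋙ VQuiv.pullback V (objMap g'))
      t T.unop.beads T.unop.pos) a b) e).trans ?_
    exact congrArg (fun t => app t a b) (eq_extendL hθ T.unop.beads T.unop.pos).symm

end NecCat

/-! ### Full faithfulness: `X` as a limit for `X^nec` -/

namespace Templicial

open VQuiv NecV Neck Functor.LaxMonoidal

variable {V : Type u} [Category.{v} V] [MonoidalCategory V] [SymmetricCategory V]
  [MonoidalClosed V] [HasColimits V]

/-- A composite of associators and unitors. This strength of the monoidal structure of `X^nec` is
what makes `selfTemp` a limit. -/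
instance isIso_join {W : Type*} [Category W] [MonoidalCategory W] (X : FIntᵒᵖ ⥤ W) (L M : List ℕ) :
    IsIso (join X L M) := by
  induction L with
  | nil => exact inferInstanceAs (IsIso (λ_ _).hom)
  | cons n L ih => exact inferInstanceAs (IsIso ((α_ _ _ _).hom ≫ ob X n ◁ join X L M))

/-- The functor underlying `X`, with values in the quivers on the objects of `X^nec`. -/
def quivFun (X : Templicial V) : FIntᵒᵖ ⥤ VQuiv V (necObj X).Obj := X.X

instance (X : Templicial V) : X.quivFun.OplaxMonoidal := X.oplax

instance (X : Templicial V) : IsIso (Functor.OplaxMonoidal.η X.quivFun) := X.unital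

lemma necObj_mul (X : Templicial V) (T U : Nec) :
    (necObj X).mul T U = lmul (toNec X.quivFun) T U := VQuiv.hom_ext fun a c => inj_ext fun b =>
  ((necObj X).inj_mul a b c T U).trans (dη_homComp (toNec X.X) a b c (op T) (op U))

lemma necObj_one (X : Templicial V) :
    (necObj X).one = lone (toNec X.quivFun) := VQuiv.hom_ext fun a b => uinj_ext fun e => by
  subst e
  exact ((necObj X).uinj_one a).trans (dν_homId (toNec X.X) a)

/-- A templicial object `X` is a result of the limit construction for `X^nec`. -/
def selfTemp (X : Templicial V) : (necObj X).Temp where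
  X := X.quivFun
  p := canon X.quivFun
  isTemp :=
    { unit := by
        rw [necObj_one]
        exact (canon_simplexMaps X.quivFun).unit
      map := fun f => (canon_simplexMaps X.quivFun).map f
      mul := fun k l n hk hl h => by
        rw [necObj_mul]
        exact (canon_simplexMaps X.quivFun).mul k l n hk hl h
      -- The map `canon` is invertible, so the first leg forces the solution. The other legs then
      -- agree after the isomorphism `(canon k ⊗ canon l) ≫ lmul`, by the condition `mul` of the
      -- cone.
      limit := fun n hn Q c => by
        let fst : Q ⟶ (toNec X.quivFun).obj (op (Nec.simplex n)) := c.fst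
        refine ⟨fst ≫ inv (canon X.quivFun n), ⟨?_, fun k l hk hl h => ?_⟩, fun z hz => ?_⟩
        · have h1 : (fst ≫ inv (canon X.quivFun n)) ≫ canon X.quivFun n = fst := by
            rw [Category.assoc, IsIso.inv_hom_id, Category.comp_id]
          exact h1
        · have h1 := (canon_simplexMaps X.quivFun).mul k l n hk hl h
          have h2 := c.mul k l hk hl h
          rw [necObj_mul] at h2
          have h3 : c.snd k l hk hl h ≫ (canon X.quivFun k ⊗ₘ canon X.quivFun l) ≫
            lmul (toNec X.quivFun) (Nec.simplex k) (Nec.simplex l) =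
              fst ≫ lmap (toNec X.quivFun) (Nec.inert k l n h) := h2
          have : IsIso (lmul (toNec X.quivFun) (Nec.simplex k) (Nec.simplex l)) :=
            isIso_join X.quivFun (Nec.simplex k).beads (Nec.simplex l).beads
          rw [← cancel_mono ((canon X.quivFun k ⊗ₘ canon X.quivFun l) ≫
            lmul (toNec X.quivFun) (Nec.simplex k) (Nec.simplex l)), h3, Category.assoc,
            Category.assoc, h1, IsIso.inv_hom_id_assoc]
        · have h1 : z ≫ canon X.quivFun n = fst := hz.1
          rw [IsIso.eq_comp_inv, h1] }

/-- The identity `X_T → X_T`, as a transformation of functors on necklaces. -/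
def toLaxSelf (X : Templicial V) : toNec X.quivFun ⟶ (necObj X).toLax where
  app T := 𝟙 ((toNec X.quivFun).obj T)
  naturality T U f :=
    (Category.comp_id ((toNec X.quivFun).map f)).trans (Category.id_comp ((toNec X.quivFun).map f)).symm

lemma toLaxSelf_isMonoidalNat (X : Templicial V) : IsMonoidalNat X.toLaxSelf where
  mul T U := by
    refine (Category.comp_id (lmul (toNec X.quivFun) T U)).trans ((X.necObj_mul T U).symm.trans ?_)
    refine (Category.id_comp _).symm.trans (congrArg (fun t => t ≫ (necObj X).mul T U) ?_)
    exact (id_tensorHom_id ((toNec X.quivFun).obj (op T)) ((toNec X.quivFun).obj (op U))).symm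
  unit := (Category.comp_id (lone (toNec X.quivFun))).trans X.necObj_one.symm

/-- The counit is the extension of `canon`. The identity of `X^nec` is monoidal with the same values
on simplices, so the two agree by `eq_extendL`. -/
lemma selfTemp_counit (X : Templicial V) : X.selfTemp.counit = 𝟙 (necObj X) :=
  EnrichedFunctor.ext _ (fun _ => rfl) fun a b =>
    (Category.comp_id _).trans (NecV.hom_ext fun T => by
      have h := eq_extendL X.toLaxSelf_isMonoidalNat T.unop.beads T.unop.pos
      have e : (fun n => canon X.quivFun n ≫ X.toLaxSelf.app (op (Nec.simplex n))) = canon X.quivFun :=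
        funext fun n => Category.comp_id (canon X.quivFun n)
      refine Eq.trans ?_ (congrArg (fun t => app t a b) h.symm)
      exact congrArg (fun r => app (extendL (G := (necObj X).toLax) r T.unop.beads T.unop.pos) a b)
        e.symm)

/-- The universal property of `selfTemp` with its counit, an identity, removed. -/
lemma nec_map_bijective (Y X : Templicial V) :
    Function.Bijective fun h : Y ⟶ X => (nec V).map h := by
  have h := X.selfTemp.bijective Y
  refine (congrArg Function.Bijective (funext fun p => ?_)).mp h
  refine Eq.symm ?_
  refine (Category.comp_id ((nec V).map p)).symm.trans ?_
  exact congrArg (fun t : necObj X ⟶ necObj X => (nec V).map p ≫ t) X.selfTemp_counit.symm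

end Templicial

/-! ### The limits required in each degree -/

/-- The existence of limits of diagrams of parallel pairs indexed by small sets. -/
def HasGenEqualizers (W : Type u) [Category.{v} W] : Prop :=
  ∀ (I J : Type) (A : I → W) (B : J → W) (s t : J → I) (f : ∀ j, A (s j) ⟶ B j)
    (g : ∀ j, A (t j) ⟶ B j), ∃ (L : W) (π : ∀ i, L ⟶ A i),
      (∀ j, π (s j) ≫ f j = π (t j) ≫ g j) ∧
      ∀ (Q : W) (x : ∀ i, Q ⟶ A i), (∀ j, x (s j) ≫ f j = x (t j) ≫ g j) →
        ∃! z : Q ⟶ L, ∀ i, z ≫ π i = x i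

lemma hasGenEqualizers_of_hasLimits (V : Type u) [Category.{v} V] [HasLimits V] :
    HasGenEqualizers V := by
  intro I J A B s t f g
  -- The index sets lie in `Type`, whereas `HasLimits` refers to the universe `v`.
  have : HasLimitsOfSize.{0, 0} V := hasLimitsOfSizeShrink.{0, 0} V
  let M : MulticospanIndex (⟨I, J, s, t⟩ : MulticospanShape.{0, 0}) V := ⟨A, B, f, g⟩
  have hM := limit.isLimit M.multicospan
  refine ⟨limit M.multicospan, fun i => Multifork.ι (limit.cone M.multicospan) i, fun j =>
    Multifork.condition (limit.cone M.multicospan) j, fun Q x hx => ?_⟩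
  refine ⟨Multifork.IsLimit.lift hM x hx, fun i => Multifork.IsLimit.fac hM x hx i, fun z hz => ?_⟩
  exact Multifork.IsLimit.hom_ext hM fun i => (hz i).trans (Multifork.IsLimit.fac hM x hx i).symm

/-- For a fixed set of vertices, limits of quivers are computed separately at each pair of vertices.
-/
lemma VQuiv.hasGenEqualizers (V : Type u) [Category.{v} V] [HasLimits V] (S : Type v) :
    HasGenEqualizers (VQuiv V S) := by
  intro I J A B s t f g
  have h := fun a b : S => hasGenEqualizers_of_hasLimits V I J (fun i => (A i).obj a b)
    (fun j => (B j).obj a b) s t (fun j => (f j).app a b) (fun j => (g j).app a b)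
  choose L π hπ hu using h
  refine ⟨⟨L⟩, fun i => ⟨fun a b => π a b i⟩, fun j => VQuiv.hom_ext fun a b => hπ a b j,
    fun Q x hx => ?_⟩
  have h := fun a b : S => hu a b (Q.obj a b) (fun i => (x i).app a b)
    fun j => congrArg (fun t => VQuiv.app t a b) (hx j)
  choose z hz hz' using h
  refine ⟨⟨z⟩, fun i => VQuiv.hom_ext fun a b => hz a b i, fun y hy => VQuiv.hom_ext fun a b => ?_⟩
  exact hz' a b _ fun i => congrArg (fun t => VQuiv.app t a b) (hy i)

/-- A decomposition of `n` into two positive summands. -/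
structure Cut2 (n : ℕ) where
  k : ℕ
  l : ℕ
  hk : 0 < k
  hl : 0 < l
  h : n = k + l

/-- A decomposition of `n` into three positive summands. -/
structure Cut3 (n : ℕ) where
  r : ℕ
  s : ℕ
  t : ℕ
  hr : 0 < r
  hs : 0 < s
  ht : 0 < t
  h : n = r + s + t

/-- The decomposition `n = r + (s + t)`. -/
abbrev Cut3.left {n : ℕ} (c : Cut3 n) : Cut2 n :=
  ⟨c.r, c.s + c.t, c.hr, Nat.add_pos_left c.hs _, c.h.trans (Nat.add_assoc _ _ _)⟩

/-- The decomposition `n = (r + s) + t`. -/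
abbrev Cut3.right {n : ℕ} (c : Cut3 n) : Cut2 n :=
  ⟨c.r + c.s, c.t, Nat.add_pos_left c.hr _, c.ht, c.h⟩

lemma HasGenEqualizers.exists_limit {W : Type u} [Category.{v} W] (hW : HasGenEqualizers W) {n : ℕ}
    {E : W} {A B : Cut2 n → W} {D : Cut3 n → W} (u : ∀ c, E ⟶ B c) (m : ∀ c, A c ⟶ B c)
    (f : ∀ c : Cut3 n, A c.left ⟶ D c) (g : ∀ c : Cut3 n, A c.right ⟶ D c) :
    ∃ (L : W) (p : L ⟶ E) (π : ∀ c, L ⟶ A c), (∀ c, π c ≫ m c = p ≫ u c) ∧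
      (∀ c : Cut3 n, π c.left ≫ f c = π c.right ≫ g c) ∧
      ∀ (Q : W) (fst : Q ⟶ E) (snd : ∀ c, Q ⟶ A c), (∀ c, snd c ≫ m c = fst ≫ u c) →
        (∀ c : Cut3 n, snd c.left ≫ f c = snd c.right ≫ g c) →
        ∃! z : Q ⟶ L, z ≫ p = fst ∧ ∀ c, z ≫ π c = snd c := by
  -- One family of parallel pairs encodes the whole diagram. The factors are `E`, at index `none`,
  -- and the `A c`; each decomposition into two summands equates a map out of `A c` with one out of
  -- `E`, and each one into three summands equates maps out of its two bracketings.
  obtain ⟨L, π, hπ, hu⟩ := hW (Option (Cut2 n)) (Cut2 n ⊕ Cut3 n) (fun i => i.elim E A)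
    (Sum.elim B D) (Sum.elim (fun c => some c) fun c => some c.left)
    (Sum.elim (fun c => none) fun c => some c.right)
    (Sum.rec m f) (Sum.rec u g)
  refine ⟨L, π none, fun c => π (some c), fun c => hπ (Sum.inl c), fun c => hπ (Sum.inr c),
    fun Q fst snd h₁ h₂ => ?_⟩
  obtain ⟨z, hz, hz'⟩ := hu Q (Option.rec fst snd) (Sum.rec h₁ h₂)
  exact ⟨z, ⟨hz none, fun c => hz (some c)⟩, fun y hy => hz' y (Option.rec hy.1 hy.2)⟩

/-! ### The tower of limits, without actions of interval maps -/

namespace Neck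

variable {W : Type u} [Category.{v} W] [MonoidalCategory W] (G : Necᵒᵖ ⥤ W) [G.LaxMonoidal]

/-- The objects `X_n`, the maps `p_n : X_n → G_{Δ^n}` and the comultiplications `μ_{k,l}`, `k, l > 0`,
of the inductive limit construction. -/
structure LimitTower where
  X : ℕ → W
  e : X 0 ≅ 𝟙_ W
  p (n : ℕ) : X n ⟶ G.obj (op (Nec.simplex n))
  μ (k l n : ℕ) (hk : 0 < k) (hl : 0 < l) (h : n = k + l) : X n ⟶ X k ⊗ X l
  unit : p 0 = e.hom ≫ lone G
  mul (k l n : ℕ) (hk : 0 < k) (hl : 0 < l) (h : n = k + l) :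
    μ k l n hk hl h ≫ (p k ⊗ₘ p l) ≫ lmul G (Nec.simplex k) (Nec.simplex l) =
      p n ≫ lmap G (Nec.inert k l n h)
  coassoc (r s t n : ℕ) (hr : 0 < r) (hs : 0 < s) (ht : 0 < t) (h : n = r + s + t) :
    μ r (s + t) n hr (by omega) (by omega) ≫ X r ◁ μ s t (s + t) hs ht rfl =
      μ (r + s) t n (by omega) ht h ≫ μ r s (r + s) hr hs rfl ▷ X t ≫ (α_ _ _ _).hom
  limit (n : ℕ) (hn : 0 < n) (Q : W) (fst : Q ⟶ G.obj (op (Nec.simplex n)))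
    (snd : ∀ k l : ℕ, 0 < k → 0 < l → n = k + l → (Q ⟶ X k ⊗ X l)) :
    (∀ (k l : ℕ) (hk : 0 < k) (hl : 0 < l) (h : n = k + l),
      snd k l hk hl h ≫ (p k ⊗ₘ p l) ≫ lmul G (Nec.simplex k) (Nec.simplex l) =
        fst ≫ lmap G (Nec.inert k l n h)) →
    (∀ (r s t : ℕ) (hr : 0 < r) (hs : 0 < s) (ht : 0 < t) (h : n = r + s + t),
      snd r (s + t) hr (by omega) (by omega) ≫ X r ◁ μ s t (s + t) hs ht rfl =
        snd (r + s) t (by omega) ht h ≫ μ r s (r + s) hr hs rfl ▷ X t ≫ (α_ _ _ _).hom) →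
    ∃! z : Q ⟶ X n, z ≫ p n = fst ∧
      ∀ (k l : ℕ) (hk : 0 < k) (hl : 0 < l) (h : n = k + l), z ≫ μ k l n hk hl h = snd k l hk hl h

/-- One degree of a limit tower; the objects `L k` are copies of the objects of lower degree. -/
structure Level (n : ℕ) where
  obj : W
  p : obj ⟶ G.obj (op (Nec.simplex n))
  L : ℕ → W
  μ (k l : ℕ) (hk : 0 < k) (hl : 0 < l) (h : n = k + l) : obj ⟶ L k ⊗ L l

variable {G}

/-- The comultiplication of a level, after the identification of the copies of the objects. -/
def Level.cm {n : ℕ} (a : Level G n) (k l : ℕ) (hk : 0 < k) (hl : 0 < l) (h : n = k + l) {A B : W}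
    (hA : a.L k = A) (hB : a.L l = B) : a.obj ⟶ A ⊗ B :=
  a.μ k l hk hl h ≫ (eqToHom hA ⊗ₘ eqToHom hB)

/-- The conditions on a level, relative to the lower ones. -/
structure Level.Good (n : ℕ) (a : Level G n) (hist : ∀ k, k < n → Level G k) : Prop where
  eq (k : ℕ) (hk : k < n) : a.L k = (hist k hk).obj
  -- An equality of objects, since `Good` is a proposition and cannot store an isomorphism. In
  -- `nonempty_limitTower` it is converted into one.
  unit (h : n = 0) : ∃ e : a.obj = 𝟙_ W,
    a.p = eqToHom e ≫ lone G ≫ eqToHom (congrArg (fun i => G.obj (op (Nec.simplex i))) h.symm)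
  mul (k l : ℕ) (hk : 0 < k) (hl : 0 < l) (h : n = k + l) :
    a.cm k l hk hl h (eq k (by omega)) (eq l (by omega)) ≫ ((hist k (by omega)).p ⊗ₘ
      (hist l (by omega)).p) ≫ lmul G (Nec.simplex k) (Nec.simplex l) =
        a.p ≫ lmap G (Nec.inert k l n h)
  -- The history alone does not record that lower levels use the actual lower objects as their `L`.
  -- This enters as the argument `E`, supplied when the whole sequence is available.
  coassoc (E : ∀ m hm k (hk : k < m), (hist m hm).L k = (hist k (hk.trans hm)).obj)
    (r s t : ℕ) (hr : 0 < r) (hs : 0 < s) (ht : 0 < t) (h : n = r + s + t) :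
    a.cm r (s + t) hr (by omega) (by omega) (eq r (by omega)) (eq (s + t) (by omega)) ≫
      (hist r (by omega)).obj ◁ (hist (s + t) (by omega)).cm s t hs ht rfl
        (E _ _ s (by omega)) (E _ _ t (by omega)) =
      a.cm (r + s) t (by omega) ht h (eq (r + s) (by omega)) (eq t (by omega)) ≫
        (hist (r + s) (by omega)).cm r s hr hs rfl
          (E _ _ r (by omega)) (E _ _ s (by omega)) ▷ (hist t (by omega)).obj ≫ (α_ _ _ _).hom
  limit (E : ∀ m hm k (hk : k < m), (hist m hm).L k = (hist k (hk.trans hm)).obj)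
    (hn : 0 < n) (Q : W) (fst : Q ⟶ G.obj (op (Nec.simplex n)))
    (snd : ∀ (k l : ℕ) (hk : 0 < k) (hl : 0 < l) (h : n = k + l),
      Q ⟶ (hist k (by omega)).obj ⊗ (hist l (by omega)).obj) :
    (∀ (k l : ℕ) (hk : 0 < k) (hl : 0 < l) (h : n = k + l),
      snd k l hk hl h ≫ ((hist k (by omega)).p ⊗ₘ (hist l (by omega)).p) ≫
        lmul G (Nec.simplex k) (Nec.simplex l) = fst ≫ lmap G (Nec.inert k l n h)) →
    (∀ (r s t : ℕ) (hr : 0 < r) (hs : 0 < s) (ht : 0 < t) (h : n = r + s + t),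
      snd r (s + t) hr (by omega) (by omega) ≫
        (hist r (by omega)).obj ◁ (hist (s + t) (by omega)).cm s t hs ht rfl
          (E _ _ s (by omega)) (E _ _ t (by omega)) =
        snd (r + s) t (by omega) ht h ≫ (hist (r + s) (by omega)).cm r s hr hs rfl
          (E _ _ r (by omega)) (E _ _ s (by omega)) ▷ (hist t (by omega)).obj ≫ (α_ _ _ _).hom) →
    ∃! z : Q ⟶ a.obj, z ≫ a.p = fst ∧
      ∀ (k l : ℕ) (hk : 0 < k) (hl : 0 < l) (h : n = k + l),
        z ≫ a.cm k l hk hl h (eq k (by omega)) (eq l (by omega)) = snd k l hk hl h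

/-- Degree `0` is the unit object with the unit of `G`. In positive degree the diagram involves only
objects and comultiplications of lower degree, and its limit is the new level. -/
lemma Level.exists_good (hW : HasGenEqualizers W) (n : ℕ) (hist : ∀ k, k < n → Level G k)
    (hh : ∀ k hk, Level.Good k (hist k hk) (fun j hj => hist j (hj.trans hk))) :
    ∃ a, Level.Good n a hist := by
  rcases Nat.eq_zero_or_pos n with rfl | hn
  · refine ⟨⟨𝟙_ W, lone G, fun _ => 𝟙_ W, fun k l hk hl h => by omega⟩, ?_⟩
    exact
      { eq := fun k hk => by omega
        unit := fun h => ⟨rfl, by simp⟩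
        mul := fun k l hk hl h => by omega
        coassoc := fun E r s t hr hs ht h => by omega
        limit := fun E hn => by omega }
  · have E : ∀ m hm k (hk : k < m), (hist m hm).L k = (hist k (hk.trans hm)).obj :=
      fun m hm k hk => (hh m hm).eq k hk
    obtain ⟨L, p, π, h₁, h₂, h₃⟩ := hW.exists_limit (n := n) (E := G.obj (op (Nec.simplex n)))
      (A := fun c => (hist c.k (by have := c.h; have := c.hl; omega)).obj ⊗
        (hist c.l (by have := c.h; have := c.hk; omega)).obj)
      (fun c => lmap G (Nec.inert c.k c.l n c.h))
      (fun c => ((hist c.k (by have := c.h; have := c.hl; omega)).p ⊗ₘ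
        (hist c.l (by have := c.h; have := c.hk; omega)).p) ≫
          lmul G (Nec.simplex c.k) (Nec.simplex c.l))
      (D := fun c => (hist c.r (by have := c.h; have := c.hs; omega)).obj ⊗
        ((hist c.s (by have := c.h; have := c.hr; omega)).obj ⊗
          (hist c.t (by have := c.h; have := c.hr; omega)).obj))
      (fun c => (hist c.r (by have := c.h; have := c.hs; omega)).obj ◁
        (hist (c.s + c.t) (by have := c.h; have := c.hr; omega)).cm c.s c.t c.hs c.ht rfl
          (E _ _ c.s (by have := c.ht; omega)) (E _ _ c.t (by have := c.hs; omega)))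
      (fun c => (hist (c.r + c.s) (by have := c.h; have := c.ht; omega)).cm c.r c.s c.hr c.hs rfl
          (E _ _ c.r (by have := c.hs; omega)) (E _ _ c.s (by have := c.hr; omega)) ▷
            (hist c.t (by have := c.h; have := c.hr; omega)).obj ≫ (α_ _ _ _).hom)
    -- A level stores a total family of objects. The value from `n` on is arbitrary: the summands of
    -- a positive decomposition of `n` are smaller than `n`.
    let M : ℕ → W := fun k => if h : k < n then (hist k h).obj else 𝟙_ W
    have eM : ∀ k (hk : k < n), M k = (hist k hk).obj := fun k hk => dif_pos hk
    let a : Level G n := ⟨L, p, M, fun k l hk hl h => π ⟨k, l, hk, hl, h⟩ ≫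
      (eqToHom (eM k (by omega)).symm ⊗ₘ eqToHom (eM l (by omega)).symm)⟩
    have ha : ∀ (k l : ℕ) (hk : 0 < k) (hl : 0 < l) (h : n = k + l),
        a.cm k l hk hl h (eM k (by omega)) (eM l (by omega)) = π ⟨k, l, hk, hl, h⟩ :=
      fun k l hk hl h => by simp [Level.cm, a]
    refine ⟨a, ?_⟩
    exact
      { eq := eM
        unit := fun h => by omega
        mul := fun k l hk hl h => by
          rw [ha]
          exact h₁ ⟨k, l, hk, hl, h⟩
        coassoc := fun _ r s t hr hs ht h => by
          rw [ha, ha]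
          exact h₂ ⟨r, s, t, hr, hs, ht, h⟩
        limit := fun _ _ Q fst snd e₁ e₂ => by
          obtain ⟨z, ⟨hz, hz'⟩, hu⟩ := h₃ Q fst (fun c => snd c.k c.l c.hk c.hl c.h)
            (fun c => e₁ c.k c.l c.hk c.hl c.h) (fun c => e₂ c.r c.s c.t c.hr c.hs c.ht c.h)
          refine ⟨z, ⟨hz, fun k l hk hl h => ?_⟩, fun y hy => hu y ⟨hy.1, fun c => ?_⟩⟩
          · rw [ha]
            exact hz' ⟨k, l, hk, hl, h⟩
          · rw [← ha]
            exact hy.2 c.k c.l c.hk c.hl c.h }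

lemma nonempty_limitTower (hW : HasGenEqualizers W) : Nonempty (LimitTower G) := by
  obtain ⟨a, ha⟩ := exists_strong_rec (A := Level G) Level.Good (Level.exists_good hW)
  obtain ⟨e, he⟩ := (ha 0).unit rfl
  exact ⟨{
    X := fun n => (a n).obj
    e := eqToIso e
    p := fun n => (a n).p
    μ := fun k l n hk hl h => (a n).cm k l hk hl h ((ha n).eq k (by omega)) ((ha n).eq l (by omega))
    unit := he.trans (by simp)
    mul := fun k l n hk hl h => (ha n).mul k l hk hl h
    coassoc := fun r s t n hr hs ht h =>
      (ha n).coassoc (fun m _ k hk => (ha m).eq k hk) r s t hr hs ht h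
    limit := fun n hn => (ha n).limit (fun m _ k hk => (ha m).eq k hk) hn }⟩

end Neck

/-! ### Uniqueness and composition of sum decompositions -/

namespace FInt

/-- The first of three facts showing that a decomposition of `f` as a sum is determined by the cut
point `a`. A condition on all decompositions thus needs to be checked only for `segL` and `segR`. -/
lemma IsSum.fn_eq {m n a b a' b' : ℕ} {f : (⟨m⟩ : FInt) ⟶ ⟨n⟩} {f₁ : (⟨a⟩ : FInt) ⟶ ⟨a'⟩}
    {f₂ : (⟨b⟩ : FInt) ⟶ ⟨b'⟩} (h : m = a + b) (hf : IsSum f f₁ f₂) : fn f a = a' := by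
  rw [hf a (by omega), Nat.sub_self, fn_zero, fn_last f₁ le_rfl, add_zero]

lemma IsSum.eq_segL {m n a b b' : ℕ} {f : (⟨m⟩ : FInt) ⟶ ⟨n⟩} {f₁ : (⟨a⟩ : FInt) ⟶ ⟨fn f a⟩}
    {f₂ : (⟨b⟩ : FInt) ⟶ ⟨b'⟩} (h : m = a + b) (hf : IsSum f f₁ f₂) : f₁ = segL f a :=
  hom_ext fun i hi => by
    replace hi : i ≤ a := hi
    rw [fn_segL f hi, hf i (by omega), Nat.sub_eq_zero_of_le hi, fn_zero, add_zero]

lemma IsSum.eq_segR {m n a b : ℕ} {f : (⟨m⟩ : FInt) ⟶ ⟨n⟩} {f₁ : (⟨a⟩ : FInt) ⟶ ⟨fn f a⟩}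
    {f₂ : (⟨b⟩ : FInt) ⟶ ⟨n - fn f a⟩} (h : m = a + b) (hf : IsSum f f₁ f₂) :
    f₂ = segR f a b h :=
  hom_ext fun i hi => by
    replace hi : i ≤ b := hi
    rw [fn_segR f h hi, hf (a + i) (by omega), fn_last f₁ (by simp), Nat.add_sub_cancel_left]
    simp

/-- The restriction of a map of intervals to a middle segment. -/
def segM {m n : ℕ} (f : (⟨m⟩ : FInt) ⟶ ⟨n⟩) (r s : ℕ) :
    (⟨s⟩ : FInt) ⟶ ⟨fn f (r + s) - fn f r⟩ :=
  homMk (fun i => fn f (r + i) - fn f r) (Nat.sub_self _) rfl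
    fun _ _ h _ => Nat.sub_le_sub_right (fn_mono f (Nat.add_le_add_left h r)) _

lemma fn_segM {m n : ℕ} (f : (⟨m⟩ : FInt) ⟶ ⟨n⟩) {r s i : ℕ} (hi : i ≤ s) :
    fn (segM f r s) i = fn f (r + i) - fn f r :=
  fn_homMk (m := ⟨s⟩) (fun i => fn f (r + i) - fn f r) _ _ _ hi

/-- Here and in `isSum_segR` the same middle piece `segM f r s` appears. This common refinement is
behind the coassociativity of the cone in `GoodMap.exists_good`. -/
lemma isSum_segL {m n : ℕ} (f : (⟨m⟩ : FInt) ⟶ ⟨n⟩) (r s : ℕ) :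
    IsSum (segL f (r + s)) (segL f r) (segM f r s) := fun i hi => by
  by_cases hir : i ≤ r
  · rw [Nat.sub_eq_zero_of_le hir, fn_zero, fn_segL f hir, fn_segL f hi, add_zero]
  · have := fn_mono f (show r ≤ i by omega)
    rw [fn_last (segL f r) (by simp only; omega), fn_segL f hi, fn_segM f (by omega),
      show r + (i - r) = i by omega]
    simp only
    omega

lemma isSum_segR {m n : ℕ} (f : (⟨m⟩ : FInt) ⟶ ⟨n⟩) (r s t : ℕ) (h : m = r + (s + t))
    (h' : m = r + s + t) :
    IsSum (segR f r (s + t) h) (segM f r s) (segR f (r + s) t h') := fun i hi => by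
  rw [fn_segR f h hi]
  by_cases his : i ≤ s
  · rw [Nat.sub_eq_zero_of_le his, fn_zero, fn_segM f his, add_zero]
  · have h1 := fn_mono f (show r ≤ r + s by omega)
    have h2 := fn_mono f (show r + s ≤ r + i by omega)
    rw [fn_last (segM f r s) (by simp only; omega), fn_segR f h' (by omega),
      show r + s + (i - s) = r + i by omega]
    simp only
    omega

lemma IsSum.id {m a b : ℕ} (h : m = a + b) :
    IsSum (𝟙 (⟨m⟩ : FInt)) (𝟙 (⟨a⟩ : FInt)) (𝟙 (⟨b⟩ : FInt)) := fun i hi => by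
  simp only [fn_id]
  omega

lemma IsSum.comp {m n k a b a' b' a'' b'' : ℕ} {f : (⟨m⟩ : FInt) ⟶ ⟨n⟩} {f₁ : (⟨a⟩ : FInt) ⟶ ⟨a'⟩}
    {f₂ : (⟨b⟩ : FInt) ⟶ ⟨b'⟩} {g : (⟨n⟩ : FInt) ⟶ ⟨k⟩} {g₁ : (⟨a'⟩ : FInt) ⟶ ⟨a''⟩}
    {g₂ : (⟨b'⟩ : FInt) ⟶ ⟨b''⟩} (hf : IsSum f f₁ f₂) (hg : IsSum g g₁ g₂) :
    IsSum (f ≫ g) (f₁ ≫ g₁) (f₂ ≫ g₂) := fun i hi => by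
  rw [fn_comp, fn_comp, fn_comp, hg _ (fn_le' f i), hf i hi]
  by_cases h : i ≤ a
  · have := fn_le' f₁ i
    rw [Nat.sub_eq_zero_of_le h, fn_zero, add_zero, fn_zero, Nat.sub_eq_zero_of_le this, fn_zero]
  · rw [fn_last f₁ (show a ≤ i by omega)]
    simp only
    rw [fn_last g₁ (Nat.le_add_right _ _), fn_last g₁ le_rfl, Nat.add_sub_cancel_left]

end FInt

/-! ### Degenerate comultiplications; actions of interval maps -/

namespace Neck.LimitTower

variable {W : Type u} [Category.{v} W] [MonoidalCategory W] {G : Necᵒᵖ ⥤ W} [G.LaxMonoidal]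
  (D : LimitTower G)

/-- The comultiplications, including the degenerate ones. -/
def cm : ∀ k l n : ℕ, n = k + l → (D.X n ⟶ D.X k ⊗ D.X l)
  | 0, l, n, h => eqToHom (congrArg D.X (h.trans (Nat.zero_add l))) ≫ (λ_ _).inv ≫ D.e.inv ▷ D.X l
  | k + 1, 0, n, h => eqToHom (congrArg D.X h) ≫ (ρ_ _).inv ≫ D.X (k + 1) ◁ D.e.inv
  | k + 1, l + 1, n, h => D.μ (k + 1) (l + 1) n (Nat.succ_pos k) (Nat.succ_pos l) h

lemma cm_pos {k l n : ℕ} (hk : 0 < k) (hl : 0 < l) (h : n = k + l) :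
    D.cm k l n h = D.μ k l n hk hl h := by
  obtain ⟨k, rfl⟩ := Nat.exists_eq_succ_of_ne_zero hk.ne'
  obtain ⟨l, rfl⟩ := Nat.exists_eq_succ_of_ne_zero hl.ne'
  rfl

lemma cm_left (n : ℕ) (h : n = 0 + n) : D.cm 0 n n h = (λ_ _).inv ≫ D.e.inv ▷ D.X n :=
  (congrArg (fun t => t ≫ (λ_ _).inv ≫ D.e.inv ▷ D.X n) (eqToHom_refl _ _)).trans
    (Category.id_comp _)

/-- The degenerate formulas for `0 + n` and for `n + 0` must agree when `n = 0`. They do because the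
left and right unitors of the unit object coincide. -/
lemma coh_units {A : W} (e : A ≅ 𝟙_ W) :
    (λ_ A).inv ≫ e.inv ▷ A = (ρ_ A).inv ≫ A ◁ e.inv := by
  have h : (λ_ A).inv ≫ e.inv ▷ A = e.hom ≫ (λ_ _).inv ≫ (e.inv ⊗ₘ e.inv) := by
    rw [MonoidalCategory.tensorHom_def', ← leftUnitor_inv_naturality_assoc, e.hom_inv_id_assoc]
  have h' : (ρ_ A).inv ≫ A ◁ e.inv = e.hom ≫ (ρ_ _).inv ≫ (e.inv ⊗ₘ e.inv) := by
    rw [MonoidalCategory.tensorHom_def, ← rightUnitor_inv_naturality_assoc, e.hom_inv_id_assoc]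
  rw [h, h', unitors_inv_equal]

lemma cm_right (n : ℕ) (h : n = n + 0) : D.cm n 0 n h = (ρ_ _).inv ≫ D.X n ◁ D.e.inv := by
  cases n with
  | zero => rw [cm_left, coh_units]
  | succ n =>
    exact (congrArg (fun t => t ≫ (ρ_ _).inv ≫ D.X (n + 1) ◁ D.e.inv) (eqToHom_refl _ _)).trans
      (Category.id_comp _)

lemma coh_assoc_left {A B C E : W} (u : 𝟙_ W ⟶ E) (f : A ⟶ B ⊗ C) :
    ((λ_ A).inv ≫ u ▷ A) ≫ E ◁ f = f ≫ ((λ_ B).inv ≫ u ▷ B) ▷ C ≫ (α_ _ _ _).hom := by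
  rw [Category.assoc, ← whisker_exchange, ← leftUnitor_inv_naturality_assoc]
  simp

lemma coh_assoc_mid {B C E : W} (u : 𝟙_ W ⟶ E) :
    B ◁ ((λ_ C).inv ≫ u ▷ C) = ((ρ_ B).inv ≫ B ◁ u) ▷ C ≫ (α_ _ _ _).hom := by
  simp

lemma coh_assoc_right {A B C E : W} (u : 𝟙_ W ⟶ E) (f : A ⟶ B ⊗ C) :
    f ≫ B ◁ ((ρ_ C).inv ≫ C ◁ u) = ((ρ_ A).inv ≫ A ◁ u) ≫ f ▷ E ≫ (α_ _ _ _).hom := by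
  rw [Category.assoc, whisker_exchange_assoc, ← rightUnitor_inv_naturality_assoc]
  simp

/-- Coassociativity in the tower covers positive summands only. If one summand is zero, the identity
is a naturality or coherence property of the unitors. -/
lemma cm_assoc {a b c ab bc n : ℕ} (h₁ : n = ab + c) (h₂ : ab = a + b) (h₃ : n = a + bc)
    (h₄ : bc = b + c) :
    D.cm a bc n h₃ ≫ D.X a ◁ D.cm b c bc h₄ =
      D.cm ab c n h₁ ≫ D.cm a b ab h₂ ▷ D.X c ≫ (α_ _ _ _).hom := by
  rcases Nat.eq_zero_or_pos a with rfl | ha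
  · obtain rfl : bc = n := by omega
    obtain rfl : ab = b := by omega
    rw [cm_left, cm_left]
    exact coh_assoc_left _ _
  rcases Nat.eq_zero_or_pos b with rfl | hb
  · obtain rfl : bc = c := by omega
    obtain rfl : ab = a := by omega
    rw [cm_left, cm_right, coh_assoc_mid]
  rcases Nat.eq_zero_or_pos c with rfl | hc
  · obtain rfl : bc = b := by omega
    obtain rfl : ab = n := by omega
    rw [cm_right, cm_right]
    exact coh_assoc_right _ _
  subst h₂ h₄
  rw [cm_pos D ha (by omega), cm_pos D hb hc, cm_pos D (by omega) hc, cm_pos D ha hb]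
  exact D.coassoc a b c n ha hb hc h₁

lemma e_inv_p : D.e.inv ≫ D.p 0 = lone G := by
  rw [D.unit, Iso.inv_hom_id_assoc]

lemma cm_mul (k l n : ℕ) (h : n = k + l) :
    D.cm k l n h ≫ (D.p k ⊗ₘ D.p l) ≫ lmul G (Nec.simplex k) (Nec.simplex l) =
      D.p n ≫ lmap G (Nec.inert k l n h) := by
  rcases Nat.eq_zero_or_pos k with rfl | hk
  · obtain rfl : n = l := by omega
    rw [cm_left, MonoidalCategory.tensorHom_def, Category.assoc, Category.assoc,
      ← comp_whiskerRight_assoc, D.e_inv_p, ← whisker_exchange_assoc, lmul_left,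
      ← leftUnitor_inv_naturality_assoc, Iso.inv_hom_id_assoc]
    refine congrArg (fun t => D.p n ≫ lmap G t) (Nec.hom_ext fun i hi => ?_)
    rw [Nec.fn_leftMap, Nec.fn_inert, Nec.len_simplex]
  · rcases Nat.eq_zero_or_pos l with rfl | hl
    · obtain rfl : n = k := by omega
      rw [cm_right, MonoidalCategory.tensorHom_def', Category.assoc, Category.assoc,
        ← MonoidalCategory.whiskerLeft_comp_assoc, D.e_inv_p, whisker_exchange_assoc, lmul_right,
        ← rightUnitor_inv_naturality_assoc, Iso.inv_hom_id_assoc]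
      refine congrArg (fun t => D.p n ≫ lmap G t) (Nec.hom_ext fun i hi => ?_)
      rw [Nec.fn_rightMap, Nec.fn_inert, Nec.len_simplex]
    · rw [cm_pos D hk hl]
      exact D.mul k l n hk hl h

lemma hom_ext {n : ℕ} (hn : 0 < n) {Q : W} {z z' : Q ⟶ D.X n} (h₁ : z ≫ D.p n = z' ≫ D.p n)
    (h₂ : ∀ (k l : ℕ) (hk : 0 < k) (hl : 0 < l) (h : n = k + l),
      z ≫ D.cm k l n h = z' ≫ D.cm k l n h) : z = z' := by
  obtain ⟨y, _, hy⟩ := D.limit n hn Q (z ≫ D.p n) (fun k l hk hl h => z ≫ D.μ k l n hk hl h)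
    (fun k l hk hl h => by rw [Category.assoc, Category.assoc, D.mul])
    (fun r s t hr hs ht h => by rw [Category.assoc, Category.assoc, D.coassoc])
  rw [hy z ⟨rfl, fun _ _ _ _ _ => rfl⟩, hy z' ⟨h₁.symm, fun k l hk hl h => ?_⟩]
  rw [← cm_pos D hk hl h, h₂ k l hk hl h]

/-- The condition on the action of the maps out of `[m]`, relative to that of maps out of shorter
intervals. -/
structure GoodMap (m : ℕ) (φ : ∀ n, ((⟨m⟩ : FInt) ⟶ ⟨n⟩) → (D.X n ⟶ D.X m))
    (hist : ∀ k, k < m → ∀ n, ((⟨k⟩ : FInt) ⟶ ⟨n⟩) → (D.X n ⟶ D.X k)) : Prop where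
  zero (h : m = 0) (n : ℕ) (f : (⟨m⟩ : FInt) ⟶ ⟨n⟩) (e : n = m) : φ n f = eqToHom (congrArg D.X e)
  p (n : ℕ) (f : (⟨m⟩ : FInt) ⟶ ⟨n⟩) : φ n f ≫ D.p m = D.p n ≫ lmap G (Nec.simplexMap f)
  -- Only `k` and `l` are positive: `k'` or `l'` vanishes when `f` collapses a segment, hence `D.cm`
  -- instead of `D.μ` on the target side.
  cm (n : ℕ) (f : (⟨m⟩ : FInt) ⟶ ⟨n⟩) (k l k' l' : ℕ) (hk : 0 < k) (hl : 0 < l) (h : m = k + l)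
    (h' : n = k' + l') (f₁ : (⟨k⟩ : FInt) ⟶ ⟨k'⟩) (f₂ : (⟨l⟩ : FInt) ⟶ ⟨l'⟩)
    (hf : FInt.IsSum f f₁ f₂) :
    φ n f ≫ D.cm k l m h =
      D.cm k' l' n h' ≫ (hist k (by omega) k' f₁ ⊗ₘ hist l (by omega) l' f₂)

lemma simplexMap_inert {m n k l k' l' : ℕ} (f : (⟨m⟩ : FInt) ⟶ ⟨n⟩) (h : m = k + l)
    (h' : n = k' + l') (f₁ : (⟨k⟩ : FInt) ⟶ ⟨k'⟩) (f₂ : (⟨l⟩ : FInt) ⟶ ⟨l'⟩)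
    (hf : FInt.IsSum f f₁ f₂) :
    lmap G (Nec.inert k' l' n h') ≫ lmap G (Nec.simplexMap f₁ ⊗ₘ Nec.simplexMap f₂) =
      lmap G (Nec.simplexMap f) ≫ lmap G (Nec.inert k l m h) := by
  rw [← lmap_comp, ← lmap_comp]
  refine congrArg (fun t => lmap G t) (Nec.hom_ext fun i hi => ?_)
  rw [Nec.len_tensor, Nec.len_simplex, Nec.len_simplex] at hi
  have h1 := FInt.fn_le' f i
  have h2 := hf i (by omega)
  rw [Nec.fn_comp, Nec.fn_comp, Nec.fn_tensorHom, Nec.fn_simplexMap, Nec.fn_simplexMap,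
    Nec.fn_simplexMap, Nec.fn_inert, Nec.fn_inert, Nec.len_simplex, min_eq_left (by omega),
    min_eq_left (by omega), h2]

variable {D}

/-- The first compatibility of the cone defining the action of `f`. It rests on the square formed by
`f`, `f₁ ∨ f₂` and the two inert maps, which commutes on vertices. -/
lemma GoodMap.cm_p {k l k' l' m n : ℕ} (f : (⟨m⟩ : FInt) ⟶ ⟨n⟩) (h : m = k + l) (h' : n = k' + l')
    (f₁ : (⟨k⟩ : FInt) ⟶ ⟨k'⟩) (f₂ : (⟨l⟩ : FInt) ⟶ ⟨l'⟩) (hf : FInt.IsSum f f₁ f₂)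
    {z₁ : D.X k' ⟶ D.X k} {z₂ : D.X l' ⟶ D.X l}
    (e₁ : z₁ ≫ D.p k = D.p k' ≫ lmap G (Nec.simplexMap f₁))
    (e₂ : z₂ ≫ D.p l = D.p l' ≫ lmap G (Nec.simplexMap f₂)) :
    (D.cm k' l' n h' ≫ (z₁ ⊗ₘ z₂)) ≫ (D.p k ⊗ₘ D.p l) ≫
      lmul G (Nec.simplex k) (Nec.simplex l) =
        (D.p n ≫ lmap G (Nec.simplexMap f)) ≫ lmap G (Nec.inert k l m h) := by
  rw [Category.assoc, tensorHom_comp_tensorHom_assoc, e₁, e₂, ← tensorHom_comp_tensorHom_assoc,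
    lmul_nat, reassoc_of% (D.cm_mul k' l' n h'), simplexMap_inert f h h' f₁ f₂ hf, Category.assoc]

lemma coh_whisker_left {A B C A' B' C' E E' F : W} {c : E ⟶ A ⊗ F} {z : A ⟶ A'} {g : F ⟶ E'}
    {d : E' ⟶ B' ⊗ C'} {d' : F ⟶ B ⊗ C} {y : B ⟶ B'} {x : C ⟶ C'} (h : g ≫ d = d' ≫ (y ⊗ₘ x)) :
    (c ≫ (z ⊗ₘ g)) ≫ A' ◁ d = (c ≫ A ◁ d') ≫ (z ⊗ₘ (y ⊗ₘ x)) := by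
  simp only [← id_tensorHom, Category.assoc, tensorHom_comp_tensorHom, h, Category.id_comp,
    Category.comp_id]

lemma coh_whisker_right {A B C A' B' C' E E' F : W} {c : E ⟶ F ⊗ A} {z : A ⟶ A'} {g : F ⟶ E'}
    {d : E' ⟶ B' ⊗ C'} {d' : F ⟶ B ⊗ C} {y : B ⟶ B'} {x : C ⟶ C'} (h : g ≫ d = d' ≫ (y ⊗ₘ x)) :
    (c ≫ (g ⊗ₘ z)) ≫ d ▷ A' ≫ (α_ _ _ _).hom =
      (c ≫ d' ▷ A ≫ (α_ _ _ _).hom) ≫ (y ⊗ₘ (x ⊗ₘ z)) := by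
  simp only [Category.assoc, ← associator_naturality]
  simp only [← tensorHom_id, tensorHom_comp_tensorHom_assoc, h, Category.id_comp,
    Category.comp_id]

/-- The action of `f` is induced by the cone with first leg `p_n` followed by `G(f)`, whose leg at
`(k, l)` is the comultiplication of `X_n` at `f k` followed by the actions of the two restrictions
of `f`. Coassociativity follows by cutting `f` into three pieces at `r` and `r + s`. -/
lemma GoodMap.exists_good (m : ℕ)
    (hist : ∀ k, k < m → ∀ n, ((⟨k⟩ : FInt) ⟶ ⟨n⟩) → (D.X n ⟶ D.X k))
    (hh : ∀ k hk, GoodMap D k (hist k hk) (fun j hj => hist j (hj.trans hk))) :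
    ∃ φ, GoodMap D m φ hist := by
  rcases Nat.eq_zero_or_pos m with rfl | hm
  · refine ⟨fun n f => eqToHom (congrArg D.X (FInt.eq_zero_of_hom f)), fun _ _ _ _ => rfl,
      fun n f => ?_, fun n f k l k' l' hk hl h => by omega⟩
    obtain rfl := FInt.eq_zero_of_hom f
    obtain rfl := FInt.hom_zero_eq f
    rw [Nec.simplexMap_id, lmap_id, eqToHom_refl, Category.id_comp, Category.comp_id]
  · have key : ∀ n (f : (⟨m⟩ : FInt) ⟶ ⟨n⟩), ∃ z : D.X n ⟶ D.X m,
        z ≫ D.p m = D.p n ≫ lmap G (Nec.simplexMap f) ∧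
        ∀ (k l : ℕ) (hk : 0 < k) (hl : 0 < l) (h : m = k + l), z ≫ D.μ k l m hk hl h =
          D.cm (FInt.fn f k) (n - FInt.fn f k) n (Nat.add_sub_cancel' (FInt.fn_le' f k)).symm ≫
            (hist k (by omega) _ (FInt.segL f k) ⊗ₘ hist l (by omega) _ (FInt.segR f k l h)) := by
      intro n f
      refine (D.limit m hm _ _ _ (fun k l hk hl h => ?_) (fun r s t hr hs ht h => ?_)).exists
      · exact GoodMap.cm_p f h _ _ _ (FInt.isSum_seg f k l h) ((hh k (by omega)).p _ _)
          ((hh l (by omega)).p _ _)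
      · have h1 := FInt.fn_mono f (show r ≤ r + s by omega)
        have h2 := FInt.fn_le' f (r + s)
        have e₁ := (hh (s + t) (by omega)).cm _ (FInt.segR f r (s + t) (by omega)) s t _ _ hs ht rfl
          (by omega) _ _ (FInt.isSum_segR f r s t (by omega) h)
        have e₂ := (hh (r + s) (by omega)).cm _ (FInt.segL f (r + s)) r s _ _ hr hs rfl
          (by omega) _ _ (FInt.isSum_segL f r s)
        rw [cm_pos D hs ht] at e₁
        rw [cm_pos D hr hs] at e₂
        rw [coh_whisker_left e₁, coh_whisker_right e₂, cm_assoc]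
    choose φ hφ hφ' using key
    refine ⟨φ, fun h => by omega, hφ, fun n f k l k' l' hk hl h h' f₁ f₂ hf => ?_⟩
    -- An arbitrary decomposition is the one at the cut point `k`, for which the limit gives the
    -- equation.
    obtain rfl := hf.fn_eq h
    obtain rfl : l' = n - FInt.fn f k := by omega
    obtain rfl := hf.eq_segL h
    obtain rfl := hf.eq_segR h
    rw [cm_pos D hk hl]
    exact hφ' n f k l hk hl h

end Neck.LimitTower

/-! ### Functoriality and the colax structure -/

namespace Neck.LimitTower

variable {W : Type u} [Category.{v} W] [MonoidalCategory W] {G : Necᵒᵖ ⥤ W} [G.LaxMonoidal]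
  (D : LimitTower G)

lemma exists_action : ∃ φ : ∀ m n, ((⟨m⟩ : FInt) ⟶ ⟨n⟩) → (D.X n ⟶ D.X m),
    ∀ m, D.GoodMap m (φ m) (fun k _ => φ k) :=
  exists_strong_rec (A := fun m => ∀ n, ((⟨m⟩ : FInt) ⟶ ⟨n⟩) → (D.X n ⟶ D.X m)) (D.GoodMap)
    GoodMap.exists_good

/-- The action `X_n → X_m` of a map of intervals `[m] → [n]`. -/
def act {m n : ℕ} (f : (⟨m⟩ : FInt) ⟶ ⟨n⟩) : D.X n ⟶ D.X m := D.exists_action.choose m n f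

lemma act_zero (f : (⟨0⟩ : FInt) ⟶ ⟨0⟩) : D.act f = 𝟙 _ :=
  (D.exists_action.choose_spec 0).zero rfl 0 f rfl

lemma act_p {m n : ℕ} (f : (⟨m⟩ : FInt) ⟶ ⟨n⟩) :
    D.act f ≫ D.p m = D.p n ≫ lmap G (Nec.simplexMap f) :=
  (D.exists_action.choose_spec m).p n f

/-- Naturality of the comultiplications for all indices. If `k = 0`, then `f₁` is the identity of
`[0]` and `f` coincides with `f₂`, so naturality of the unitor suffices; the case `l = 0` is
symmetric. -/
lemma act_cm {m n k l k' l' : ℕ} (f : (⟨m⟩ : FInt) ⟶ ⟨n⟩) (h : m = k + l) (h' : n = k' + l')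
    (f₁ : (⟨k⟩ : FInt) ⟶ ⟨k'⟩) (f₂ : (⟨l⟩ : FInt) ⟶ ⟨l'⟩) (hf : FInt.IsSum f f₁ f₂) :
    D.act f ≫ D.cm k l m h = D.cm k' l' n h' ≫ (D.act f₁ ⊗ₘ D.act f₂) := by
  rcases Nat.eq_zero_or_pos k with rfl | hk
  · obtain rfl := FInt.eq_zero_of_hom f₁
    obtain rfl : m = l := by omega
    obtain rfl : n = l' := by omega
    obtain rfl : f = f₂ := FInt.hom_ext fun i hi => by
      rw [hf i hi, FInt.fn_last f₁ (Nat.zero_le _), Nat.sub_zero]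
      exact Nat.zero_add _
    rw [act_zero, id_tensorHom, cm_left, cm_left, Category.assoc, ← whisker_exchange,
      leftUnitor_inv_naturality_assoc]
  · rcases Nat.eq_zero_or_pos l with rfl | hl
    · obtain rfl := FInt.eq_zero_of_hom f₂
      obtain rfl : m = k := by omega
      obtain rfl : n = k' := by omega
      obtain rfl : f = f₁ := FInt.hom_ext fun i hi => by
        rw [hf i hi, FInt.fn_last f₂ (Nat.zero_le _)]
        exact Nat.add_zero _
      rw [act_zero, tensorHom_id, cm_right, cm_right, Category.assoc, whisker_exchange,
        rightUnitor_inv_naturality_assoc]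
    · exact (D.exists_action.choose_spec m).cm n f k l k' l' hk hl h h' f₁ f₂ hf

lemma act_id (m : ℕ) : D.act (𝟙 (⟨m⟩ : FInt)) = 𝟙 _ := by
  induction m using Nat.strong_induction_on with
  | _ m ih =>
    rcases Nat.eq_zero_or_pos m with rfl | hm
    · exact D.act_zero _
    · refine D.hom_ext hm ?_ fun k l hk hl h => ?_
      · rw [act_p, Nec.simplexMap_id, lmap_id, Category.comp_id, Category.id_comp]
      · rw [D.act_cm _ h h _ _ (FInt.IsSum.id h), ih k (by omega), ih l (by omega),
          id_tensorHom_id, Category.comp_id, Category.id_comp]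

/-- As for identities, both sides solve the same limit problem: they agree after `p`, and after the
comultiplications by induction, since sum decompositions compose. -/
lemma act_comp {m n k : ℕ} (f : (⟨m⟩ : FInt) ⟶ ⟨n⟩) (g : (⟨n⟩ : FInt) ⟶ ⟨k⟩) :
    D.act (f ≫ g) = D.act g ≫ D.act f := by
  induction m using Nat.strong_induction_on generalizing n k with
  | _ m ih =>
    rcases Nat.eq_zero_or_pos m with rfl | hm
    · obtain rfl := FInt.eq_zero_of_hom f
      obtain rfl := FInt.eq_zero_of_hom g
      rw [act_zero, act_zero, act_zero, Category.comp_id]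
    · refine D.hom_ext hm ?_ fun a b ha hb h => ?_
      · rw [act_p, Category.assoc, act_p, reassoc_of% (D.act_p g), Nec.simplexMap_comp, lmap_comp]
      · have hn := (Nat.add_sub_cancel' (FInt.fn_le' f a)).symm
        have hk := (Nat.add_sub_cancel' (FInt.fn_le' g (FInt.fn f a))).symm
        have s₁ := FInt.isSum_seg f a b h
        have s₂ := FInt.isSum_seg g _ _ hn
        rw [D.act_cm _ h hk _ _ (s₁.comp s₂), Category.assoc, D.act_cm f h hn _ _ s₁,
          reassoc_of% (D.act_cm g hn hk _ _ s₂), ih a (by omega), ih b (by omega),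
          tensorHom_comp_tensorHom]

/-- The functor on intervals given by a limit tower. -/
def functor : FIntᵒᵖ ⥤ W where
  obj n := D.X n.unop.len
  map f := D.act f.unop
  map_id n := D.act_id n.unop.len
  map_comp f g := D.act_comp g.unop f.unop

/-- The associators and unitors of intervals are identities between equal lengths. Because the total
length of `cm` is a separate index, they are absorbed into it. -/
lemma act_cast_cm {a b n n' : ℕ} (h : n = a + b) (h' : n' = a + b) (e : n' = n) :
    D.act (FInt.cast e : (⟨n'⟩ : FInt) ⟶ ⟨n⟩) ≫ D.cm a b n' h' = D.cm a b n h := by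
  subst e
  rw [FInt.cast_rfl, act_id, Category.id_comp]

lemma act_tensor {m m' n n' : ℕ} (f : (⟨m⟩ : FInt) ⟶ ⟨m'⟩) (g : (⟨n⟩ : FInt) ⟶ ⟨n'⟩) :
    D.cm m' n' (m' + n') rfl ≫ (D.act f ⊗ₘ D.act g) =
      D.act (f ⊗ₘ g : (⟨m + n⟩ : FInt) ⟶ ⟨m' + n'⟩) ≫ D.cm m n (m + n) rfl :=
  (D.act_cm _ rfl rfl f g fun i _ => FInt.fn_tensorHom f g i).symm

/-- The degenerate comultiplications were defined from `X_0 ≅ I` so that the counit laws hold;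
coassociativity is `cm_assoc`, up to the identification of lengths. -/
instance : D.functor.OplaxMonoidal where
  η := D.e.hom
  δ m n := D.cm m.unop.len n.unop.len _ rfl
  δ_natural_left {m m'} f n := by
    have h := D.act_tensor f.unop (𝟙 n.unop)
    rw [act_id, tensorHom_id, tensorHom_id] at h
    exact h
  δ_natural_right {m m'} n f := by
    have h := D.act_tensor (𝟙 n.unop) f.unop
    rw [act_id, id_tensorHom, id_tensorHom] at h
    exact h
  oplax_associativity m n k := by
    have e := Nat.add_assoc m.unop.len n.unop.len k.unop.len
    have h := D.cm_assoc (a := m.unop.len) (b := n.unop.len) (c := k.unop.len) rfl rfl e rfl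
    rw [← D.act_cast_cm e rfl e.symm, Category.assoc] at h
    exact h.symm
  oplax_left_unitality n := by
    have h := D.act_cast_cm (Nat.zero_add n.unop.len).symm rfl (Nat.zero_add _)
    have h' : D.cm 0 n.unop.len n.unop.len (Nat.zero_add _).symm ≫ D.e.hom ▷ D.X n.unop.len =
        (λ_ _).inv := by
      rw [cm_left, Category.assoc, ← comp_whiskerRight, Iso.inv_hom_id, id_whiskerRight,
        Category.comp_id]
    rw [← h, Category.assoc] at h'
    exact h'.symm
  oplax_right_unitality n := by
    have h := D.act_cast_cm (Nat.add_zero n.unop.len).symm rfl (Nat.add_zero _)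
    have h' : D.cm n.unop.len 0 n.unop.len (Nat.add_zero _).symm ≫ D.X n.unop.len ◁ D.e.hom =
        (ρ_ _).inv := by
      rw [cm_right, Category.assoc, ← MonoidalCategory.whiskerLeft_comp, Iso.inv_hom_id,
        MonoidalCategory.whiskerLeft_id, Category.comp_id]
    rw [← h, Category.assoc] at h'
    exact h'.symm

instance : IsIso (Functor.OplaxMonoidal.η D.functor) := inferInstanceAs (IsIso D.e.hom)

lemma comul_functor (k l n : ℕ) (h : n = k + l) : comul D.functor k l n h = D.cm k l n h := by
  subst h
  exact comul_rfl _ _ _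

end Neck.LimitTower

/-! ### Existence of `C^temp` -/

namespace NecCat

open Neck

variable {V : Type u} [Category.{v} V] [MonoidalCategory V] [SymmetricCategory V]
  [MonoidalClosed V] [HasColimits V]

/-- The templicial object given by a limit tower. -/
def tempOfTower {C : NecCat V} (D : LimitTower C.toLax) : C.Temp where
  X := D.functor
  p := D.p
  isTemp :=
    { unit := D.unit
      map := fun f => D.act_p f
      mul := fun k l n hk hl h => by
        rw [D.comul_functor]
        exact D.cm_mul k l n h
      limit := fun n hn Q c => by
        obtain ⟨z, ⟨h₁, h₂⟩, hu⟩ := D.limit n hn Q c.fst c.snd c.mul fun r s t hr hs ht h => by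
          have e := c.coassoc r s t hr hs ht h
          rw [D.comul_functor, D.comul_functor, D.cm_pos hs ht, D.cm_pos hr hs] at e
          exact e
        refine ⟨z, ⟨h₁, fun k l hk hl h => ?_⟩, fun y hy => hu y ⟨hy.1, fun k l hk hl h => ?_⟩⟩
        · rw [D.comul_functor, D.cm_pos hk hl]
          exact h₂ k l hk hl h
        · have e := hy.2 k l hk hl h
          rw [D.comul_functor, D.cm_pos hk hl] at e
          exact e }

lemma nonempty_temp [HasLimits V] (C : NecCat V) : Nonempty C.Temp :=
  (nonempty_limitTower (VQuiv.hasGenEqualizers V C.Obj)).map tempOfTower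

end NecCat

/-! ### The adjunction -/

namespace NecCat

variable {V : Type u} [Category.{v} V] [MonoidalCategory V] [SymmetricCategory V]
  [MonoidalClosed V] [HasColimits V] (temp : ∀ C : NecCat V, C.Temp)

/-- The universal property of `C^temp`. -/
def tempEquiv (Y : Templicial V) (C : NecCat V) :
    ((Templicial.nec V).obj Y ⟶ C) ≃ (Y ⟶ (temp C).toTemplicial) :=
  (Equiv.ofBijective _ ((temp C).bijective Y)).symm

/-- The inverse of the equivalence applies `(-)^nec` and composes with the counit, which is visibly
natural in `Y`. Naturality in `C` is not needed: the action of the right adjoint on morphisms is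
defined by it. -/
lemma tempEquiv_naturality (Y' Y : Templicial V) (C : NecCat V) (f : Y' ⟶ Y)
    (g : (Templicial.nec V).obj Y ⟶ C) :
    tempEquiv temp Y' C ((Templicial.nec V).map f ≫ g) = f ≫ tempEquiv temp Y C g := by
  refine (Equiv.symm_apply_eq _).2 ?_
  have h : (Templicial.nec V).map (tempEquiv temp Y C g) ≫ (temp C).counit = g :=
    (Equiv.ofBijective _ ((temp C).bijective Y)).apply_symm_apply g
  change _ = (Templicial.nec V).map (f ≫ tempEquiv temp Y C g) ≫ (temp C).counit
  rw [Functor.map_comp, Category.assoc, h]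

/-- The functor `(-)^temp`, for a choice of limits. -/
def tempFunctor : NecCat V ⥤ Templicial V :=
  Adjunction.rightAdjointOfEquiv (F := Templicial.nec V) (tempEquiv temp) (tempEquiv_naturality temp)

/-- `(-)^temp` is right adjoint to `(-)^nec`. -/
def tempAdjunction : Templicial.nec V ⊣ tempFunctor temp :=
  Adjunction.adjunctionOfEquivRight (F := Templicial.nec V) (tempEquiv temp)
    (tempEquiv_naturality temp)

end NecCat

end

theorem mainTheorem2 (V : Type u) [Category.{v} V] [MonoidalCategory V] [SymmetricCategory V]
    [MonoidalClosed V] [HasLimits V] [HasColimits V] :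
    (Templicial.nec V).Full ∧ (Templicial.nec V).Faithful ∧
    (∀ C : NecCat V, Nonempty C.Temp) ∧
    (∀ temp : ∀ C : NecCat V, C.Temp, ∃ R : NecCat V ⥤ Templicial V,
      (∀ C, R.obj C = (temp C).toTemplicial) ∧ Nonempty (Templicial.nec V ⊣ R)) ∧
    Nonempty (Coreflective (Templicial.nec V)) := by
  have hfull : (Templicial.nec V).Full := ⟨fun {Y X} => (Templicial.nec_map_bijective Y X).2⟩
  have hfaith : (Templicial.nec V).Faithful := ⟨fun {Y X} _ _ h =>
    (Templicial.nec_map_bijective Y X).1 h⟩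
  refine ⟨hfull, hfaith, NecCat.nonempty_temp, fun temp => ⟨NecCat.tempFunctor temp, fun _ => rfl,
    ⟨NecCat.tempAdjunction temp⟩⟩, ?_⟩
  let temp : ∀ C : NecCat V, C.Temp := fun C => Classical.choice (NecCat.nonempty_temp C)
  exact ⟨{ R := NecCat.tempFunctor temp, adj := NecCat.tempAdjunction temp }⟩
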